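/- **Setting.** Let $(X,d)$ be a finite metric space with $N=|X|$ points. For $A,B\subseteq X$ put $d_{sum}(A,B)=\sum_{p\in A}\sum_{q\in B}d(p,q)$, $d_{avg}(A,B)=d_{sum}(A,B)/(|A||B|)$, and write $p$ for $\{p\}$. A $k$-clustering is a partition of $X$ into $k$ nonempty clusters; its min-sum cost is $\sum_i d_{sum}(C_i,C_i)$. The instance $(X,d)$ is $\alpha$-perturbation resilient to the min-sum objective if for every $d':X\times X\to\mathbb R_{\ge 0}$ with $d\le d'\le\alpha d$ pointwise (not necessarily a metric), there is a unique optimal min-sum $k$-clustering under $d'$, and it equals the optimal $k$-clustering $\mathcal C=\{C_1,\dots,C_k\}$ under $d$. Let $D=\max_{p,q}d(p,q)$, $\rho=\min_i|C_i|/N$, $\eta=\min_{p\in X,\,1\le i\le k}d_{avg}(p,C_i)$. **Average linkage algorithm.** Input: a finite data set $S$ with its pairwise distances, $k$, and a number $m$ (the size of the smallest target cluster in $S$). Connect each point with its $\lfloor m/2\rfloor$ nearest other points; start with the connected components as clusters; repeatedly merge two clusters $A\ne A'$ of minimum $d_{avg}(A,A')$ until one cluster remains; in the resulting binary tree, whose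 leaves are the components, return a pruning (a set of nodes that partitions $S$) of minimum min-sum cost among the prunings with at most $k$ clusters. Ties are broken arbitrarily. **Theorem.** There are universal constants $c,K>0$ and one fixed program for a unit-cost real RAM such that the following holds. Let $(X,d)$ be $\alpha$-perturbation resilient to the min-sum objective with optimal $k$-clustering $\mathcal C$, where $\min_i|C_i|\ge 2$ and $$\alpha\ \ge\ 6\,\frac{\max_i|C_i|}{\min_i|C_i|-1},$$ let $0<\delta<1$, and put $L=\frac{D^2}{\rho^2\eta^2}\ln\frac{Nk}{\delta}$. Let $n\ge cL$, and let $S$ be a sample of $n$ independent uniformly distributed points of $X$ (counted with multiplicity). 1. With probability at least $1-\delta$ over $S$, the following holds for every way of breaking ties. If $\tilde{\mathcal C}$ is the output of the average linkage algorithm on $S$ with $m=\min_i|C_i\cap S|$, and each $p\in X$ is assigned to a cluster $\tilde C\in\tilde{\mathcal C}$ that minimizes $d_{sum}(p,\tilde C)$, then the resulting clustering of $X$ is the optimal clustering $\mathcal C$. 2. For every sample $S$ of size $n$, the program, given $n$, $k$, $m=\min_i|C_i\cap S|$ and the matrix of distances between the sampled points, computes an output of the average linkage algorithm on $S$ in at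 most $Kn^3$ steps. Hence if $n\le bL$, it takes at most $Kb^3L^3$ steps; in particular, for $n=\Theta(L)$ the time is $O\big(\big(\frac{D^2}{\rho^2\eta^2}\ln\frac{Nk}{\delta}\big)^3\big)$. -/

import Mathlib

open MeasureTheory Finset

/-! ### Min-sum clustering and perturbation resilience -/

section Clustering

/-- `d_sum(A, B)`, the sum of `d p q` over `p ∈ A` and `q ∈ B`. -/
def dsum {β γ : Type*} (d : β → γ → ℝ) (A : Finset β) (B : Finset γ) : ℝ :=
  ∑ p ∈ A, ∑ q ∈ B, d p q

/-- `d_avg(A, B) = d_sum(A, B) / (|A| |B|)`. -/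
noncomputable def davg {β γ : Type*} (d : β → γ → ℝ) (A : Finset β) (B : Finset γ) : ℝ :=
  dsum d A B / ((A.card : ℝ) * (B.card : ℝ))

/-- The min-sum cost of a family of clusters (sum over ordered pairs inside the clusters). -/
def minSumCost {β : Type*} (d : β → β → ℝ) (P : Finset (Finset β)) : ℝ :=
  ∑ A ∈ P, dsum d A A

/-- `C` is a minimum min-sum cost partition of the whole space into `k` (nonempty) clusters. -/
def IsOptimalClustering {X : Type*} [Fintype X] [DecidableEq X] (d : X → X → ℝ) (k : ℕ)
    (C : Finpartition (univ : Finset X)) : Prop :=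
  C.parts.card = k ∧ ∀ P : Finpartition (univ : Finset X), P.parts.card = k →
    minSumCost d C.parts ≤ minSumCost d P.parts

/-- `α`-perturbation resilience to the min-sum objective: for every (not necessarily metric)
`α`-perturbation `d'` of `d`, the optimal clustering under `d` is the one and only optimal
clustering under `d'`. -/
def IsPerturbationResilient {X : Type*} [Fintype X] [DecidableEq X] (d : X → X → ℝ) (k : ℕ)
    (α : ℝ) : Prop :=
  ∀ C : Finpartition (univ : Finset X), IsOptimalClustering d k C →
    ∀ d' : X → X → ℝ, (∀ p q, d p q ≤ d' p q ∧ d' p q ≤ α * d p q) →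
      ∀ P : Finpartition (univ : Finset X), IsOptimalClustering d' k P ↔ P = C

/-- `min_i |C_i|`. -/
noncomputable def minSize {X : Type*} [Fintype X] [DecidableEq X]
    (C : Finpartition (univ : Finset X)) : ℕ :=
  ⨅ A : C.parts, A.1.card

/-- `max_i |C_i|`. -/
noncomputable def maxSize {X : Type*} [Fintype X] [DecidableEq X]
    (C : Finpartition (univ : Finset X)) : ℕ :=
  ⨆ A : C.parts, A.1.card

/-- `ρ = min_i |C_i| / N`. -/
noncomputable def rho {X : Type*} [Fintype X] [DecidableEq X]
    (C : Finpartition (univ : Finset X)) : ℝ :=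
  (minSize C : ℝ) / (Fintype.card X : ℝ)

/-- `η`, the minimum over points `p` and clusters `C_i` of `d_avg(p, C_i)`. -/
noncomputable def eta {X : Type*} [Fintype X] [DecidableEq X] (d : X → X → ℝ)
    (C : Finpartition (univ : Finset X)) : ℝ :=
  ⨅ z : X × C.parts, davg d {z.1} z.2.1

/-- `(D² / (ρ² η²)) ln (N k / δ)`, where `D` is the diameter of `X`. -/
noncomputable def sampleBound {X : Type*} [Fintype X] [DecidableEq X] [MetricSpace X] (k : ℕ)
    (C : Finpartition (univ : Finset X)) (δ : ℝ) : ℝ :=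
  Metric.diam (Set.univ : Set X) ^ 2 / (rho C ^ 2 * eta (dist : X → X → ℝ) C ^ 2) *
    Real.log ((Fintype.card X : ℝ) * (k : ℝ) / δ)

/-- The family of the nonempty fibres of `f`. -/
def fibers {ι β : Type*} [Fintype ι] [DecidableEq ι] [DecidableEq β] (f : ι → β) :
    Finset (Finset ι) :=
  univ.image fun p => univ.filter fun q => f q = f p

end Clustering

/-! ### The average linkage algorithm -/

section AverageLinkage

variable {ι : Type*}

/-- `B` is a set of `t` nearest neighbours of `p` (other than `p`; ties are broken arbitrarily). -/
def IsNearestNeighbors (d : ι → ι → ℝ) (t : ℕ) (p : ι) (B : Finset ι) : Prop :=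
  p ∉ B ∧ B.card = t ∧ ∀ q ∈ B, ∀ r, r ∉ B → r ≠ p → d p q ≤ d p r

/-- The connected components of the undirected graph that joins each `p` to the elements of
`nn p`. -/
def components (nn : ι → Finset ι) : Set (Finset ι) :=
  {A | ∃ p, ∀ q, q ∈ A ↔ (SimpleGraph.fromRel fun a b => b ∈ nn a).Reachable p q}

/-- Binary trees of clusters. -/
inductive ClusterTree (ι : Type*) : Type _
  | leaf (A : Finset ι) : ClusterTree ι
  | node (l r : ClusterTree ι) : ClusterTree ι

/-- The cluster at the root of a tree. -/
def ClusterTree.points [DecidableEq ι] : ClusterTree ι → Finset ι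
  | .leaf A => A
  | .node l r => l.points ∪ r.points

/-- One merge: two different current clusters at minimum average distance are joined. The current
clusters are the roots of the trees of the forest. -/
def MergeStep [DecidableEq ι] (d : ι → ι → ℝ) (F F' : Set (ClusterTree ι)) : Prop :=
  ∃ T₁ ∈ F, ∃ T₂ ∈ F, T₁ ≠ T₂ ∧
    (∀ U ∈ F, ∀ V ∈ F, U ≠ V → davg d T₁.points T₂.points ≤ davg d U.points V.points) ∧
    F' = insert (ClusterTree.node T₁ T₂) (F \ {T₁, T₂})

/-- Prunings of a tree: families of nodes that partition its root cluster. -/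
inductive IsPruning [DecidableEq ι] : ClusterTree ι → Finset (Finset ι) → Prop
  | root (T : ClusterTree ι) : IsPruning T {T.points}
  | split (l r : ClusterTree ι) (P Q : Finset (Finset ι)) :
      IsPruning l P → IsPruning r Q → IsPruning (ClusterTree.node l r) (P ∪ Q)

/-- `P` is a possible output (for some way of breaking ties) of the average linkage algorithm on
the data set `ι` with distances `d`, with input `m` for the size of the smallest target cluster:
join each point to its `⌊m / 2⌋` nearest neighbours, start from the connected components, merge
clusters at minimum average distance until one is left, and return a pruning of the tree of
minimum min-sum cost among those with at most `k` clusters (in the dynamic program, a leaf of the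
tree counts as a clustering of itself into `j` clusters for every `j ≥ 1`, so fewer than `k`
clusters are allowed). -/
def IsAverageLinkageOutput [DecidableEq ι] (d : ι → ι → ℝ) (m k : ℕ)
    (P : Finset (Finset ι)) : Prop :=
  ∃ nn : ι → Finset ι, (∀ p, IsNearestNeighbors d (m / 2) p (nn p)) ∧
    ∃ T : ClusterTree ι,
      Relation.ReflTransGen (MergeStep d) (ClusterTree.leaf '' components nn) {T} ∧
      IsPruning T P ∧ P.card ≤ k ∧
      ∀ Q, IsPruning T Q → Q.card ≤ k → minSumCost d P ≤ minSumCost d Q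

end AverageLinkage

/-! ### Sampling and the implicit clustering -/

section Sample

variable {X : Type*} [Fintype X] [DecidableEq X]

/-- The smallest size `min_i |C_i ∩ S|` of an optimal cluster in the sample `x`, counted with
multiplicity. -/
noncomputable def sampleMinSize (C : Finpartition (univ : Finset X)) {n : ℕ} (x : Fin n → X) : ℕ :=
  ⨅ A : C.parts, (univ.filter fun a => x a ∈ A.1).card

/-- The distances between the sampled points. -/
def sampleDist [MetricSpace X] {n : ℕ} (x : Fin n → X) (a b : Fin n) : ℝ := dist (x a) (x b)

/-- The implicit clustering given by a clustering `P` of the sample is `C`: however each point `p`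
of the whole space is assigned to a cluster of `P` that minimizes `d_sum(p, ·)`, the resulting
clusters are those of `C`. -/
def ImplicitClusteringIs [MetricSpace X] {n : ℕ} (x : Fin n → X) (P : Finset (Finset (Fin n)))
    (C : Finpartition (univ : Finset X)) : Prop :=
  ∀ f : X → Finset (Fin n),
    (∀ p, f p ∈ P ∧ ∀ B ∈ P,
      dsum (fun q a => dist q (x a)) {p} (f p) ≤ dsum (fun q a => dist q (x a)) {p} B) →
    fibers f = C.parts

/-- The law of `n` independent uniformly distributed points of `X`. -/
noncomputable def sampleLaw (X : Type*) [MeasurableSpace X] (n : ℕ) : Measure (Fin n → X) :=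
  Measure.pi fun _ => ProbabilityTheory.uniformOn (Set.univ : Set X)

end Sample

/-! ### The machine model: a unit-cost real RAM programmed with bounded loops

The memory consists of arrays of natural numbers and arrays of real numbers, named by natural
numbers and having two indices. A program is a fixed finite piece of syntax. Every node of an
expression that is evaluated, every command that is executed and every pass through a loop
costs one step. There is no conversion from real to natural numbers. -/

namespace RealRAM

structure State where
  nat : ℕ → ℕ → ℕ → ℕ
  real : ℕ → ℕ → ℕ → ℝ

def State.setNat (s : State) (a i j v : ℕ) : State :=
  { s with nat := fun a' i' j' => if a' = a ∧ i' = i ∧ j' = j then v else s.nat a' i' j' }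

def State.setReal (s : State) (a i j : ℕ) (v : ℝ) : State :=
  { s with real := fun a' i' j' => if a' = a ∧ i' = i ∧ j' = j then v else s.real a' i' j' }

/-- Expressions with values in the natural numbers (`sub` is truncated subtraction). -/
inductive NExp : Type
  | const (c : ℕ) : NExp
  | get (a : ℕ) (i j : NExp) : NExp
  | add (e f : NExp) : NExp
  | sub (e f : NExp) : NExp

def NExp.eval (s : State) : NExp → ℕ
  | .const c => c
  | .get a i j => s.nat a (i.eval s) (j.eval s)
  | .add e f => e.eval s + f.eval s
  | .sub e f => e.eval s - f.eval s

def NExp.cost : NExp → ℕ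
  | .const _ => 1
  | .get _ i j => 1 + i.cost + j.cost
  | .add e f => 1 + e.cost + f.cost
  | .sub e f => 1 + e.cost + f.cost

/-- Expressions with values in the real numbers. -/
inductive RExp : Type
  | ofNat (e : NExp) : RExp
  | get (a : ℕ) (i j : NExp) : RExp
  | add (e f : RExp) : RExp
  | sub (e f : RExp) : RExp
  | mul (e f : RExp) : RExp
  | div (e f : RExp) : RExp

noncomputable def RExp.eval (s : State) : RExp → ℝ
  | .ofNat e => (e.eval s : ℝ)
  | .get a i j => s.real a (i.eval s) (j.eval s)
  | .add e f => e.eval s + f.eval s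
  | .sub e f => e.eval s - f.eval s
  | .mul e f => e.eval s * f.eval s
  | .div e f => e.eval s / f.eval s

def RExp.cost : RExp → ℕ
  | .ofNat e => 1 + e.cost
  | .get _ i j => 1 + i.cost + j.cost
  | .add e f => 1 + e.cost + f.cost
  | .sub e f => 1 + e.cost + f.cost
  | .mul e f => 1 + e.cost + f.cost
  | .div e f => 1 + e.cost + f.cost

/-- Tests. -/
inductive Test : Type
  | natLt (e f : NExp) : Test
  | natEq (e f : NExp) : Test
  | realLt (e f : RExp) : Test
  | not (b : Test) : Test
  | and (b c : Test) : Test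
  | or (b c : Test) : Test

def Test.Holds (s : State) : Test → Prop
  | .natLt e f => e.eval s < f.eval s
  | .natEq e f => e.eval s = f.eval s
  | .realLt e f => e.eval s < f.eval s
  | .not b => ¬ b.Holds s
  | .and b c => b.Holds s ∧ c.Holds s
  | .or b c => b.Holds s ∨ c.Holds s

def Test.cost : Test → ℕ
  | .natLt e f => 1 + e.cost + f.cost
  | .natEq e f => 1 + e.cost + f.cost
  | .realLt e f => 1 + e.cost + f.cost
  | .not b => 1 + b.cost
  | .and b c => 1 + b.cost + c.cost
  | .or b c => 1 + b.cost + c.cost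

/-- Commands. `loop v e c` evaluates `e` once and then runs `c` that many times, the counter
`0, 1, 2, …` being stored in entry `(0, 0)` of the natural number array `v` before each pass. -/
inductive Cmd : Type
  | skip : Cmd
  | setNat (a : ℕ) (i j e : NExp) : Cmd
  | setReal (a : ℕ) (i j : NExp) (e : RExp) : Cmd
  | seq (c c' : Cmd) : Cmd
  | ite (b : Test) (c c' : Cmd) : Cmd
  | loop (v : ℕ) (e : NExp) (c : Cmd) : Cmd

open scoped Classical in
/-- The final state of a command and the number of steps it takes. -/
noncomputable def Cmd.run : Cmd → State → State × ℕ
  | .skip, s => (s, 1)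
  | .setNat a i j e, s =>
      (s.setNat a (i.eval s) (j.eval s) (e.eval s), 1 + i.cost + j.cost + e.cost)
  | .setReal a i j e, s =>
      (s.setReal a (i.eval s) (j.eval s) (e.eval s), 1 + i.cost + j.cost + e.cost)
  | .seq c c', s =>
      ((c'.run (c.run s).1).1, 1 + (c.run s).2 + (c'.run (c.run s).1).2)
  | .ite b c c', s =>
      if b.Holds s then ((c.run s).1, 1 + b.cost + (c.run s).2)
      else ((c'.run s).1, 1 + b.cost + (c'.run s).2)
  | .loop v e c, s =>
      Nat.rec (s, 1 + e.cost)
        (fun t r => ((c.run (r.1.setNat v 0 0 t)).1, r.2 + 1 + (c.run (r.1.setNat v 0 0 t)).2))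
        (e.eval s)

/-- The initial state for the input `n`, `k`, `m` and the `n × n` matrix `d`: the three numbers
stand in the entries `(0, 0)`, `(0, 1)`, `(0, 2)` of the natural number array `0`, the matrix in
the real array `0`, and everything else is zero. -/
noncomputable def input (n k m : ℕ) (d : Fin n → Fin n → ℝ) : State where
  nat := fun a i j =>
    if a = 0 ∧ i = 0 then (if j = 0 then n else if j = 1 then k else if j = 2 then m else 0) else 0
  real := fun a i j =>
    if h : a = 0 ∧ i < n ∧ j < n then d ⟨i, h.2.1⟩ ⟨j, h.2.2⟩ else 0

/-- The number of steps of a program on an input. -/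
noncomputable def steps (c : Cmd) (n k m : ℕ) (d : Fin n → Fin n → ℝ) : ℕ :=
  (c.run (input n k m d)).2

/-- The clustering of `Fin n` computed by a program: the label of the point `a` is the final value
of entry `(a, 0)` of the natural number array `1`, and the clusters are the classes of points with
equal labels. -/
noncomputable def output (c : Cmd) (n k m : ℕ) (d : Fin n → Fin n → ℝ) : Finset (Finset (Fin n)) :=
  fibers fun a : Fin n => (c.run (input n k m d)).1.nat 1 a 0

end RealRAM

/-! ### Sums of distances -/

section Dsum

variable {β γ : Type*}

/-! Perturb the metric by multiplying exactly the distances inside the optimal clusters by `α`.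
Since the optimal clustering stays the only optimum, any other `k`-clustering separates pairs whose
total distance, even times `α`, is less than the total distance of the pairs that it newly joins
(`IsPerturbationResilient.relabel`). Two competitors suffice. Moving a point `p` from its cluster
`A` to `B` gives `α d_sum(p, A) < d_sum(p, B)`. Merging `I` and `J` while splitting a third cluster
`L` into `B` and `B'` gives `α d_sum(B, B') < d_sum(I, J)`. A balanced split keeps an eighth of the
cost of `L`, so, as `α ≥ 6`, no cluster costs more than `4/3` of `d_sum(I, J)`.

Both facts survive sampling. By Hoeffding's inequality and a union bound over the `N k` pairs of a
point and a cluster, with probability at least `1 - δ` the sample reproduces all cluster sizes and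
all sums `d_sum(p, C_i)` up to a factor `1 ± 1/20` (`sampleLaw_real_representative_ge`). The sampled
classes then satisfy `IsSeparated`: `4 |S_l|` times the distance sum of a point to its own class is
at most `m` times its sum to any other class, and every class costs less than twice the distance sum
of any two classes. The gaps between `6` and `4` and between `4/3` and `2` absorb the sampling
errors.

For separated classes average linkage is analysed deterministically. Nearest neighbours lie in the
same class, so the initial components are inside classes and have at least `m / 2` points. Every
later cluster is inside a class or a union of classes: if `T` is a proper part of a class, the rest
`R` of that class has at least `m / 2` points, and `d_avg(T, R) < d_avg(T, U)` for every cluster `U`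
outside the class (`IsSeparated.davg_rest_lt`). Some current cluster in `R` is on average no farther
from `T` than `R` is, so `T` and `U` are not a closest pair. Hence the classes form a pruning of the
final tree. It is the cheapest one with at most `k` clusters by a Lagrange multiplier argument: for
a price `c` per cluster between the largest cost of a class and twice the smallest distance sum of
two classes, the classes are the only minimizer of cost plus price among all prunings
(`IsPruning.lagrangian`). Assigning points of `X` by `d_sum` to the sampled classes then gives back
the optimal clustering.

The program keeps labels, sizes and pairwise distance sums of the current clusters, so that one
union takes linear time and a search for the closest pair quadratic time. The dynamic program over
prunings is run along with the merging: each cluster carries, for every `j ≤ k`, the best cost with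
at most `j` clusters and the labels that attain it. All loops have length `n` or `k ≤ n` and are
nested at most three deep, which gives the cubic bound syntactically (`Cmd.run_snd_le`). Correctness
is a chain of loop invariants. -/

theorem dsum_singleton_left (d : β → γ → ℝ) (a : β) (B : Finset γ) :
    dsum d {a} B = ∑ q ∈ B, d a q := by simp [dsum]

theorem dsum_eq_sum_singleton (d : β → γ → ℝ) (A : Finset β) (B : Finset γ) :
    dsum d A B = ∑ a ∈ A, dsum d {a} B := by simp [dsum]

theorem dsum_comm {d : β → β → ℝ} (hd : ∀ a b, d a b = d b a) (A B : Finset β) :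
    dsum d A B = dsum d B A := by
  unfold dsum
  rw [Finset.sum_comm]
  exact Finset.sum_congr rfl fun _ _ => Finset.sum_congr rfl fun _ _ => hd _ _

theorem dsum_nonneg {d : β → γ → ℝ} (hd : ∀ a b, 0 ≤ d a b) (A : Finset β) (B : Finset γ) :
    0 ≤ dsum d A B :=
  Finset.sum_nonneg fun _ _ => Finset.sum_nonneg fun _ _ => hd _ _

theorem dsum_mono_right {d : β → γ → ℝ} (hd : ∀ a b, 0 ≤ d a b) (A : Finset β) {B B' : Finset γ}
    (h : B ⊆ B') : dsum d A B ≤ dsum d A B' :=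
  Finset.sum_le_sum fun _ _ => Finset.sum_le_sum_of_subset_of_nonneg h fun _ _ _ => hd _ _

theorem dsum_union_left [DecidableEq β] (d : β → γ → ℝ) {A A' : Finset β} (h : Disjoint A A')
    (B : Finset γ) : dsum d (A ∪ A') B = dsum d A B + dsum d A' B :=
  Finset.sum_union h

theorem dsum_union_right [DecidableEq γ] (d : β → γ → ℝ) (A : Finset β) {B B' : Finset γ}
    (h : Disjoint B B') : dsum d A (B ∪ B') = dsum d A B + dsum d A B' := by
  simp [dsum, Finset.sum_union h, Finset.sum_add_distrib]

theorem dsum_biUnion_right {κ : Type*} [DecidableEq γ] (d : β → γ → ℝ) (A : Finset β)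
    (J : Finset κ) (S : κ → Finset γ) (h : (J : Set κ).PairwiseDisjoint S) :
    dsum d A (J.biUnion S) = ∑ j ∈ J, dsum d A (S j) := by
  calc dsum d A (J.biUnion S) = ∑ p ∈ A, ∑ j ∈ J, ∑ q ∈ S j, d p q :=
        Finset.sum_congr rfl fun _ _ => Finset.sum_biUnion h
    _ = _ := Finset.sum_comm

/-- Sum the triangle inequality over all triples: each pair is counted once for every element of the
third set. This averaged form is the only way in which the metric enters the analysis of average
linkage. -/
theorem dsum_triangle {d : β → β → ℝ} (hd : ∀ a b c, d a c ≤ d a b + d b c) (A B C : Finset β) :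
    (B.card : ℝ) * dsum d A C ≤ C.card * dsum d A B + A.card * dsum d B C := by
  have h : ∑ a ∈ A, ∑ b ∈ B, ∑ c ∈ C, d a c ≤ ∑ a ∈ A, ∑ b ∈ B, ∑ c ∈ C, (d a b + d b c) :=
    Finset.sum_le_sum fun a _ => Finset.sum_le_sum fun b _ => Finset.sum_le_sum fun c _ => hd a b c
  simp only [Finset.sum_add_distrib, Finset.sum_const, nsmul_eq_mul] at h
  simp only [dsum, Finset.mul_sum] at h ⊢
  exact h

theorem dsum_pos {d : β → γ → ℝ} {A : Finset β} {B : Finset γ} (hA : A.Nonempty)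
    (hB : B.Nonempty) (h : ∀ a ∈ A, ∀ b ∈ B, 0 < d a b) : 0 < dsum d A B :=
  Finset.sum_pos (fun a ha => Finset.sum_pos (h a ha) hB) hA

end Dsum

/-! ### Trees of clusters -/

section Trees

variable {ι : Type*} [DecidableEq ι]

/-- The leaves are nonempty and the children of a node are disjoint. -/
def ClusterTree.WF : ClusterTree ι → Prop
  | .leaf A => A.Nonempty
  | .node l r => l.WF ∧ r.WF ∧ Disjoint l.points r.points

theorem ClusterTree.WF.nonempty {T : ClusterTree ι} (h : T.WF) : T.points.Nonempty := by
  induction T with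
  | leaf A => exact h
  | node l r ihl _ => exact (ihl h.1).mono Finset.subset_union_left

theorem IsPruning.subset {T : ClusterTree ι} {P : Finset (Finset ι)} (h : IsPruning T P) :
    ∀ A ∈ P, A ⊆ T.points := by
  induction h with
  | root T => simp
  | split l r P Q _ _ ihP ihQ =>
    intro A hA
    rcases Finset.mem_union.1 hA with hA | hA
    · exact (ihP A hA).trans Finset.subset_union_left
    · exact (ihQ A hA).trans Finset.subset_union_right

theorem IsPruning.nonempty_of_mem {T : ClusterTree ι} {P : Finset (Finset ι)} (h : IsPruning T P)
    (hT : T.WF) : ∀ A ∈ P, A.Nonempty := by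
  induction h with
  | root T => simpa using hT.nonempty
  | split l r P Q _ _ ihP ihQ =>
    intro A hA
    rcases Finset.mem_union.1 hA with hA | hA
    · exact ihP hT.1 A hA
    · exact ihQ hT.2.1 A hA

theorem IsPruning.nonempty {T : ClusterTree ι} {P : Finset (Finset ι)} (h : IsPruning T P) :
    P.Nonempty := by
  induction h with
  | root T => simp
  | split l r P Q _ _ ihP _ => exact ihP.mono Finset.subset_union_left

theorem IsPruning.exists_mem {T : ClusterTree ι} {P : Finset (Finset ι)} (h : IsPruning T P) :
    ∀ a ∈ T.points, ∃ A ∈ P, a ∈ A := by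
  induction h with
  | root T => simp
  | split l r P Q _ _ ihP ihQ =>
    intro a ha
    rcases Finset.mem_union.1 ha with ha | ha
    · obtain ⟨A, hA, h⟩ := ihP a ha
      exact ⟨A, Finset.mem_union_left _ hA, h⟩
    · obtain ⟨A, hA, h⟩ := ihQ a ha
      exact ⟨A, Finset.mem_union_right _ hA, h⟩

theorem IsPruning.eq_of_mem {T : ClusterTree ι} {P : Finset (Finset ι)} (h : IsPruning T P)
    (hT : T.WF) : ∀ A ∈ P, ∀ B ∈ P, ∀ a, a ∈ A → a ∈ B → A = B := by
  induction h with
  | root T => simp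
  | split l r P Q hP hQ ihP ihQ =>
    intro A hA B hB a haA haB
    have hd := Finset.disjoint_left.1 hT.2.2
    rcases Finset.mem_union.1 hA with hA | hA <;> rcases Finset.mem_union.1 hB with hB | hB
    · exact ihP hT.1 A hA B hB a haA haB
    · exact absurd (hQ.subset B hB haB) (hd (hP.subset A hA haA))
    · exact absurd (hQ.subset A hA haA) (hd (hP.subset B hB haB))
    · exact ihQ hT.2.1 A hA B hB a haA haB

/-- Well-formedness matters because the empty set could be a cluster on both sides. Disjointness
lets cost and number of clusters add up over the two subtrees. -/
theorem IsPruning.disjoint {l r : ClusterTree ι} {P Q : Finset (Finset ι)} (hP : IsPruning l P)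
    (hQ : IsPruning r Q) (hT : (ClusterTree.node l r).WF) : Disjoint P Q := by
  rw [Finset.disjoint_left]
  intro A hA hA'
  obtain ⟨a, ha⟩ := hP.nonempty_of_mem hT.1 A hA
  exact Finset.disjoint_left.1 hT.2.2 (hP.subset A hA ha) (hQ.subset A hA' ha)

theorem minSumCost_union (d : ι → ι → ℝ) {P Q : Finset (Finset ι)} (h : Disjoint P Q) :
    minSumCost d (P ∪ Q) = minSumCost d P + minSumCost d Q :=
  Finset.sum_union h

end Trees

/-! ### Forests that respect a target clustering -/

section Laminar

variable {ι κ : Type*}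

/-- All points of `A` have the same label. -/
def IsPure (g : ι → κ) (A : Finset ι) : Prop := ∃ i, ∀ a ∈ A, g a = i

/-- `A` is a union of classes of the labelling `g`. -/
def IsSaturated (g : ι → κ) (A : Finset ι) : Prop := ∀ a ∈ A, ∀ b, g b = g a → b ∈ A

variable [DecidableEq ι]

/-- The leaves are pure, and every node is pure or saturated. -/
def ClusterTree.Laminar (g : ι → κ) : ClusterTree ι → Prop
  | .leaf A => IsPure g A
  | .node l r => l.Laminar g ∧ r.Laminar g ∧
      (IsPure g (l.points ∪ r.points) ∨ IsSaturated g (l.points ∪ r.points))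

theorem ClusterTree.Laminar.pure_or_saturated {g : ι → κ} {T : ClusterTree ι} (h : T.Laminar g) :
    IsPure g T.points ∨ IsSaturated g T.points := by
  cases T with
  | leaf A => exact Or.inl h
  | node l r => exact h.2.2

variable [Fintype ι] [DecidableEq κ]

/-- The class of the label `i`. -/
def labelClass (g : ι → κ) (i : κ) : Finset ι := univ.filter fun a => g a = i

@[simp] theorem mem_labelClass {g : ι → κ} {i : κ} {a : ι} : a ∈ labelClass g i ↔ g a = i := by
  simp [labelClass]

theorem labelClass_pairwiseDisjoint (g : ι → κ) (J : Set κ) : J.PairwiseDisjoint (labelClass g) := by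
  intro i _ j _ hij
  simp only [Function.onFun, Finset.disjoint_left, mem_labelClass]
  rintro a rfl h
  exact hij h

theorem IsSaturated.eq_biUnion {g : ι → κ} {A : Finset ι} (h : IsSaturated g A) :
    A = (A.image g).biUnion (labelClass g) := by
  ext a
  simp only [mem_biUnion, mem_image, mem_labelClass]
  constructor
  · exact fun ha => ⟨g a, ⟨a, ha, rfl⟩, rfl⟩
  · rintro ⟨_, ⟨b, hb, rfl⟩, hab⟩
    exact h b hb a hab

theorem IsPure.eq_labelClass {g : ι → κ} {A : Finset ι} (h : IsPure g A) (h' : IsSaturated g A)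
    {a : ι} (ha : a ∈ A) : A = labelClass g (g a) := by
  obtain ⟨i, hi⟩ := h
  ext b
  rw [mem_labelClass]
  exact ⟨fun hb => (hi b hb).trans (hi a ha).symm, fun hb => h' a ha b hb⟩

/-- The children of a saturated node that is not a single class are saturated. -/
theorem ClusterTree.Laminar.children {g : ι → κ} {l r : ClusterTree ι}
    (hL : (ClusterTree.node l r).Laminar g) (hW : (ClusterTree.node l r).WF)
    (hS : IsSaturated g (ClusterTree.node l r).points) :
    IsPure g (ClusterTree.node l r).points ∨
      (IsSaturated g l.points ∧ IsSaturated g r.points) := by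
  have hS' : ∀ a ∈ l.points ∪ r.points, ∀ b, g b = g a → b ∈ l.points ∪ r.points := hS
  -- Inside a saturated union of two disjoint sets, the complement of a saturated set is saturated.
  have key : ∀ A B : Finset ι, (∀ a ∈ A ∪ B, ∀ b, g b = g a → b ∈ A ∪ B) → Disjoint A B →
      IsSaturated g A → IsSaturated g B := by
    intro A B h hd hA b hb c hc
    rcases Finset.mem_union.1 (h b (Finset.mem_union_right _ hb) c hc) with h1 | h1
    · exact absurd hb (Finset.disjoint_left.1 hd (hA c h1 b hc.symm))
    · exact h1
  rcases hL.1.pure_or_saturated with hl | hl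
  · rcases hL.2.1.pure_or_saturated with hr | hr
    · obtain ⟨a, ha⟩ := hW.1.nonempty
      by_cases h : ∃ b ∈ r.points, g b = g a
      · left
        obtain ⟨b, hb, hab⟩ := h
        obtain ⟨i, hi⟩ := hl
        obtain ⟨j, hj⟩ := hr
        refine ⟨i, fun c hc => ?_⟩
        rcases Finset.mem_union.1 hc with hc | hc
        · exact hi c hc
        · rw [hj c hc, ← hj b hb, hab, hi a ha]
      · right
        push Not at h
        have h1 : IsSaturated g l.points := by
          intro c hc b hb
          obtain ⟨i, hi⟩ := hl
          rcases Finset.mem_union.1 (hS' c (Finset.mem_union_left _ hc) b hb) with h1 | h1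
          · exact h1
          · exact absurd (hb.trans ((hi c hc).trans (hi a ha).symm)) (h b h1)
        exact ⟨h1, key _ _ hS' hW.2.2 h1⟩
    · right
      refine ⟨key r.points l.points ?_ hW.2.2.symm hr, hr⟩
      rw [Finset.union_comm]; exact hS'
  · exact Or.inr ⟨hl, key _ _ hS' hW.2.2 hl⟩

/-- The classes inside a saturated node form a pruning. -/
theorem ClusterTree.Laminar.isPruning_image {g : ι → κ} {T : ClusterTree ι} (hL : T.Laminar g)
    (hW : T.WF) (hS : IsSaturated g T.points) :
    IsPruning T ((T.points.image g).image (labelClass g)) := by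
  have pure_case : ∀ T : ClusterTree ι, T.WF → IsSaturated g T.points → IsPure g T.points →
      IsPruning T ((T.points.image g).image (labelClass g)) := by
    intro T hW hS hP
    obtain ⟨a, ha⟩ := hW.nonempty
    have h1 : T.points.image g = {g a} := by
      obtain ⟨i, hi⟩ := hP
      ext j
      simp only [mem_image, mem_singleton]
      exact ⟨fun ⟨b, hb, h⟩ => by rw [← h, hi b hb, hi a ha], fun h => ⟨a, ha, h.symm⟩⟩
    rw [h1, Finset.image_singleton, ← hP.eq_labelClass hS ha]
    exact IsPruning.root T
  induction T with
  | leaf A => exact pure_case _ hW hS hL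
  | node l r ihl ihr =>
    rcases hL.children hW hS with h | ⟨h1, h2⟩
    · exact pure_case _ hW hS h
    · have := IsPruning.split l r _ _ (ihl hL.1 hW.1 h1) (ihr hL.2.1 hW.2.1 h2)
      rwa [← Finset.image_union, ← Finset.image_union] at this

/-- With a price `c` per cluster that exceeds the cost of every class and is less than twice the
distance of any two classes, the classes are the only cheapest pruning. -/
theorem IsPruning.lagrangian {d : ι → ι → ℝ} (hd : ∀ a b, 0 ≤ d a b) {g : ι → κ} {c : ℝ}
    (hc : ∀ i, dsum d (labelClass g i) (labelClass g i) < c)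
    (hc' : ∀ i j, i ≠ j → labelClass g i ≠ ∅ → labelClass g j ≠ ∅ →
      c < 2 * dsum d (labelClass g i) (labelClass g j))
    {T : ClusterTree ι} {P : Finset (Finset ι)} (hP : IsPruning T P) (hL : T.Laminar g)
    (hW : T.WF) (hS : IsSaturated g T.points) :
    (∑ i ∈ T.points.image g, (dsum d (labelClass g i) (labelClass g i) + c)
      < ∑ A ∈ P, (dsum d A A + c)) ∨ P = (T.points.image g).image (labelClass g) := by
  induction hP with
  | root T =>
    by_cases hpure : IsPure g T.points
    · right
      obtain ⟨a, ha⟩ := hW.nonempty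
      have h1 : T.points.image g = {g a} := by
        obtain ⟨i, hi⟩ := hpure
        ext j
        simp only [mem_image, mem_singleton]
        exact ⟨fun ⟨b, hb, h⟩ => by rw [← h, hi b hb, hi a ha], fun h => ⟨a, ha, h.symm⟩⟩
      rw [h1, Finset.image_singleton, ← hpure.eq_labelClass hS ha]
    · left
      set J := T.points.image g with hJ
      have hne : ∀ i ∈ J, labelClass g i ≠ ∅ := by
        intro i hi
        obtain ⟨a, _, rfl⟩ := Finset.mem_image.1 hi
        exact Finset.ne_empty_of_mem (mem_labelClass.2 rfl)
      have hJ2 : 2 ≤ J.card := by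
        by_contra hlt
        apply hpure
        obtain ⟨a, ha⟩ := hW.nonempty
        have h1 : J.card ≤ 1 := by omega
        exact ⟨g a, fun b hb => Finset.card_le_one.1 h1 _ (Finset.mem_image_of_mem g hb) _
          (Finset.mem_image_of_mem g ha)⟩
      have hexp : dsum d T.points T.points =
          ∑ i ∈ J, ∑ j ∈ J, dsum d (labelClass g i) (labelClass g j) := by
        conv_lhs => rw [hS.eq_biUnion]
        rw [← hJ, dsum_biUnion_right _ _ _ _ (labelClass_pairwiseDisjoint g _), Finset.sum_comm]
        refine Finset.sum_congr rfl fun j _ => ?_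
        unfold dsum
        exact Finset.sum_biUnion (labelClass_pairwiseDisjoint g _)
      -- Each of the other `|J| - 1` classes contributes more than `c / 2` to the row of `i`.
      have hrow : ∀ i ∈ J, dsum d (labelClass g i) (labelClass g i) + ((J.card : ℝ) - 1) * (c / 2) <
          ∑ j ∈ J, dsum d (labelClass g i) (labelClass g j) := by
        intro i hi
        rw [← Finset.add_sum_erase _ _ hi]
        have hcard : ((J.erase i).card : ℝ) = (J.card : ℝ) - 1 := by
          rw [Finset.card_erase_of_mem hi, Nat.cast_sub (by omega)]; simp
        have : ∑ j ∈ J.erase i, c / 2 <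
            ∑ j ∈ J.erase i, dsum d (labelClass g i) (labelClass g j) := by
          apply Finset.sum_lt_sum_of_nonempty
          · rw [← Finset.card_pos, Finset.card_erase_of_mem hi]; omega
          · intro j hj
            have := hc' i j (Finset.ne_of_mem_erase hj).symm (hne i hi)
              (hne j (Finset.mem_of_mem_erase hj))
            linarith
        rw [Finset.sum_const, nsmul_eq_mul, hcard] at this
        linarith
      have hJne : J.Nonempty := Finset.card_pos.1 (by omega)
      have hsum := Finset.sum_lt_sum_of_nonempty hJne hrow
      rw [Finset.sum_singleton, hexp]
      refine lt_of_le_of_lt ?_ (add_lt_add_left hsum c)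
      simp only [Finset.sum_add_distrib, Finset.sum_const, nsmul_eq_mul]
      obtain ⟨i, hi⟩ := hJne
      have hcpos : 0 ≤ c := (dsum_nonneg hd _ _).trans (hc i).le
      have h2 : (2 : ℝ) ≤ J.card := by exact_mod_cast hJ2
      -- Not splitting `j` classes saves `(j - 1) c` in price and adds more than `j (j - 1) c / 2`
      -- in cost. This is no gain because `(j - 1)(j - 2) ≥ 0`.
      nlinarith [mul_nonneg (mul_nonneg (sub_nonneg.2 h2) (by linarith : (0:ℝ) ≤ (J.card : ℝ) - 1)) hcpos]
  | split l r P Q hP hQ ihP ihQ =>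
    have hdis := hP.disjoint hQ hW
    rcases hL.children hW hS with h | ⟨h1, h2⟩
    · left
      obtain ⟨a, ha⟩ := hW.nonempty
      have hi1 : (ClusterTree.node l r).points.image g = {g a} := by
        obtain ⟨i, hi⟩ := h
        ext j
        simp only [mem_image, mem_singleton]
        exact ⟨fun ⟨b, hb, h⟩ => by rw [← h, hi b hb, hi a ha], fun h => ⟨a, ha, h.symm⟩⟩
      rw [hi1, Finset.sum_singleton, Finset.sum_union hdis]
      -- A single class that is split pays the price at least twice, and the second price exceeds
      -- the whole cost of the class.
      have hge : ∀ P : Finset (Finset ι), P.Nonempty → c ≤ ∑ A ∈ P, (dsum d A A + c) := by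
        rintro P ⟨A, hA⟩
        have hcpos : 0 ≤ c := (dsum_nonneg hd _ _).trans (hc (g a)).le
        refine le_trans ?_ (Finset.single_le_sum (f := fun A => dsum d A A + c) (fun B _ => ?_) hA)
        · simpa using dsum_nonneg hd A A
        · exact add_nonneg (dsum_nonneg hd _ _) hcpos
      linarith [hge P hP.nonempty, hge Q hQ.nonempty, hc (g a)]
    · have hJ : (ClusterTree.node l r).points.image g = l.points.image g ∪ r.points.image g :=
        Finset.image_union _ _
      have hJd : Disjoint (l.points.image g) (r.points.image g) := by
        rw [Finset.disjoint_left]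
        intro i hi hi'
        obtain ⟨a, ha, rfl⟩ := Finset.mem_image.1 hi
        obtain ⟨b, hb, hab⟩ := Finset.mem_image.1 hi'
        exact Finset.disjoint_left.1 hW.2.2 (h1 a ha b hab) hb
      rw [hJ, Finset.sum_union hJd, Finset.sum_union hdis, Finset.image_union]
      have hle : ∀ {J : Finset κ} {P : Finset (Finset ι)},
          (∀ i ∈ J, labelClass g i ≠ ∅) →
          ((∑ i ∈ J, (dsum d (labelClass g i) (labelClass g i) + c)
            < ∑ A ∈ P, (dsum d A A + c)) ∨ P = J.image (labelClass g)) →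
          ∑ i ∈ J, (dsum d (labelClass g i) (labelClass g i) + c) ≤ ∑ A ∈ P, (dsum d A A + c) := by
        rintro J P hne (h | rfl)
        · exact h.le
        · rw [Finset.sum_image]
          intro i hi j hj hij
          obtain ⟨a, ha⟩ := Finset.nonempty_iff_ne_empty.2 (hne i hi)
          have hb : a ∈ labelClass g j := by
            have : labelClass g i = labelClass g j := hij
            rwa [← this]
          rw [mem_labelClass] at ha hb
          rw [← ha, hb]
      have hne : ∀ A : Finset ι, ∀ i ∈ A.image g, labelClass g i ≠ ∅ := by
        intro A i hi
        obtain ⟨a, _, rfl⟩ := Finset.mem_image.1 hi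
        exact Finset.ne_empty_of_mem (mem_labelClass.2 rfl)
      have il := ihP hL.1 hW.1 h1
      have ir := ihQ hL.2.1 hW.2.1 h2
      rcases il with il | rfl
      · left; linarith [hle (hne _) ir]
      · rcases ir with ir | rfl
        · left; linarith [hle (P := (l.points.image g).image (labelClass g)) (hne l.points) (Or.inr rfl)]
        · exact Or.inr rfl

end Laminar

/-! ### Average linkage on separated classes -/

section Deterministic

variable {ι κ : Type*} [Fintype ι] [DecidableEq ι] [Fintype κ] [DecidableEq κ]

/-- The separation of the classes of `g` that makes average linkage with parameter `m` work. -/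
structure IsSeparated (d : ι → ι → ℝ) (g : ι → κ) (m : ℕ) : Prop where
  nonneg : ∀ a b, 0 ≤ d a b
  symm : ∀ a b, d a b = d b a
  triangle : ∀ a b c, d a c ≤ d a b + d b c
  pos : ∀ a b, g a ≠ g b → 0 < d a b
  le_card : ∀ i, m ≤ (labelClass g i).card
  m_pos : 0 < m
  near : ∀ a j l, j ≠ g a →
    4 * ((labelClass g l).card : ℝ) * dsum d {a} (labelClass g (g a)) ≤
      m * dsum d {a} (labelClass g j)
  cost_lt : ∀ i j l, i ≠ j →
    dsum d (labelClass g l) (labelClass g l) < 2 * dsum d (labelClass g i) (labelClass g j)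

namespace IsSeparated

variable {d : ι → ι → ℝ} {g : ι → κ} {m : ℕ}

/-- The condition on points is linear in the point and can be summed over any part of a class. -/
theorem near_set (h : IsSeparated d g m) {A : Finset ι} {i : κ} (hA : ∀ a ∈ A, g a = i) (j l : κ)
    (hij : j ≠ i) :
    4 * ((labelClass g l).card : ℝ) * dsum d A (labelClass g i) ≤
      m * dsum d A (labelClass g j) := by
  rw [dsum_eq_sum_singleton d A, dsum_eq_sum_singleton d A, Finset.mul_sum, Finset.mul_sum]
  refine Finset.sum_le_sum fun a ha => ?_
  have := h.near a j l (by rw [hA a ha]; exact hij)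
  rwa [hA a ha] at this

/-- The nearest neighbours of a point are in its class. -/
theorem nearestNeighbors_pure (h : IsSeparated d g m) {a b : ι} {B : Finset ι}
    (hB : IsNearestNeighbors d (m / 2) a B) (hb : b ∈ B) : g b = g a := by
  by_contra hne
  obtain ⟨haB, hcard, hmin⟩ := hB
  set Si := labelClass g (g a)
  set Sj := labelClass g (g b)
  have hpos : 0 < d a b := h.pos a b (Ne.symm hne)
  -- the points of the class that are not closer than `b`
  have hsub : B ∩ Si ⊆ B.erase b := by
    intro c hc
    obtain ⟨h1, h2⟩ := Finset.mem_inter.1 hc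
    refine Finset.mem_erase.2 ⟨?_, h1⟩
    rintro rfl
    exact hne (mem_labelClass.1 h2)
  have hc1 : (B ∩ Si).card ≤ m / 2 - 1 := by
    have := Finset.card_le_card hsub
    rwa [Finset.card_erase_of_mem hb, hcard] at this
  have hB1 : 1 ≤ m / 2 := by rw [← hcard]; exact Finset.card_pos.2 ⟨b, hb⟩
  have ha : a ∈ Si := mem_labelClass.2 rfl
  have hm : m ≤ Si.card := h.le_card _
  -- The neighbours include `b`, so at most `⌊m / 2⌋ - 1` of them are in the class of `a`. Removing
  -- these and `a` itself leaves at least half of the class, all at distance at least `d a b` from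
  -- `a`.
  have hc2 : Si.card ≤ 2 * ((Si \ B).erase a).card := by
    rw [Finset.card_erase_of_mem (Finset.mem_sdiff.2 ⟨ha, haB⟩)]
    have := Finset.card_sdiff_add_card_inter Si B
    rw [Finset.inter_comm] at this
    omega
  have hfar : (((Si \ B).erase a).card : ℝ) * d a b ≤ dsum d {a} Si := by
    rw [dsum_singleton_left, ← nsmul_eq_mul, ← Finset.sum_const]
    refine le_trans (Finset.sum_le_sum (g := fun q => d a q) fun q hq => ?_)
      (Finset.sum_le_sum_of_subset_of_nonneg (s := (Si \ B).erase a) (t := Si)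
        ((Finset.erase_subset _ _).trans Finset.sdiff_subset) fun _ _ _ => h.nonneg _ _)
    obtain ⟨h1, h2⟩ := Finset.mem_erase.1 hq
    exact hmin b hb q (Finset.mem_sdiff.1 h2).2 h1
  have hc2' : (Si.card : ℝ) ≤ 2 * (((Si \ B).erase a).card : ℝ) := by exact_mod_cast hc2
  have e1 := h.near a (g b) (g b) hne
  have e2 := h.near b (g a) (g a) (Ne.symm hne)
  have t1 := dsum_triangle h.triangle {a} {b} Sj
  have t2 := dsum_triangle h.triangle {b} {a} Si
  simp only [Finset.card_singleton, Nat.cast_one, one_mul, dsum_singleton_left d _ ({a} : Finset ι),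
    dsum_singleton_left d _ ({b} : Finset ι), Finset.sum_singleton, h.symm b a] at t1 t2
  have hmi : (m : ℝ) ≤ Si.card := by exact_mod_cast hm
  have hmj : (m : ℝ) ≤ Sj.card := by exact_mod_cast h.le_card _
  have hm0 : (0 : ℝ) < m := by exact_mod_cast h.m_pos
  change 4 * (Sj.card : ℝ) * dsum d {a} Si ≤ m * dsum d {a} Sj at e1
  change 4 * (Si.card : ℝ) * dsum d {b} Sj ≤ m * dsum d {b} Si at e2
  set x := dsum d {a} Si
  set y := dsum d {a} Sj
  set z := dsum d {b} Sj
  set w := dsum d {b} Si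
  set D := d a b
  have hz : 0 ≤ z := dsum_nonneg h.nonneg _ _
  have hx : (Si.card : ℝ) * D ≤ 2 * x := by nlinarith
  have hx0 : 0 < x := by nlinarith
  -- `z ≤ w / 4 ≤ 3 x / 4`
  have hz1 : 4 * z ≤ w := by
    have : (m : ℝ) * (4 * z) ≤ m * w := by nlinarith
    exact le_of_mul_le_mul_left this hm0
  have hz2 : 4 * z ≤ 3 * x := by linarith
  have hmD : (m : ℝ) * D ≤ 2 * x := by nlinarith
  -- Together with `z ≤ 3 x / 4` this reads `4 x ≤ (2 + 3/4) x`, which contradicts `x > 0`.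
  have h5 : 4 * (Sj.card : ℝ) * x ≤ Sj.card * (2 * x) + Sj.card * z := by nlinarith
  nlinarith

/-- Merging a proper part `A` of a class with something outside the class is never best. -/
theorem davg_rest_lt (h : IsSeparated d g m) {A A' R : Finset ι} {i : κ}
    (hA : ∀ a ∈ A, g a = i) (hA' : ∀ a ∈ A', g a ≠ i) (hAne : A.Nonempty) (hA'ne : A'.Nonempty)
    (hL : IsPure g A' ∨ IsSaturated g A') (hR : R ⊆ labelClass g i) (hRm : m ≤ 2 * R.card) :
    (A'.card : ℝ) * dsum d A R < R.card * dsum d A A' := by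
  have hy : 0 < dsum d A A' := dsum_pos hAne hA'ne fun a ha b hb => h.pos a b (by
    rw [hA a ha]; exact (hA' b hb).symm)
  have hRm' : (m : ℝ) ≤ 2 * R.card := by exact_mod_cast hRm
  have hm0 : (0 : ℝ) < m := by exact_mod_cast h.m_pos
  have hu : dsum d A R ≤ dsum d A (labelClass g i) := dsum_mono_right h.nonneg _ hR
  have hA'0 : (0 : ℝ) < A'.card := by exact_mod_cast hA'ne.card_pos
  -- Since `R` lies in the class and has at least `m / 2` points, it can be replaced by the whole
  -- class on the left and by `m / 2` on the right.
  have key : 2 * ((A'.card : ℝ) * dsum d A (labelClass g i)) < m * dsum d A A' →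
      (A'.card : ℝ) * dsum d A R < R.card * dsum d A A' := by
    intro hk
    nlinarith
  apply key
  rcases hL with ⟨j, hj⟩ | hS
  · obtain ⟨a', ha'⟩ := hA'ne
    have hij : j ≠ i := by rw [← hj a' ha']; exact hA' a' ha'
    have e1 := h.near_set hA j j hij
    have e2 := h.near_set hj i i hij.symm
    have t1 := dsum_triangle h.triangle A A' (labelClass g j)
    have t2 := dsum_triangle h.triangle A' A (labelClass g i)
    rw [dsum_comm h.symm A' A] at t2
    have hmi : (m : ℝ) ≤ (labelClass g i).card := by exact_mod_cast h.le_card _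
    have hmj : (m : ℝ) ≤ (labelClass g j).card := by exact_mod_cast h.le_card _
    have hz := dsum_nonneg h.nonneg A' (labelClass g j)
    have hu0 := dsum_nonneg h.nonneg A (labelClass g i)
    set y := dsum d A A'
    set u := dsum d A (labelClass g i)
    set v := dsum d A (labelClass g j)
    set w := dsum d A' (labelClass g j)
    set z := dsum d A' (labelClass g i)
    set ri := ((labelClass g i).card : ℝ)
    set rj := ((labelClass g j).card : ℝ)
    set p := (A.card : ℝ) with hp
    set q := (A'.card : ℝ)
    have hp0 : 0 ≤ p := Nat.cast_nonneg _
    have hri : 0 < ri := lt_of_lt_of_le hm0 hmi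
    have hrj : 0 < rj := lt_of_lt_of_le hm0 hmj
    have hqu : 0 ≤ q * u := mul_nonneg hA'0.le hu0
    -- `4 p w ≤ m y + q u`
    have s1 : 4 * (p * w) ≤ m * y + q * u := by
      have h1 : ri * (4 * (p * w)) ≤ ri * (m * y + q * u) := by
        calc ri * (4 * (p * w)) = p * (4 * ri * w) := by ring
          _ ≤ p * (m * z) := mul_le_mul_of_nonneg_left e2 hp0
          _ = m * (p * z) := by ring
          _ ≤ m * (ri * y + q * u) := mul_le_mul_of_nonneg_left t2 hm0.le
          _ ≤ ri * (m * y + q * u) := by nlinarith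
      exact le_of_mul_le_mul_left h1 hri
    have s2 : 4 * (q * u) ≤ m * y + p * w := by
      have h1 : rj * (4 * (q * u)) ≤ rj * (m * y + p * w) := by
        calc rj * (4 * (q * u)) = q * (4 * rj * u) := by ring
          _ ≤ q * (m * v) := mul_le_mul_of_nonneg_left e1 hA'0.le
          _ = m * (q * v) := by ring
          _ ≤ m * (rj * y + p * w) := mul_le_mul_of_nonneg_left t1 hm0.le
          _ ≤ rj * (m * y + p * w) := by nlinarith [mul_nonneg hp0 hz]
      exact le_of_mul_le_mul_left h1 hrj
    have hmy : 0 < m * y := mul_pos hm0 hy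
    -- Eliminating `p w` from `s1` and `s2` gives `15 q u ≤ 5 m y`, hence `2 q u < m y`.
    linarith
  · have hu0 := dsum_nonneg h.nonneg A (labelClass g i)
    -- When `A'` is a union of classes, add up the separation from each of these classes.
    have e : 4 * (A'.card : ℝ) * dsum d A (labelClass g i) ≤ m * dsum d A A' := by
      have hdis := labelClass_pairwiseDisjoint g ((A'.image g : Finset κ) : Set κ)
      have hcard : (A'.card : ℝ) = ∑ j ∈ A'.image g, ((labelClass g j).card : ℝ) := by
        conv_lhs => rw [hS.eq_biUnion]
        rw [Finset.card_biUnion hdis]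
        push_cast
        rfl
      have hsum : dsum d A A' = ∑ j ∈ A'.image g, dsum d A (labelClass g j) := by
        conv_lhs => rw [hS.eq_biUnion]
        exact dsum_biUnion_right _ _ _ _ hdis
      rw [hcard, hsum, Finset.mul_sum, Finset.mul_sum, Finset.sum_mul]
      refine Finset.sum_le_sum fun j hj => h.near_set hA j j ?_
      obtain ⟨b, hb, rfl⟩ := Finset.mem_image.1 hj
      exact hA' b hb
    have hmy : 0 < m * dsum d A A' := mul_pos hm0 hy
    nlinarith [mul_nonneg hA'0.le hu0]

end IsSeparated

/-- The forests of clusters that average linkage goes through. -/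
structure IsGoodForest (g : ι → κ) (m : ℕ) (F : Set (ClusterTree ι)) : Prop where
  wf : ∀ T ∈ F, T.WF
  laminar : ∀ T ∈ F, T.Laminar g
  eq_of_mem : ∀ T ∈ F, ∀ U ∈ F, ∀ a, a ∈ T.points → a ∈ U.points → T = U
  cover : ∀ a, ∃ T ∈ F, a ∈ T.points
  big : ∀ T ∈ F, m ≤ 2 * T.points.card

/-! ### The merging process respects the classes -/

namespace IsSeparated

variable {d : ι → ι → ℝ} {g : ι → κ} {m : ℕ}

theorem reachable_pure (h : IsSeparated d g m) {nn : ι → Finset ι}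
    (hnn : ∀ p, IsNearestNeighbors d (m / 2) p (nn p)) {a b : ι}
    (hab : (SimpleGraph.fromRel fun a b => b ∈ nn a).Reachable a b) : g b = g a := by
  obtain ⟨w⟩ := hab
  induction w with
  | nil => rfl
  | cons hadj _ ih =>
    rw [ih]
    rw [SimpleGraph.fromRel_adj] at hadj
    rcases hadj.2 with h1 | h1
    · exact h.nearestNeighbors_pure (hnn _) h1
    · exact (h.nearestNeighbors_pure (hnn _) h1).symm

/-- A component contains a point together with its `⌊m / 2⌋` neighbours, hence at least `⌊m / 2⌋ +
1` points. It stays in one class since no edge leaves a class. -/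
theorem isGoodForest_components (h : IsSeparated d g m) {nn : ι → Finset ι}
    (hnn : ∀ p, IsNearestNeighbors d (m / 2) p (nn p)) :
    IsGoodForest g m (ClusterTree.leaf '' components nn) where
  wf := by
    rintro _ ⟨A, ⟨p, hp⟩, rfl⟩
    exact ⟨p, (hp p).2 (SimpleGraph.Reachable.refl _)⟩
  laminar := by
    rintro _ ⟨A, ⟨p, hp⟩, rfl⟩
    exact ⟨g p, fun a ha => h.reachable_pure hnn ((hp a).1 ha)⟩
  eq_of_mem := by
    rintro _ ⟨A, ⟨p, hp⟩, rfl⟩ _ ⟨B, ⟨q, hq⟩, rfl⟩ a ha hb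
    have hpq := ((hp a).1 ha).trans ((hq a).1 hb).symm
    congr 1
    ext c
    rw [hp, hq]
    exact ⟨fun hc => hpq.symm.trans hc, fun hc => hpq.trans hc⟩
  cover := by
    classical
    intro a
    refine ⟨_, ⟨univ.filter fun b => (SimpleGraph.fromRel fun a b => b ∈ nn a).Reachable a b,
      ⟨a, fun b => by simp⟩, rfl⟩, ?_⟩
    simp [ClusterTree.points]
  big := by
    rintro _ ⟨A, ⟨p, hp⟩, rfl⟩
    have hsub : insert p (nn p) ⊆ A := by
      intro q hq
      rw [hp]
      rcases Finset.mem_insert.1 hq with rfl | hq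
      · exact SimpleGraph.Reachable.refl _
      · refine SimpleGraph.Adj.reachable ?_
        rw [SimpleGraph.fromRel_adj]
        exact ⟨by rintro rfl; exact (hnn p).1 hq, Or.inl hq⟩
    have := Finset.card_le_card hsub
    rw [Finset.card_insert_of_notMem (hnn p).1, (hnn p).2.1] at this
    change m ≤ 2 * A.card
    omega

/-- A cluster strictly inside a class is not merged with anything outside the class. -/
theorem merge_inside (h : IsSeparated d g m) {F : Set (ClusterTree ι)} (hF : IsGoodForest g m F)
    {T U : ClusterTree ι} (hT : T ∈ F) (hU : U ∈ F) (hTU : T ≠ U)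
    (hmin : ∀ V ∈ F, V ≠ T → davg d T.points U.points ≤ davg d T.points V.points)
    (hpure : IsPure g T.points) (hsat : ¬ IsSaturated g T.points) :
    IsPure g (T.points ∪ U.points) := by
  by_contra hnot
  obtain ⟨i, hi⟩ := hpure
  obtain ⟨a₀, ha₀⟩ := (hF.wf T hT).nonempty
  -- `U` has no point in the class of `T`
  have hUi : ∀ b ∈ U.points, g b ≠ i := by
    intro b hb hbi
    rcases (hF.laminar U hU).pure_or_saturated with ⟨j, hj⟩ | hs
    · apply hnot
      refine ⟨i, fun c hc => ?_⟩
      rcases Finset.mem_union.1 hc with hc | hc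
      · exact hi c hc
      · rw [hj c hc, ← hj b hb, hbi]
    · exact hTU (hF.eq_of_mem T hT U hU a₀ ha₀ (hs b hb a₀ (by rw [hi a₀ ha₀, hbi])))
  set R := labelClass g i \ T.points with hR
  -- every cluster that meets `R` lies in it
  have hin : ∀ V ∈ F, ∀ b ∈ R, b ∈ V.points → V ≠ T ∧ V.points ⊆ R := by
    intro V hV b hb hbV
    obtain ⟨h1, h2⟩ := Finset.mem_sdiff.1 hb
    rw [mem_labelClass] at h1
    have hVT : V ≠ T := by rintro rfl; exact h2 hbV
    refine ⟨hVT, fun c hc => Finset.mem_sdiff.2 ⟨?_, fun hcT => hVT (hF.eq_of_mem V hV T hT c hc hcT)⟩⟩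
    rw [mem_labelClass]
    rcases (hF.laminar V hV).pure_or_saturated with ⟨j, hj⟩ | hs
    · rw [hj c hc, ← hj b hbV, h1]
    · exact absurd (hF.eq_of_mem V hV T hT a₀ (hs b hbV a₀ (by rw [hi a₀ ha₀, h1])) ha₀) hVT
  have hRne : R.Nonempty := by
    by_contra hne
    rw [Finset.not_nonempty_iff_eq_empty, hR, Finset.sdiff_eq_empty_iff_subset] at hne
    apply hsat
    intro a ha b hb
    exact hne (mem_labelClass.2 (hb.trans (hi a ha)))
  choose V hVF hV using hF.cover
  obtain ⟨b₀, hb₀⟩ := hRne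
  -- The rest of the class contains a whole cluster of the forest, which already has at least `m /
  -- 2` points.
  have hRm : m ≤ 2 * R.card := (hF.big _ (hVF b₀)).trans
    (Nat.mul_le_mul_left 2 (Finset.card_le_card (hin _ (hVF b₀) b₀ hb₀ (hV b₀)).2))
  have hlt := h.davg_rest_lt hi hUi ⟨a₀, ha₀⟩ (hF.wf U hU).nonempty
    (hF.laminar U hU).pure_or_saturated (Finset.sdiff_subset (s := labelClass g i) (t := T.points))
    hRm
  have hRu : R = (R.image fun b => (V b).points).biUnion id := by
    ext c
    simp only [mem_biUnion, mem_image, id]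
    constructor
    · exact fun hc => ⟨_, ⟨c, hc, rfl⟩, hV c⟩
    · rintro ⟨_, ⟨b, hb, rfl⟩, hc⟩
      exact (hin _ (hVF b) b hb (hV b)).2 hc
  have hdis : ((R.image fun b => (V b).points : Finset (Finset ι)) : Set (Finset ι)).PairwiseDisjoint
      id := by
    intro B hB B' hB' hne
    obtain ⟨b, _, rfl⟩ := Finset.mem_image.1 hB
    obtain ⟨b', _, rfl⟩ := Finset.mem_image.1 hB'
    rw [Function.onFun, Finset.disjoint_left]
    intro c hc hc'
    exact hne (by rw [hF.eq_of_mem _ (hVF b) _ (hVF b') c hc hc'])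
  have hTc : (0 : ℝ) < T.points.card := by exact_mod_cast (hF.wf T hT).nonempty.card_pos
  have hUc : (0 : ℝ) < U.points.card := by exact_mod_cast (hF.wf U hU).nonempty.card_pos
  -- `R` is a disjoint union of current clusters, none of which is closer to `T` than `U`. So the
  -- weighted mean `d_avg(T, R)` is not below `d_avg(T, U)`, contrary to `hlt`.
  have hge : (R.card : ℝ) * dsum d T.points U.points ≤ U.points.card * dsum d T.points R := by
    have hcard : (R.card : ℝ) = ∑ B ∈ R.image fun b => (V b).points, (B.card : ℝ) := by
      conv_lhs => rw [hRu]
      rw [Finset.card_biUnion hdis]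
      push_cast
      rfl
    have hsum : dsum d T.points R = ∑ B ∈ R.image fun b => (V b).points, dsum d T.points B := by
      conv_lhs => rw [hRu]
      exact dsum_biUnion_right _ _ _ _ hdis
    rw [hcard, hsum, Finset.sum_mul, Finset.mul_sum]
    refine Finset.sum_le_sum fun B hB => ?_
    obtain ⟨b, hb, rfl⟩ := Finset.mem_image.1 hB
    have hm := hmin _ (hVF b) (hin _ (hVF b) b hb (hV b)).1
    have hVc : (0 : ℝ) < (V b).points.card := by
      exact_mod_cast (hF.wf _ (hVF b)).nonempty.card_pos
    unfold davg at hm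
    rw [div_le_div_iff₀ (mul_pos hTc hUc) (mul_pos hTc hVc)] at hm
    have : (T.points.card : ℝ) * ((V b).points.card * dsum d T.points U.points) ≤
        T.points.card * (U.points.card * dsum d T.points (V b).points) := by linarith
    exact le_of_mul_le_mul_left this hTc
  linarith

/-- Two saturated clusters have a saturated union. If one of the two is not saturated, it is a
proper part of a class, and `merge_inside` forces the union to be pure. -/
theorem isGoodForest_mergeStep (h : IsSeparated d g m) {F F' : Set (ClusterTree ι)}
    (hF : IsGoodForest g m F) (hs : MergeStep d F F') : IsGoodForest g m F' := by
  obtain ⟨T, hT, U, hU, hTU, hmin, rfl⟩ := hs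
  have hdisj : Disjoint T.points U.points :=
    Finset.disjoint_left.2 fun a ha hb => hTU (hF.eq_of_mem T hT U hU a ha hb)
  have hmem : ∀ V, V ∈ insert (ClusterTree.node T U) (F \ {T, U}) →
      V = ClusterTree.node T U ∨ (V ∈ F ∧ V ≠ T ∧ V ≠ U) := by
    rintro V (h1 | ⟨h1, h2⟩)
    · exact Or.inl h1
    · rw [Set.mem_insert_iff, Set.mem_singleton_iff, not_or] at h2
      exact Or.inr ⟨h1, h2⟩
  have hnode : ∀ V ∈ F, V ≠ T → V ≠ U → ∀ a, a ∈ V.points →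
      a ∉ (ClusterTree.node T U).points := by
    intro V hV h1 h2 a ha hn
    rcases Finset.mem_union.1 hn with hn | hn
    · exact h1 (hF.eq_of_mem V hV T hT a ha hn)
    · exact h2 (hF.eq_of_mem V hV U hU a ha hn)
  refine ⟨?_, ?_, ?_, ?_, ?_⟩
  · intro V hV
    rcases hmem V hV with rfl | ⟨hV, _⟩
    · exact ⟨hF.wf T hT, hF.wf U hU, hdisj⟩
    · exact hF.wf V hV
  · intro V hV
    rcases hmem V hV with rfl | ⟨hV, _⟩
    · refine ⟨hF.laminar T hT, hF.laminar U hU, ?_⟩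
      -- By symmetry of `d` the minimal pair is also minimal seen from its second member.
      have hUT : ∀ V ∈ F, V ≠ U → davg d U.points T.points ≤ davg d U.points V.points := by
        intro V hV hne
        have := hmin U hU V hV hne.symm
        unfold davg at this ⊢
        rwa [dsum_comm h.symm T.points, mul_comm (T.points.card : ℝ)] at this
      by_cases sT : IsSaturated g T.points
      · by_cases sU : IsSaturated g U.points
        · right
          intro a ha b hb
          rcases Finset.mem_union.1 ha with ha | ha
          · exact Finset.mem_union_left _ (sT a ha b hb)
          · exact Finset.mem_union_right _ (sU a ha b hb)
        · left
          rw [Finset.union_comm]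
          exact h.merge_inside hF hU hT hTU.symm hUT
            ((hF.laminar U hU).pure_or_saturated.resolve_right sU) sU
      · left
        exact h.merge_inside hF hT hU hTU (fun V hV hne => hmin T hT V hV hne.symm)
          ((hF.laminar T hT).pure_or_saturated.resolve_right sT) sT
    · exact hF.laminar V hV
  · intro V hV W hW a ha hb
    rcases hmem V hV with rfl | ⟨hV, h1, h2⟩ <;> rcases hmem W hW with rfl | ⟨hW, h3, h4⟩
    · rfl
    · exact absurd ha (hnode W hW h3 h4 a hb)
    · exact absurd hb (hnode V hV h1 h2 a ha)
    · exact hF.eq_of_mem V hV W hW a ha hb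
  · intro a
    obtain ⟨V, hV, ha⟩ := hF.cover a
    by_cases h1 : V = T
    · exact ⟨_, Set.mem_insert _ _, Finset.mem_union_left _ (h1 ▸ ha)⟩
    · by_cases h2 : V = U
      · exact ⟨_, Set.mem_insert _ _, Finset.mem_union_right _ (h2 ▸ ha)⟩
      · exact ⟨V, Or.inr ⟨hV, by simp [h1, h2]⟩, ha⟩
  · intro V hV
    rcases hmem V hV with rfl | ⟨hV, _⟩
    · exact (hF.big T hT).trans
        (Nat.mul_le_mul_left 2 (Finset.card_le_card Finset.subset_union_left))
    · exact hF.big V hV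

/-- Average linkage finds the classes of a separated labelling. -/
theorem output_eq (h : IsSeparated d g m) (hg : Function.Surjective g) {P : Finset (Finset ι)}
    (hP : IsAverageLinkageOutput d m (Fintype.card κ) P) : P = univ.image (labelClass g) := by
  obtain ⟨nn, hnn, T, hT, hprun, hcard, hmin⟩ := hP
  have hF : ∀ F, Relation.ReflTransGen (MergeStep d) (ClusterTree.leaf '' components nn) F →
      IsGoodForest g m F := by
    intro F hF
    induction hF with
    | refl => exact h.isGoodForest_components hnn
    | tail _ hs ih => exact h.isGoodForest_mergeStep ih hs
  replace hF := hF _ hT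
  have hW := hF.wf T rfl
  have hL := hF.laminar T rfl
  have huniv : T.points = univ := by
    ext a
    obtain ⟨V, rfl, ha⟩ := hF.cover a
    simpa using ha
  have hS : IsSaturated g T.points := fun a _ b _ => by rw [huniv]; exact mem_univ b
  have himg : T.points.image g = univ := by rw [huniv]; exact Finset.image_univ_of_surjective hg
  have hinj : Function.Injective (labelClass g) := by
    intro i j hij
    obtain ⟨a, rfl⟩ := hg i
    exact mem_labelClass.1 (hij ▸ mem_labelClass.2 rfl : a ∈ labelClass g j)
  have htarget := hL.isPruning_image hW hS
  rw [himg] at htarget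
  have hcardT : (univ.image (labelClass g)).card = Fintype.card κ :=
    Finset.card_image_of_injective _ hinj
  have hle := hmin _ htarget hcardT.le
  -- Two finite sets of reals, each element of the first below each element of the second, leave
  -- room for a number in between. This also holds if one set is empty, as for a single class.
  obtain ⟨c, hc, hc'⟩ : ∃ c : ℝ, (∀ i, dsum d (labelClass g i) (labelClass g i) < c) ∧
      ∀ i j, i ≠ j → c < 2 * dsum d (labelClass g i) (labelClass g j) := by
    obtain ⟨c, h1, h2⟩ := Order.exists_between_finsets
      (univ.image fun i => dsum d (labelClass g i) (labelClass g i))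
      ((univ.filter fun z : κ × κ => z.1 ≠ z.2).image
        fun z => 2 * dsum d (labelClass g z.1) (labelClass g z.2)) (by
          intro x hx y hy
          obtain ⟨l, _, rfl⟩ := Finset.mem_image.1 hx
          obtain ⟨z, hz, rfl⟩ := Finset.mem_image.1 hy
          exact h.cost_lt _ _ _ (Finset.mem_filter.1 hz).2)
    exact ⟨c, fun i => h1 _ (Finset.mem_image_of_mem _ (mem_univ i)), fun i j hij =>
      h2 _ (Finset.mem_image.2 ⟨(i, j), Finset.mem_filter.2 ⟨mem_univ _, hij⟩, rfl⟩)⟩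
  rcases hprun.lagrangian h.nonneg hc (fun i j hij _ _ => hc' i j hij) hL hW hS with hlt | he
  · exfalso
    obtain ⟨A, hA⟩ := hprun.nonempty
    obtain ⟨a, ha⟩ := hprun.nonempty_of_mem hW A hA
    have hc0 : 0 ≤ c := (dsum_nonneg h.nonneg _ _).trans (hc (g a)).le
    rw [himg, Finset.sum_add_distrib, Finset.sum_add_distrib, Finset.sum_const, Finset.sum_const,
      nsmul_eq_mul, nsmul_eq_mul, Finset.card_univ] at hlt
    have h1 : minSumCost d (univ.image (labelClass g)) =
        ∑ i, dsum d (labelClass g i) (labelClass g i) :=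
      Finset.sum_image fun i _ j _ hij => hinj hij
    -- As `c ≥ 0`, having at most as many clusters as there are classes means paying at most the
    -- same price. A pruning at most as costly as the classes is therefore no worse with the price
    -- included.
    have h2 : (P.card : ℝ) * c ≤ Fintype.card κ * c :=
      mul_le_mul_of_nonneg_right (by exact_mod_cast hcard) hc0
    unfold minSumCost at h1 hle
    linarith
  · rw [he, himg]

end IsSeparated

end Deterministic

/-! ### Consequences of perturbation resilience -/

section Resilience

variable {X κ : Type*} [Fintype X] [DecidableEq X] [Fintype κ] [DecidableEq κ]

theorem labelClass_injective {h : X → κ} (hs : Function.Surjective h) :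
    Function.Injective (labelClass h) := by
  intro i j hij
  obtain ⟨a, rfl⟩ := hs i
  exact mem_labelClass.1 (hij ▸ mem_labelClass.2 rfl : a ∈ labelClass h j)

/-- Writing all quantities as sums over `X × X` lets clusterings be compared one ordered pair at a
time. -/
theorem dsum_eq_sum_ite (d : X → X → ℝ) (A A' : Finset X) : dsum d A A' =
    ∑ x, ∑ y, (if x ∈ A ∧ y ∈ A' then d x y else 0) := by
  simp only [ite_and, Finset.sum_ite_irrel, Finset.sum_const_zero, ← Finset.sum_filter,
    Finset.filter_mem_eq_inter, Finset.univ_inter]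
  rfl

/-- The partition of `X` into the classes of a surjective labelling. -/
def partitionOfLabel (h : X → κ) (hs : Function.Surjective h) :
    Finpartition (univ : Finset X) :=
  Finpartition.ofExistsUnique (univ.image (labelClass h)) (fun _ _ => Finset.subset_univ _)
    (fun a _ => ⟨labelClass h (h a), ⟨Finset.mem_image_of_mem _ (mem_univ _), mem_labelClass.2 rfl⟩, by
      rintro B ⟨hB, ha⟩
      obtain ⟨i, _, rfl⟩ := Finset.mem_image.1 hB
      rw [mem_labelClass.1 ha]⟩)
    (by
      intro hmem
      obtain ⟨i, _, hi⟩ := Finset.mem_image.1 hmem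
      obtain ⟨a, rfl⟩ := hs i
      exact Finset.notMem_empty a (hi ▸ mem_labelClass.2 rfl))

theorem partitionOfLabel_parts (h : X → κ) (hs : Function.Surjective h) :
    (partitionOfLabel h hs).parts = univ.image (labelClass h) := rfl

theorem minSumCost_image_labelClass (d : X → X → ℝ) {h : X → κ} (hs : Function.Surjective h) :
    minSumCost d (univ.image (labelClass h)) = ∑ x, ∑ y, if h x = h y then d x y else 0 := by
  have h1 : minSumCost d (univ.image (labelClass h)) =
      ∑ i, dsum d (labelClass h i) (labelClass h i) :=
    Finset.sum_image fun i _ j _ hij => labelClass_injective hs hij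
  rw [h1, ← Finset.sum_fiberwise univ h]
  refine Finset.sum_congr rfl fun i _ => Finset.sum_congr rfl fun x hx => ?_
  rw [← Finset.sum_filter]
  refine Finset.sum_congr ?_ fun _ _ => rfl
  ext y
  simp [mem_labelClass.1 hx, eq_comm]

/-- The cluster of a point. -/
def partLabel (C : Finpartition (univ : Finset X)) (p : X) : C.parts :=
  ⟨C.part p, C.part_mem.2 (mem_univ p)⟩

theorem partLabel_eq_iff {C : Finpartition (univ : Finset X)} {p : X} {A : C.parts} :
    partLabel C p = A ↔ p ∈ A.1 := by
  rw [Subtype.ext_iff]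
  exact C.part_eq_iff_mem A.2

theorem partLabel_surjective (C : Finpartition (univ : Finset X)) :
    Function.Surjective (partLabel C) := by
  intro A
  obtain ⟨p, hp⟩ := C.nonempty_of_mem_parts A.2
  exact ⟨p, partLabel_eq_iff.2 hp⟩

theorem labelClass_partLabel {C : Finpartition (univ : Finset X)} (A : C.parts) :
    labelClass (partLabel C) A = A.1 := by
  ext p
  rw [mem_labelClass, partLabel_eq_iff]

theorem image_labelClass_partLabel (C : Finpartition (univ : Finset X)) :
    univ.image (labelClass (partLabel C)) = C.parts := by
  ext A
  simp only [mem_image, mem_univ, true_and, labelClass_partLabel]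
  exact ⟨fun ⟨B, h⟩ => h ▸ B.2, fun h => ⟨⟨A, h⟩, rfl⟩⟩

/-- Under perturbation resilience, any relabelling saves less than it costs, even if the savings
are multiplied by `α`. -/
theorem IsPerturbationResilient.relabel {d : X → X → ℝ} {k : ℕ} {α : ℝ}
    {C : Finpartition (univ : Finset X)} (hPR : IsPerturbationResilient d k α)
    (hC : IsOptimalClustering d k C) (hd : ∀ x y, 0 ≤ d x y) (hα : 1 ≤ α) {h : X → C.parts}
    (hs : Function.Surjective h) (hne : ∃ x y, partLabel C x = partLabel C y ∧ h x ≠ h y) :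
    α * ∑ x, ∑ y, (if partLabel C x = partLabel C y ∧ h x ≠ h y then d x y else 0) <
      ∑ x, ∑ y, (if partLabel C x ≠ partLabel C y ∧ h x = h y then d x y else 0) := by
  by_contra hle
  rw [not_lt] at hle
  -- The adversarial perturbation stretches only the distances inside the clusters. It need not be a
  -- metric.
  set d' : X → X → ℝ := fun x y => if partLabel C x = partLabel C y then α * d x y else d x y
  have hpert : ∀ p q, d p q ≤ d' p q ∧ d' p q ≤ α * d p q := by
    intro p q
    have h1 : d p q ≤ α * d p q := le_mul_of_one_le_left (hd p q) hα
    by_cases hpq : partLabel C p = partLabel C q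
    · simpa [d', hpq] using h1
    · simpa [d', hpq] using h1
  have hopt := (hPR C hC d' hpert C).2 rfl
  have hcard : Fintype.card C.parts = C.parts.card := Fintype.card_coe _
  have hcost : minSumCost d' (partitionOfLabel h hs).parts ≤ minSumCost d' C.parts := by
    rw [partitionOfLabel_parts, minSumCost_image_labelClass d' hs,
      ← congrArg (minSumCost d') (image_labelClass_partLabel C),
      minSumCost_image_labelClass d' (partLabel_surjective C)]
    -- For each pair, the old cost plus what is newly joined equals the new cost plus `α` times what
    -- is separated.
    have key : (∑ x, ∑ y, if partLabel C x = partLabel C y then d' x y else 0) +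
        (∑ x, ∑ y, (if partLabel C x ≠ partLabel C y ∧ h x = h y then d x y else 0)) =
        (∑ x, ∑ y, if h x = h y then d' x y else 0) +
        α * ∑ x, ∑ y, (if partLabel C x = partLabel C y ∧ h x ≠ h y then d x y else 0) := by
      simp only [Finset.mul_sum, ← Finset.sum_add_distrib]
      refine Finset.sum_congr rfl fun x _ => Finset.sum_congr rfl fun y _ => ?_
      by_cases h1 : partLabel C x = partLabel C y <;> by_cases h2 : h x = h y <;> simp [d', h1, h2]
    linarith
  have hopt' : IsOptimalClustering d' k (partitionOfLabel h hs) := by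
    refine ⟨?_, fun P hP => hcost.trans (hopt.2 P hP)⟩
    rw [partitionOfLabel_parts, Finset.card_image_of_injective _ (labelClass_injective hs),
      Finset.card_univ, hcard, hC.1]
  have heq := (hPR C hC d' hpert _).1 hopt'
  obtain ⟨x, y, hxy, hxy'⟩ := hne
  have hmem : labelClass h (h x) ∈ C.parts := by
    refine (congrArg (fun Q : Finpartition (univ : Finset X) => labelClass h (h x) ∈ Q.parts)
      heq).mp ?_
    exact Finset.mem_image_of_mem _ (mem_univ _)
  have hx : partLabel C x = ⟨_, hmem⟩ := partLabel_eq_iff.2 (mem_labelClass.2 rfl)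
  have hy : y ∈ labelClass h (h x) := partLabel_eq_iff.1 (hxy.symm.trans hx)
  exact hxy' (mem_labelClass.1 hy).symm

/-- A point is much closer to its own cluster than to any other one. -/
theorem IsPerturbationResilient.dsum_point_lt {d : X → X → ℝ} {k : ℕ} {α : ℝ}
    {C : Finpartition (univ : Finset X)} (hPR : IsPerturbationResilient d k α)
    (hC : IsOptimalClustering d k C) (hd : ∀ x y, 0 ≤ d x y) (hd0 : ∀ x, d x x = 0)
    (hsymm : ∀ x y, d x y = d y x) (hα : 1 ≤ α) (p : X) (hp : 2 ≤ (partLabel C p).1.card)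
    (B : C.parts) (hB : B ≠ partLabel C p) :
    α * dsum d {p} (partLabel C p).1 < dsum d {p} B.1 := by
  set A := partLabel C p with hA
  set h : X → C.parts := fun x => if x = p then B else partLabel C x with hh
  -- A second point of the cluster ensures that moving `p` away leaves `k` nonempty clusters.
  obtain ⟨q, hqA, hqp⟩ : ∃ q ∈ A.1, q ≠ p := Finset.exists_mem_ne (by omega) p
  have hqA' : partLabel C q = A := partLabel_eq_iff.2 hqA
  have hs : Function.Surjective h := by
    intro E
    by_cases hE : E = A
    · exact ⟨q, by simp [h, hqp, hE, hqA']⟩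
    · obtain ⟨x, rfl⟩ := partLabel_surjective C E
      exact ⟨x, by simp only [h]; rw [if_neg]; rintro rfl; exact hE rfl⟩
  have key := hPR.relabel hC hd hα hs ⟨p, q, by rw [hqA'], by simp [h, hqp, hqA', hB]⟩
  -- The ordered pairs with `p` in the first and in the second place give the factor two; the pair
  -- `(p, p)` has distance zero.
  have e1 : 2 * dsum d {p} A.1 ≤
      ∑ x, ∑ y, (if partLabel C x = partLabel C y ∧ h x ≠ h y then d x y else 0) := by
    have h1 : dsum d {p} A.1 =
        ∑ x, ∑ y, (if x = p ∧ partLabel C y = A then d x y else 0) := by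
      rw [dsum_eq_sum_ite]
      simp only [Finset.mem_singleton, partLabel_eq_iff]
    have h2 : dsum d {p} A.1 =
        ∑ x, ∑ y, (if y = p ∧ partLabel C x = A then d x y else 0) := by
      rw [h1, Finset.sum_comm]
      exact Finset.sum_congr rfl fun x _ => Finset.sum_congr rfl fun y _ => by rw [hsymm]
    rw [two_mul]
    nth_rewrite 1 [h1]
    rw [h2, ← Finset.sum_add_distrib]
    refine Finset.sum_le_sum fun x _ => ?_
    rw [← Finset.sum_add_distrib]
    refine Finset.sum_le_sum fun y _ => ?_
    by_cases hx : x = p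
    · by_cases hy : y = p
      · simp [hx, hy, hd0]
      · by_cases hyA : partLabel C y = A
        · simp [h, hx, hy, hyA, hB, ← hA]
        · simp [hx, hy, hyA]; split_ifs <;> simp [hd]
    · by_cases hy : y = p
      · by_cases hxA : partLabel C x = A
        · simp [h, hx, hy, hxA, hB.symm, ← hA]
        · simp [hx, hy, hxA]; split_ifs <;> simp [hd]
      · simp [hx, hy]; split_ifs <;> simp [hd]
  have e2 : ∑ x, ∑ y, (if partLabel C x ≠ partLabel C y ∧ h x = h y then d x y else 0) ≤
      2 * dsum d {p} B.1 := by
    have h1 : dsum d {p} B.1 =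
        ∑ x, ∑ y, (if x = p ∧ partLabel C y = B then d x y else 0) := by
      rw [dsum_eq_sum_ite]
      simp only [Finset.mem_singleton, partLabel_eq_iff]
    have h2 : dsum d {p} B.1 =
        ∑ x, ∑ y, (if y = p ∧ partLabel C x = B then d x y else 0) := by
      rw [h1, Finset.sum_comm]
      exact Finset.sum_congr rfl fun x _ => Finset.sum_congr rfl fun y _ => by rw [hsymm]
    rw [two_mul]
    nth_rewrite 1 [h1]
    rw [h2, ← Finset.sum_add_distrib]
    refine Finset.sum_le_sum fun x _ => ?_
    rw [← Finset.sum_add_distrib]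
    refine Finset.sum_le_sum fun y _ => ?_
    have n1 : 0 ≤ (if x = p ∧ partLabel C y = B then d x y else 0) := by split_ifs <;> simp [hd]
    have n2 : 0 ≤ (if y = p ∧ partLabel C x = B then d x y else 0) := by split_ifs <;> simp [hd]
    by_cases hc : partLabel C x ≠ partLabel C y ∧ h x = h y
    · obtain ⟨hc1, hc2⟩ := hc
      by_cases hx : x = p
      · have hy : y ≠ p := by rintro rfl; exact hc1 (by rw [hx])
        have : partLabel C y = B := by simpa [h, hx, hy] using hc2.symm
        rw [if_pos ⟨hc1, hc2⟩, if_pos ⟨hx, this⟩]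
        linarith
      · by_cases hy : y = p
        · have : partLabel C x = B := by simpa [h, hx, hy] using hc2
          rw [if_pos ⟨hc1, hc2⟩, if_pos (show y = p ∧ partLabel C x = B from ⟨hy, this⟩)]
          linarith
        · exact absurd (by simpa [h, hx, hy] using hc2) hc1
    · rw [if_neg hc]; linarith
  nlinarith

/-- Merging two clusters costs more than splitting a third one can save. -/
theorem IsPerturbationResilient.dsum_split_lt {d : X → X → ℝ} {k : ℕ} {α : ℝ}
    {C : Finpartition (univ : Finset X)} (hPR : IsPerturbationResilient d k α)
    (hC : IsOptimalClustering d k C) (hd : ∀ x y, 0 ≤ d x y)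
    (hsymm : ∀ x y, d x y = d y x) (hα : 1 ≤ α) {I J L : C.parts} (hIJ : I ≠ J) (hIL : I ≠ L)
    (hJL : J ≠ L) {B B' : Finset X} (hB : B.Nonempty) (hB' : B'.Nonempty) (hdis : Disjoint B B')
    (hBL : B ∪ B' = L.1) : α * dsum d B B' < dsum d I.1 J.1 := by
  have hmemL : ∀ x, partLabel C x = L ↔ x ∈ B ∨ x ∈ B' := by
    intro x; rw [partLabel_eq_iff, ← hBL, Finset.mem_union]
  -- The number of labels is kept: `J` joins `I`, the freed label `J` goes to `B`, and `B'` keeps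
  -- the label `L`.
  set h : X → C.parts := fun x => if x ∈ B then J else if partLabel C x = J then I
    else partLabel C x with hh
  have hBh : ∀ x ∈ B, h x = J := fun x hx => by simp [h, hx]
  have hnB : ∀ x, partLabel C x ≠ L → x ∉ B := fun x hx hxB => hx ((hmemL x).2 (Or.inl hxB))
  have hB'h : ∀ x ∈ B', h x = L := fun x hx => by
    have h1 : x ∉ B := fun h1 => Finset.disjoint_left.1 hdis h1 hx
    have h2 : partLabel C x = L := (hmemL x).2 (Or.inr hx)
    simp [h, h1, h2, hJL.symm]
  have hJh : ∀ x, partLabel C x = J → h x = I := fun x hx => by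
    have h1 : x ∉ B := hnB x (by rw [hx]; exact hJL)
    simp [h, h1, hx]
  have hoth : ∀ x, partLabel C x ≠ J → partLabel C x ≠ L → h x = partLabel C x := fun x h1 h2 => by
    simp [h, hnB x h2, h1]
  have hs : Function.Surjective h := by
    intro E
    by_cases hE : E = J
    · obtain ⟨x, hx⟩ := hB
      exact ⟨x, by rw [hBh x hx, hE]⟩
    · by_cases hE' : E = L
      · obtain ⟨x, hx⟩ := hB'
        exact ⟨x, by rw [hB'h x hx, hE']⟩
      · obtain ⟨x, rfl⟩ := partLabel_surjective C E
        exact ⟨x, hoth x hE hE'⟩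
  obtain ⟨b, hb⟩ := id hB
  obtain ⟨b', hb'⟩ := id hB'
  have key := hPR.relabel hC hd hα hs ⟨b, b', by
    rw [(hmemL b).2 (Or.inl hb), (hmemL b').2 (Or.inr hb')], by
    rw [hBh b hb, hB'h b' hb']; exact hJL⟩
  have e1 : 2 * dsum d B B' ≤
      ∑ x, ∑ y, (if partLabel C x = partLabel C y ∧ h x ≠ h y then d x y else 0) := by
    rw [two_mul]
    nth_rewrite 2 [dsum_comm hsymm]
    rw [dsum_eq_sum_ite, dsum_eq_sum_ite, ← Finset.sum_add_distrib]
    refine Finset.sum_le_sum fun x _ => ?_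
    rw [← Finset.sum_add_distrib]
    refine Finset.sum_le_sum fun y _ => ?_
    have hxy : ∀ u v : X, u ∈ B → v ∈ B' →
        (partLabel C u = partLabel C v ∧ h u ≠ h v) ∧ ¬ (u ∈ B' ∧ v ∈ B) := by
      intro u v hu hv
      refine ⟨⟨?_, ?_⟩, fun hc => Finset.disjoint_left.1 hdis hu hc.1⟩
      · rw [(hmemL u).2 (Or.inl hu), (hmemL v).2 (Or.inr hv)]
      · rw [hBh u hu, hB'h v hv]; exact hJL
    by_cases c1 : x ∈ B ∧ y ∈ B'
    · obtain ⟨h1, h2⟩ := hxy x y c1.1 c1.2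
      rw [if_pos c1, if_neg h2, if_pos h1, add_zero]
    · by_cases c2 : x ∈ B' ∧ y ∈ B
      · obtain ⟨h1, -⟩ := hxy y x c2.2 c2.1
        rw [if_neg c1, if_pos c2, if_pos ⟨h1.1.symm, h1.2.symm⟩, zero_add]
      · rw [if_neg c1, if_neg c2, add_zero]
        split_ifs
        · exact hd _ _
        · exact le_rfl
  have e2 : ∑ x, ∑ y, (if partLabel C x ≠ partLabel C y ∧ h x = h y then d x y else 0) ≤
      2 * dsum d I.1 J.1 := by
    rw [two_mul]
    nth_rewrite 2 [dsum_comm hsymm]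
    rw [dsum_eq_sum_ite, dsum_eq_sum_ite, ← Finset.sum_add_distrib]
    refine Finset.sum_le_sum fun x _ => ?_
    rw [← Finset.sum_add_distrib]
    refine Finset.sum_le_sum fun y _ => ?_
    have n1 : 0 ≤ (if x ∈ I.1 ∧ y ∈ J.1 then d x y else 0) := by split_ifs <;> simp [hd]
    have n2 : 0 ≤ (if x ∈ J.1 ∧ y ∈ I.1 then d x y else 0) := by split_ifs <;> simp [hd]
    by_cases hc : partLabel C x ≠ partLabel C y ∧ h x = h y
    · have hval : ∀ u, (partLabel C u = L ∧ h u = J) ∨ (partLabel C u = L ∧ h u = L) ∨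
          (partLabel C u = J ∧ h u = I) ∨
          (partLabel C u ≠ J ∧ partLabel C u ≠ L ∧ h u = partLabel C u) := by
        intro u
        by_cases hL : partLabel C u = L
        · rcases (hmemL u).1 hL with hu | hu
          · exact Or.inl ⟨hL, hBh u hu⟩
          · exact Or.inr (Or.inl ⟨hL, hB'h u hu⟩)
        · by_cases hJ : partLabel C u = J
          · exact Or.inr (Or.inr (Or.inl ⟨hJ, hJh u hJ⟩))
          · exact Or.inr (Or.inr (Or.inr ⟨hJ, hL, hoth u hJ hL⟩))
      -- The only pairs that are newly joined are those between `I` and `J`.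
      have hres : (partLabel C x = I ∧ partLabel C y = J) ∨
          (partLabel C x = J ∧ partLabel C y = I) := by
        obtain ⟨hc1, hc2⟩ := hc
        have hx := hval x
        have hy := hval y
        grind
      rw [if_pos hc]
      rcases hres with hr | hr
      · rw [if_pos (show x ∈ I.1 ∧ y ∈ J.1 from
          ⟨partLabel_eq_iff.1 hr.1, partLabel_eq_iff.1 hr.2⟩)]
        linarith
      · rw [if_pos (show x ∈ J.1 ∧ y ∈ I.1 from
          ⟨partLabel_eq_iff.1 hr.1, partLabel_eq_iff.1 hr.2⟩)]
        linarith
    · rw [if_neg hc]; linarith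
  nlinarith

/-- A set with at least two points has a balanced bipartition that keeps an eighth of its cost. -/
theorem exists_split_dsum_le {d : X → X → ℝ} (hd : ∀ x y, 0 ≤ d x y)
    (hsymm : ∀ x y, d x y = d y x) (htri : ∀ a b c, d a c ≤ d a b + d b c) {A : Finset X}
    (hA : 2 ≤ A.card) : ∃ B B' : Finset X, B.Nonempty ∧ B'.Nonempty ∧ Disjoint B B' ∧ B ∪ B' = A ∧
      dsum d A A ≤ 8 * dsum d B B' := by
  obtain ⟨B, hBA, hB⟩ := Finset.exists_subset_card_eq (show A.card / 2 ≤ A.card by omega)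
  have hdis : Disjoint B (A \ B) := Finset.disjoint_sdiff
  have hun : B ∪ (A \ B) = A := Finset.union_sdiff_of_subset hBA
  have hcard : (A \ B).card = A.card - A.card / 2 := by rw [Finset.card_sdiff_of_subset hBA, hB]
  have hBpos : 0 < B.card := by omega
  have hB'pos : 0 < (A \ B).card := by omega
  refine ⟨B, A \ B, Finset.card_pos.1 hBpos, Finset.card_pos.1 hB'pos, hdis, hun, ?_⟩
  set B' := A \ B
  have h1 := dsum_triangle htri B B' B
  have h2 := dsum_triangle htri B' B B'
  rw [dsum_comm hsymm B' B] at h1 h2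
  have hexp : dsum d A A = dsum d B B + 2 * dsum d B B' + dsum d B' B' := by
    conv_lhs => rw [← hun]
    rw [dsum_union_left d hdis, dsum_union_right d B hdis, dsum_union_right d B' hdis,
      dsum_comm hsymm B' B]
    ring
  have c1 : (B.card : ℝ) ≤ B'.card := by exact_mod_cast (show B.card ≤ B'.card by omega)
  have c2 : (B'.card : ℝ) ≤ 2 * B.card := by exact_mod_cast (show B'.card ≤ 2 * B.card by omega)
  have p1 : (0 : ℝ) < B.card := by exact_mod_cast hBpos
  have p2 : (0 : ℝ) < B'.card := by exact_mod_cast hB'pos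
  have hn := dsum_nonneg hd B B'
  -- From `|B| ≤ |B'| ≤ 2 |B|` the two inner costs are at most two and four times the cross term.
  -- The cross term itself occurs twice, and `2 + 2 + 4 = 8`.
  have g1 : dsum d B B ≤ 2 * dsum d B B' := by
    have : (B'.card : ℝ) * dsum d B B ≤ B'.card * (2 * dsum d B B') := by nlinarith
    exact le_of_mul_le_mul_left this p2
  have g2 : dsum d B' B' ≤ 4 * dsum d B B' := by
    have : (B.card : ℝ) * dsum d B' B' ≤ B.card * (4 * dsum d B B') := by nlinarith
    exact le_of_mul_le_mul_left this p1
  linarith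

end Resilience

/-! ### Representative samples -/

section Sample

variable {X : Type*} [Fintype X] [DecidableEq X]

theorem minSize_le (C : Finpartition (univ : Finset X)) (A : C.parts) : minSize C ≤ A.1.card :=
  ciInf_le (OrderBot.bddBelow _) A

theorem le_maxSize (C : Finpartition (univ : Finset X)) (A : C.parts) : A.1.card ≤ maxSize C :=
  le_ciSup (f := fun A : C.parts => A.1.card) (Set.toFinite _).bddAbove A

theorem nonempty_parts_of_minSize {C : Finpartition (univ : Finset X)} (h : 2 ≤ minSize C) :
    Nonempty C.parts := by
  by_contra hne
  rw [not_nonempty_iff] at hne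
  unfold minSize at h
  rw [Nat.iInf_of_empty] at h
  omega

/-- Only these two consequences of the lower bound for `α` are used. The denominator `min - 1` is
weakened to `min`. -/
theorem six_le_alpha {C : Finpartition (univ : Finset X)} {α : ℝ} (h2 : 2 ≤ minSize C)
    (hα : 6 * ((maxSize C : ℝ) / ((minSize C : ℝ) - 1)) ≤ α) :
    6 ≤ α ∧ 6 * (maxSize C : ℝ) ≤ α * minSize C := by
  obtain ⟨A⟩ := nonempty_parts_of_minSize h2
  have h3 : (2 : ℝ) ≤ minSize C := by exact_mod_cast h2
  have h4 : (minSize C : ℝ) ≤ maxSize C := by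
    exact_mod_cast (minSize_le C A).trans (le_maxSize C A)
  rw [← mul_div_assoc, div_le_iff₀ (by linarith)] at hα
  have h6 : 6 ≤ α := by
    by_contra hlt
    nlinarith
  exact ⟨h6, by nlinarith⟩

theorem exists_sampleMinSize_eq {C : Finpartition (univ : Finset X)} [Nonempty C.parts] {n : ℕ}
    (x : Fin n → X) :
    ∃ A : C.parts, sampleMinSize C x = (labelClass (partLabel C ∘ x) A).card := by
  obtain ⟨A, hA⟩ := Nat.sInf_mem (Set.range_nonempty
    fun A : C.parts => (univ.filter fun a => x a ∈ A.1).card)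
  have h : (univ.filter fun a => x a ∈ A.1).card = (labelClass (partLabel C ∘ x) A).card := by
    congr 1
    ext a
    simp [partLabel_eq_iff]
  exact ⟨A, hA.symm.trans h⟩

theorem sampleMinSize_le {C : Finpartition (univ : Finset X)} {n : ℕ} (x : Fin n → X)
    (A : C.parts) : sampleMinSize C x ≤ (labelClass (partLabel C ∘ x) A).card := by
  have h := ciInf_le (f := fun A : C.parts => (univ.filter fun a => x a ∈ A.1).card)
    (OrderBot.bddBelow _) A
  refine h.trans_eq ?_
  congr 1
  ext a
  simp [partLabel_eq_iff]

variable [MetricSpace X]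

/-- The sizes of the clusters and the distances to them are estimated by the sample up to a factor
`1 ± 1 / 20`, where `t` is the expected number of times that a point is sampled. -/
structure IsRepresentative (C : Finpartition (univ : Finset X)) (t : ℝ) {n : ℕ} (x : Fin n → X) :
    Prop where
  card_ge : ∀ A : C.parts, 19 * (t * A.1.card) ≤ 20 * (labelClass (partLabel C ∘ x) A).card
  card_le : ∀ A : C.parts, 20 * ((labelClass (partLabel C ∘ x) A).card : ℝ) ≤ 21 * (t * A.1.card)
  dist_ge : ∀ (p : X) (A : C.parts), 19 * (t * dsum dist {p} A.1) ≤
    20 * ∑ a ∈ labelClass (partLabel C ∘ x) A, dist p (x a)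
  dist_le : ∀ (p : X) (A : C.parts), 20 * ∑ a ∈ labelClass (partLabel C ∘ x) A, dist p (x a) ≤
    21 * (t * dsum dist {p} A.1)

namespace IsRepresentative

variable {C : Finpartition (univ : Finset X)} {t : ℝ} {n : ℕ} {x : Fin n → X}

theorem dsum_sample_eq (A B : C.parts) :
    dsum (sampleDist x) (labelClass (partLabel C ∘ x) A) (labelClass (partLabel C ∘ x) B) =
      ∑ a ∈ labelClass (partLabel C ∘ x) A, ∑ b ∈ labelClass (partLabel C ∘ x) B,
        dist (x a) (x b) := rfl

theorem sum_dsum_eq (A B : C.parts) :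
    ∑ a ∈ labelClass (partLabel C ∘ x) A, dsum dist {x a} B.1 =
      ∑ q ∈ B.1, ∑ a ∈ labelClass (partLabel C ∘ x) A, dist q (x a) := by
  simp only [dsum_singleton_left]
  rw [Finset.sum_comm]
  simp only [dist_comm]

/-- A sum over pairs is estimated one coordinate at a time: first each sampled point against the
sampled class, then each point of the cluster against the other class. The factor `21 / 20` appears
squared. -/
theorem dsum_le (h : IsRepresentative C t x) (ht : 0 ≤ t) (A B : C.parts) :
    400 * dsum (sampleDist x) (labelClass (partLabel C ∘ x) A) (labelClass (partLabel C ∘ x) B) ≤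
      441 * (t ^ 2 * dsum dist A.1 B.1) := by
  have h1 : 20 * dsum (sampleDist x) (labelClass (partLabel C ∘ x) A)
      (labelClass (partLabel C ∘ x) B) ≤
      21 * (t * ∑ a ∈ labelClass (partLabel C ∘ x) A, dsum dist {x a} B.1) := by
    rw [dsum_sample_eq, Finset.mul_sum, Finset.mul_sum, Finset.mul_sum]
    exact Finset.sum_le_sum fun a _ => h.dist_le (x a) B
  have h2 : 20 * ∑ q ∈ B.1, ∑ a ∈ labelClass (partLabel C ∘ x) A, dist q (x a) ≤
      21 * (t * dsum dist B.1 A.1) := by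
    rw [dsum_eq_sum_singleton dist B.1, Finset.mul_sum, Finset.mul_sum, Finset.mul_sum]
    exact Finset.sum_le_sum fun q _ => h.dist_le q A
  rw [sum_dsum_eq] at h1
  rw [dsum_comm dist_comm] at h2
  have h3 := mul_le_mul_of_nonneg_left h2 ht
  nlinarith

theorem le_dsum (h : IsRepresentative C t x) (ht : 0 ≤ t) (A B : C.parts) :
    361 * (t ^ 2 * dsum dist A.1 B.1) ≤
    400 * dsum (sampleDist x) (labelClass (partLabel C ∘ x) A)
      (labelClass (partLabel C ∘ x) B) := by
  have h1 : 19 * (t * ∑ a ∈ labelClass (partLabel C ∘ x) A, dsum dist {x a} B.1) ≤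
      20 * dsum (sampleDist x) (labelClass (partLabel C ∘ x) A)
      (labelClass (partLabel C ∘ x) B) := by
    rw [dsum_sample_eq, Finset.mul_sum, Finset.mul_sum, Finset.mul_sum]
    exact Finset.sum_le_sum fun a _ => h.dist_ge (x a) B
  have h2 : 19 * (t * dsum dist B.1 A.1) ≤
      20 * ∑ q ∈ B.1, ∑ a ∈ labelClass (partLabel C ∘ x) A, dist q (x a) := by
    rw [dsum_eq_sum_singleton dist B.1, Finset.mul_sum, Finset.mul_sum, Finset.mul_sum]
    exact Finset.sum_le_sum fun q _ => h.dist_ge q A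
  rw [sum_dsum_eq] at h1
  rw [dsum_comm dist_comm] at h2
  have h3 := mul_le_mul_of_nonneg_left h2 ht
  nlinarith

variable {k : ℕ} {α : ℝ}

theorem dsum_point_pos (p : X) {A : C.parts} (hA : A ≠ partLabel C p) :
    0 < dsum dist {p} A.1 := by
  refine dsum_pos (Finset.singleton_nonempty _) (C.nonempty_of_mem_parts A.2) fun a ha b hb => ?_
  rw [Finset.mem_singleton] at ha
  rw [ha, dist_pos]
  rintro rfl
  exact hA (partLabel_eq_iff.2 hb).symm

theorem mul_dsum_point_lt (hC : IsOptimalClustering (dist : X → X → ℝ) k C)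
    (hPR : IsPerturbationResilient (dist : X → X → ℝ) k α) (h2 : 2 ≤ minSize C) (h6 : 6 ≤ α)
    (p : X) {A : C.parts} (hA : A ≠ partLabel C p) :
    α * dsum dist {p} (partLabel C p).1 < dsum dist {p} A.1 :=
  hPR.dsum_point_lt hC (fun _ _ => dist_nonneg) dist_self dist_comm (by linarith) p
    (h2.trans (minSize_le C _)) A hA

/-- If `L` is one of the two clusters, summing the inequality for points over it gives even a factor
`6`. For a third cluster, merging `I` and `J` while splitting `L` in a balanced way gives `6
d_sum(L, L) ≤ 48 d_sum(B, B') ≤ 8 d_sum(I, J)`. -/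
theorem three_mul_cost_le (hC : IsOptimalClustering (dist : X → X → ℝ) k C)
    (hPR : IsPerturbationResilient (dist : X → X → ℝ) k α) (h2 : 2 ≤ minSize C) (h6 : 6 ≤ α)
    {I J L : C.parts} (hIJ : I ≠ J) :
    3 * dsum dist L.1 L.1 ≤ 4 * dsum dist I.1 J.1 := by
  have hend : ∀ I J : C.parts, I ≠ J → 6 * dsum dist I.1 I.1 ≤ dsum dist I.1 J.1 := by
    intro I J hIJ
    rw [dsum_eq_sum_singleton dist I.1 I.1, dsum_eq_sum_singleton dist I.1 J.1, Finset.mul_sum]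
    refine Finset.sum_le_sum fun p hp => ?_
    have hpI : partLabel C p = I := partLabel_eq_iff.2 hp
    have h1 := mul_dsum_point_lt hC hPR h2 h6 p (A := J) (by rw [hpI]; exact hIJ.symm)
    rw [hpI] at h1
    have h3 := dsum_nonneg (d := (dist : X → X → ℝ)) (fun _ _ => dist_nonneg) {p} I.1
    nlinarith
  have hn := dsum_nonneg (d := (dist : X → X → ℝ)) (fun _ _ => dist_nonneg) I.1 J.1
  by_cases hIL : I = L
  · subst hIL
    linarith [hend I J hIJ]
  · by_cases hJL : J = L
    · subst hJL
      have := hend J I hIJ.symm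
      rw [dsum_comm dist_comm J.1 I.1] at this
      linarith
    · obtain ⟨B, B', hB, hB', hdis, hun, hle⟩ := exists_split_dsum_le (X := X) (d := dist)
        (fun _ _ => dist_nonneg) dist_comm dist_triangle (h2.trans (minSize_le C L))
      have h1 := hPR.dsum_split_lt hC (fun _ _ => dist_nonneg) dist_comm (by linarith) hIJ hIL hJL
        hB hB' hdis hun
      have h3 := dsum_nonneg (d := (dist : X → X → ℝ)) (fun _ _ => dist_nonneg) B B'
      nlinarith

/-- This passes from `X` to the sample. Positivity between classes needs no sampling estimate:
different clusters contain different points, even when points are sampled repeatedly. -/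
theorem isSeparated (h : IsRepresentative C t x) (ht : 0 < t)
    (hC : IsOptimalClustering (dist : X → X → ℝ) k C)
    (hPR : IsPerturbationResilient (dist : X → X → ℝ) k α) (h2 : 2 ≤ minSize C)
    (hα : 6 * ((maxSize C : ℝ) / ((minSize C : ℝ) - 1)) ≤ α) :
    IsSeparated (sampleDist x) (partLabel C ∘ x) (sampleMinSize C x) := by
  obtain ⟨h6, h6'⟩ := six_le_alpha h2 hα
  have := nonempty_parts_of_minSize h2
  have hm2 : (2 : ℝ) ≤ minSize C := by exact_mod_cast h2
  have hm : 19 * (t * minSize C) ≤ 20 * (sampleMinSize C x : ℝ) := by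
    obtain ⟨A, hA⟩ := exists_sampleMinSize_eq (C := C) x
    rw [hA]
    have h1 : (minSize C : ℝ) ≤ A.1.card := by exact_mod_cast minSize_le C A
    have := mul_le_mul_of_nonneg_left h1 ht.le
    linarith [h.card_ge A]
  refine ⟨fun _ _ => dist_nonneg, fun _ _ => dist_comm _ _, fun _ _ _ => dist_triangle _ _ _, ?_,
    sampleMinSize_le x, ?_, ?_, ?_⟩
  · intro a b hab
    refine dist_pos.2 fun he => hab ?_
    simp only [Function.comp, he]
  · have : 0 < t * minSize C := mul_pos ht (by linarith)
    have : (0 : ℝ) < sampleMinSize C x := by linarith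
    exact_mod_cast this
  · intro a J L hJ
    have hpt := mul_dsum_point_lt hC hPR h2 h6 (x a) hJ
    have e1 := h.dist_le (x a) (partLabel C (x a))
    have e2 := h.dist_ge (x a) J
    have e3 := h.card_le L
    have e4 : (L.1.card : ℝ) ≤ maxSize C := by exact_mod_cast le_maxSize C L
    have n1 := dsum_nonneg (d := (dist : X → X → ℝ)) (fun _ _ => dist_nonneg) {x a}
      (partLabel C (x a)).1
    rw [dsum_singleton_left, dsum_singleton_left]
    change 4 * ((labelClass (partLabel C ∘ x) L).card : ℝ) *
      (∑ b ∈ labelClass (partLabel C ∘ x) (partLabel C (x a)), dist (x a) (x b)) ≤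
      sampleMinSize C x * ∑ b ∈ labelClass (partLabel C ∘ x) J, dist (x a) (x b)
    have n2 : 0 ≤ ∑ b ∈ labelClass (partLabel C ∘ x) (partLabel C (x a)), dist (x a) (x b) :=
      Finset.sum_nonneg fun _ _ => dist_nonneg
    set s := ∑ b ∈ labelClass (partLabel C ∘ x) (partLabel C (x a)), dist (x a) (x b)
    set s' := ∑ b ∈ labelClass (partLabel C ∘ x) J, dist (x a) (x b)
    set u := dsum dist {x a} (partLabel C (x a)).1
    set v := dsum dist {x a} J.1
    set M := (maxSize C : ℝ)
    set μ := (minSize C : ℝ)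
    have hM0 : 0 ≤ M := Nat.cast_nonneg _
    have hMu : 6 * (M * u) ≤ μ * v := by
      calc 6 * (M * u) = (6 * M) * u := by ring
        _ ≤ (α * μ) * u := mul_le_mul_of_nonneg_right h6' n1
        _ = μ * (α * u) := by ring
        _ ≤ μ * v := mul_le_mul_of_nonneg_left hpt.le (by linarith)
    have hv : 0 ≤ v := dsum_nonneg (fun _ _ => dist_nonneg) _ _
    -- After division by `t ^ 2`, `400` times the left side of the goal is at most `4 · 441 M u`,
    -- and `400` times the right side is at least `361 μ v ≥ 6 · 361 M u`. Finally `1764 ≤ 2166`.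
    have l1 : (20 * ((labelClass (partLabel C ∘ x) L).card : ℝ)) * (20 * s) ≤
        (21 * (t * M)) * (21 * (t * u)) := by
      refine mul_le_mul (e3.trans ?_) e1 (by linarith) (by positivity)
      have := mul_le_mul_of_nonneg_left e4 ht.le
      linarith
    have l2 : (19 * (t * μ)) * (19 * (t * v)) ≤ (20 * (sampleMinSize C x : ℝ)) * (20 * s') :=
      mul_le_mul hm e2 (by positivity) (by positivity)
    have l3 : t ^ 2 * (6 * (M * u)) ≤ t ^ 2 * (μ * v) :=
      mul_le_mul_of_nonneg_left hMu (by positivity)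
    have l4 : 0 ≤ t ^ 2 * (M * u) := by positivity
    linarith
  · intro I J L hIJ
    have e1 := h.dsum_le ht.le L L
    have e2 := h.le_dsum ht.le I J
    have e3 := three_mul_cost_le hC hPR h2 h6 (L := L) hIJ
    have e4 : 0 < dsum dist I.1 J.1 :=
      dsum_pos (C.nonempty_of_mem_parts I.2) (C.nonempty_of_mem_parts J.2) fun a ha b hb => by
        rw [dist_pos]
        rintro rfl
        exact hIJ ((partLabel_eq_iff.2 ha).symm.trans (partLabel_eq_iff.2 hb))
    have e5 : 0 < t ^ 2 * dsum dist I.1 J.1 := by positivity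
    have e6 := mul_le_mul_of_nonneg_left e3 (sq_nonneg t)
    linarith

/-- On a representative sample, average linkage gives the optimal clustering. -/
theorem implicitClusteringIs (h : IsRepresentative C t x) (ht : 0 < t)
    (hC : IsOptimalClustering (dist : X → X → ℝ) k C)
    (hPR : IsPerturbationResilient (dist : X → X → ℝ) k α) (h2 : 2 ≤ minSize C)
    (hα : 6 * ((maxSize C : ℝ) / ((minSize C : ℝ) - 1)) ≤ α) {P : Finset (Finset (Fin n))}
    (hP : IsAverageLinkageOutput (sampleDist x) (sampleMinSize C x) k P) :
    ImplicitClusteringIs x P C := by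
  have hsep := h.isSeparated ht hC hPR h2 hα
  have hg : Function.Surjective (partLabel C ∘ x) := by
    intro A
    obtain ⟨a, ha⟩ := Finset.card_pos.1 (hsep.m_pos.trans_le (hsep.le_card A))
    exact ⟨a, mem_labelClass.1 ha⟩
  have hk : k = Fintype.card C.parts := by rw [Fintype.card_coe, hC.1]
  rw [hk] at hP
  have hPeq := hsep.output_eq hg hP
  intro f hf
  obtain ⟨h6, -⟩ := six_le_alpha h2 hα
  have hfp : ∀ p, f p = labelClass (partLabel C ∘ x) (partLabel C p) := by
    intro p
    obtain ⟨hmem, hmin⟩ := hf p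
    rw [hPeq] at hmem
    obtain ⟨A, _, hA⟩ := Finset.mem_image.1 hmem
    by_cases hAp : A = partLabel C p
    · rw [← hA, hAp]
    · exfalso
      have h1 := hmin (labelClass (partLabel C ∘ x) (partLabel C p)) (by
        rw [hPeq]; exact Finset.mem_image_of_mem _ (mem_univ _))
      rw [← hA, dsum_singleton_left, dsum_singleton_left] at h1
      have e1 := h.dist_le p (partLabel C p)
      have e2 := h.dist_ge p A
      have e3 := mul_dsum_point_lt hC hPR h2 h6 p hAp
      have e4 := dsum_point_pos p hAp
      have n1 := dsum_nonneg (d := (dist : X → X → ℝ)) (fun _ _ => dist_nonneg) {p}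
        (partLabel C p).1
      -- A wrong cluster would have to win although its true sum is more than six times larger,
      -- while sampling changes the ratio by at most `21 / 19`.
      have e5 : 6 * dsum dist {p} (partLabel C p).1 < dsum dist {p} A.1 := by nlinarith
      have e6 := mul_lt_mul_of_pos_left e5 ht
      have e7 : 0 < t * dsum dist {p} A.1 := mul_pos ht e4
      linarith
  have hff : ∀ p, (univ.filter fun q => f q = f p) = labelClass (partLabel C) (partLabel C p) := by
    intro p
    ext q
    simp only [mem_filter, mem_univ, true_and, mem_labelClass, hfp]
    exact ⟨fun he => labelClass_injective hg he, fun he => by rw [he]⟩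
  rw [← image_labelClass_partLabel C]
  ext A
  simp only [fibers, mem_image, mem_univ, true_and, hff]
  constructor
  · rintro ⟨p, rfl⟩
    exact ⟨_, rfl⟩
  · rintro ⟨B, rfl⟩
    obtain ⟨p, rfl⟩ := partLabel_surjective C B
    exact ⟨p, rfl⟩

end IsRepresentative

end Sample

/-! ### Random samples are representative -/

section Probability

variable {X : Type*} [Fintype X] [DecidableEq X] [MeasurableSpace X] [MeasurableSingletonClass X]

instance [Nonempty X] (n : ℕ) : IsProbabilityMeasure (sampleLaw X n) := by
  unfold sampleLaw; infer_instance

theorem integral_uniformOn_univ [Nonempty X] (φ : X → ℝ) :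
    ∫ p, φ p ∂(ProbabilityTheory.uniformOn (Set.univ : Set X)) =
      (∑ p, φ p) / Fintype.card X := by
  rw [integral_fintype, Finset.sum_div]
  · refine Finset.sum_congr rfl fun p _ => ?_
    rw [Measure.real, ProbabilityTheory.uniformOn_univ]
    simp [div_eq_inv_mul]
  · exact Integrable.of_finite

/-- Hoeffding's inequality: a variable with values in `[a, b]` is sub-Gaussian with parameter `((b -
a) / 2) ^ 2` after centring, and the coordinates are independent under the product measure. -/
theorem sampleLaw_real_sum_ge [Nonempty X] {n : ℕ} (φ : X → ℝ) {a b r : ℝ}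
    (hφ : ∀ p, φ p ∈ Set.Icc a b) (hr : 0 ≤ r) :
    (sampleLaw X n).real {x | r ≤ ∑ i, (φ (x i) - (∑ p, φ p) / Fintype.card X)} ≤
      Real.exp (-(2 * r ^ 2) / (n * (b - a) ^ 2)) := by
  set μ := ProbabilityTheory.uniformOn (Set.univ : Set X)
  have hsub : ∀ i : Fin n, ProbabilityTheory.HasSubgaussianMGF
      (fun x : Fin n → X => φ (x i) - (∑ p, φ p) / Fintype.card X) ((‖b - a‖₊ / 2) ^ 2)
      (sampleLaw X n) := by
    intro i
    have h := ProbabilityTheory.hasSubgaussianMGF_of_mem_Icc (μ := μ) (X := φ) (a := a) (b := b)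
      (measurable_of_finite φ).aemeasurable (Filter.Eventually.of_forall hφ)
    rw [integral_uniformOn_univ] at h
    have hmp : MeasurePreserving (fun x : Fin n → X => x i) (sampleLaw X n) μ :=
      measurePreserving_eval (fun _ : Fin n => μ) i
    rw [← hmp.map_eq] at h
    exact h.of_map hmp.measurable.aemeasurable
  have hind : ProbabilityTheory.iIndepFun
      (fun (i : Fin n) (x : Fin n → X) => φ (x i) - (∑ p, φ p) / Fintype.card X)
      (sampleLaw X n) :=
    ProbabilityTheory.iIndepFun_pi (μ := fun _ : Fin n => μ)
      (X := fun _ p => φ p - (∑ p, φ p) / Fintype.card X)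
      fun _ => (measurable_of_finite _).aemeasurable
  refine (ProbabilityTheory.HasSubgaussianMGF.measure_sum_ge_le_of_iIndepFun hind
    (s := univ) (fun i _ => hsub i) hr).trans_eq ?_
  congr 1
  simp only [Finset.sum_const, Finset.card_univ, Fintype.card_fin, nsmul_eq_mul]
  push_cast
  rw [Real.norm_eq_abs, div_pow, sq_abs]
  -- If `n = 0` or `a = b`, both exponents are zero by the convention for division by zero.
  by_cases h0 : (n : ℝ) * (b - a) ^ 2 = 0
  · rw [h0, ← mul_div_assoc, h0]; simp
  · have h1 : (n : ℝ) ≠ 0 := left_ne_zero_of_mul h0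
    have h2 : (b - a) ^ 2 ≠ 0 := right_ne_zero_of_mul h0
    field_simp

/-- The samples on which the sum of `φ` deviates from its mean by a twentieth. -/
def deviationSet (n : ℕ) (φ : X → ℝ) : Set (Fin n → X) :=
  {x | n * ((∑ p, φ p) / Fintype.card X) ≤ 20 * |∑ i, φ (x i) - n * ((∑ p, φ p) / Fintype.card X)|}

/-- Here `w` bounds from below the ratio of the mean to the range. A deviation of `n ν / 20` in
either direction has Hoeffding exponent `2 n ν ^ 2 / (400 b ^ 2) ≥ n w ^ 2 / 200`; the lower
deviation is the upper one for `-φ`. -/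
theorem sampleLaw_real_deviationSet_le [Nonempty X] {n : ℕ} (hn : 0 < n) {φ : X → ℝ} {b w : ℝ}
    (hb : 0 < b) (hφ : ∀ p, φ p ∈ Set.Icc 0 b) (hw : 0 ≤ w)
    (hφw : w * b ≤ (∑ p, φ p) / Fintype.card X) :
    (sampleLaw X n).real (deviationSet n φ) ≤ 2 * Real.exp (-(n * w ^ 2 / 200)) := by
  set ν := (∑ p, φ p) / Fintype.card X with hν
  have hν0 : 0 ≤ ν := le_trans (by positivity) hφw
  have hn' : (0 : ℝ) < n := by exact_mod_cast hn
  set r := n * ν / 20 with hr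
  have hr0 : 0 ≤ r := by positivity
  have h1 := sampleLaw_real_sum_ge (n := n) φ hφ hr0
  have h2 := sampleLaw_real_sum_ge (n := n) (fun p => -φ p) (a := -b) (b := 0)
    (fun p => ⟨neg_le_neg (hφ p).2, neg_nonpos.2 (hφ p).1⟩) hr0
  have hexp : -(2 * r ^ 2) / (n * b ^ 2) ≤ -(n * w ^ 2 / 200) := by
    rw [neg_div, neg_le_neg_iff, le_div_iff₀ (by positivity)]
    have h3 : (w * b) ^ 2 ≤ ν ^ 2 := pow_le_pow_left₀ (by positivity) hφw 2
    have h4 := mul_le_mul_of_nonneg_left h3 (sq_nonneg (n : ℝ))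
    rw [hr]
    nlinarith
  rw [sub_zero] at h1
  rw [zero_sub, neg_neg] at h2
  have hle := Real.exp_le_exp.2 hexp
  have hsub : deviationSet n φ ⊆
      {x | r ≤ ∑ i, (φ (x i) - (∑ p, φ p) / Fintype.card X)} ∪
      {x | r ≤ ∑ i, (-φ (x i) - (∑ p, -φ p) / Fintype.card X)} := by
    intro x hx
    have hx' : n * ν ≤ 20 * |∑ i, φ (x i) - n * ν| := hx
    simp only [Set.mem_union, Set.mem_ofPred_eq, Finset.sum_sub_distrib, Finset.sum_neg_distrib,
      neg_div, Finset.sum_const, Finset.card_univ, Fintype.card_fin, nsmul_eq_mul, ← hν]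
    rcases abs_cases (∑ i, φ (x i) - n * ν) with ⟨h, _⟩ | ⟨h, _⟩ <;> rw [h] at hx'
    · left; linarith
    · right; linarith
  calc (sampleLaw X n).real (deviationSet n φ) ≤ _ := measureReal_mono hsub
    _ ≤ _ := measureReal_union_le _ _
    _ ≤ _ := by linarith

theorem abs_lt_of_notMem_deviationSet {n : ℕ} {φ : X → ℝ} {x : Fin n → X}
    (h : x ∉ deviationSet n φ) :
    19 * (n * ((∑ p, φ p) / Fintype.card X)) ≤ 20 * ∑ i, φ (x i) ∧
      20 * ∑ i, φ (x i) ≤ 21 * (n * ((∑ p, φ p) / Fintype.card X)) := by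
  have h' : 20 * |∑ i, φ (x i) - n * ((∑ p, φ p) / Fintype.card X)| <
      n * ((∑ p, φ p) / Fintype.card X) := not_le.1 h
  constructor
  · linarith [neg_abs_le (∑ i, φ (x i) - n * ((∑ p, φ p) / Fintype.card X))]
  · linarith [le_abs_self (∑ i, φ (x i) - n * ((∑ p, φ p) / Fintype.card X))]

end Probability

/-! ### The sample size and the union bound -/

section SampleBound

variable {X : Type*} [Fintype X] [DecidableEq X] [MetricSpace X]

theorem eta_le (C : Finpartition (univ : Finset X)) (p : X) (A : C.parts) :
    eta (dist : X → X → ℝ) C * A.1.card ≤ dsum dist {p} A.1 := by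
  have h : eta (dist : X → X → ℝ) C ≤ davg dist {p} A.1 :=
    ciInf_le (f := fun z : X × C.parts => davg (dist : X → X → ℝ) {z.1} z.2.1)
      (Set.toFinite _).bddBelow (p, A)
  have hA : (0 : ℝ) < A.1.card := by exact_mod_cast (C.nonempty_of_mem_parts A.2).card_pos
  unfold davg at h
  rwa [Finset.card_singleton, Nat.cast_one, one_mul, le_div_iff₀ hA] at h

theorem dsum_point_le_diam (p : X) (A : Finset X) :
    dsum dist {p} A ≤ Metric.diam (Set.univ : Set X) * A.card := by
  rw [dsum_singleton_left, mul_comm, ← nsmul_eq_mul, ← Finset.sum_const]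
  exact Finset.sum_le_sum fun q _ =>
    Metric.dist_le_diam_of_mem Set.finite_univ.isBounded (Set.mem_univ _) (Set.mem_univ _)

/-- Every cluster has a point different from the given one, so no average distance vanishes. Without
this the sample bound would divide by zero. -/
theorem eta_pos {C : Finpartition (univ : Finset X)} (h2 : 2 ≤ minSize C) :
    0 < eta (dist : X → X → ℝ) C := by
  obtain ⟨A⟩ := nonempty_parts_of_minSize h2
  obtain ⟨p, -⟩ := C.nonempty_of_mem_parts A.2
  have : Nonempty (X × C.parts) := ⟨(p, A)⟩
  obtain ⟨⟨q, B⟩, hz⟩ := exists_eq_ciInf_of_finite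
    (f := fun z : X × C.parts => davg (dist : X → X → ℝ) {z.1} z.2.1)
  unfold eta
  rw [← hz]
  have hB : 2 ≤ B.1.card := h2.trans (minSize_le C B)
  obtain ⟨b, hb, hbq⟩ := Finset.exists_mem_ne (by omega : 1 < B.1.card) q
  have hB' : (0 : ℝ) < B.1.card := by exact_mod_cast (by omega : 0 < B.1.card)
  unfold davg
  rw [Finset.card_singleton, Nat.cast_one, one_mul, dsum_singleton_left]
  exact div_pos (Finset.sum_pos' (fun _ _ => dist_nonneg) ⟨b, hb, dist_pos.2 hbq.symm⟩) hB'

theorem eta_le_diam {C : Finpartition (univ : Finset X)} (h2 : 2 ≤ minSize C) :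
    eta (dist : X → X → ℝ) C ≤ Metric.diam (Set.univ : Set X) := by
  obtain ⟨A⟩ := nonempty_parts_of_minSize h2
  obtain ⟨p, -⟩ := C.nonempty_of_mem_parts A.2
  have hA : (0 : ℝ) < A.1.card := by exact_mod_cast (C.nonempty_of_mem_parts A.2).card_pos
  exact le_of_mul_le_mul_right ((eta_le C p A).trans (dsum_point_le_diam p A.1)) hA

theorem card_mul_minSize_le {k : ℕ} {C : Finpartition (univ : Finset X)}
    (hk : C.parts.card = k) : k * minSize C ≤ Fintype.card X := by
  rw [← hk, ← Finset.card_univ, ← C.sum_card_parts, ← smul_eq_mul]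
  exact Finset.card_nsmul_le_sum _ _ _ fun A hA => minSize_le C ⟨A, hA⟩

/-- Basic facts on the quantities in the sample bound. -/
theorem sampleBound_facts {k : ℕ} {C : Finpartition (univ : Finset X)} {δ : ℝ}
    (hk : C.parts.card = k) (h2 : 2 ≤ minSize C) (hδ : 0 < δ) (hδ1 : δ < 1) :
    1 ≤ k ∧ 2 ≤ Fintype.card X ∧ 0 < rho C ∧ rho C * k ≤ 1 ∧
      1 / 2 ≤ Real.log ((Fintype.card X : ℝ) * (k : ℝ) / δ) := by
  obtain ⟨A⟩ := nonempty_parts_of_minSize h2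
  have hk1 : 1 ≤ k := by rw [← hk]; exact Finset.card_pos.2 ⟨A.1, A.2⟩
  have hmul := card_mul_minSize_le hk
  have hN : 2 ≤ Fintype.card X := by nlinarith
  have hN0 : (2 : ℝ) ≤ Fintype.card X := by exact_mod_cast hN
  have hk0 : (1 : ℝ) ≤ k := by exact_mod_cast hk1
  have hm0 : (2 : ℝ) ≤ minSize C := by exact_mod_cast h2
  have hmul' : (k : ℝ) * minSize C ≤ Fintype.card X := by exact_mod_cast hmul
  refine ⟨hk1, hN, div_pos (by linarith) (by linarith), ?_, ?_⟩
  · unfold rho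
    rw [div_mul_eq_mul_div, div_le_one (by linarith), mul_comm]
    exact hmul'
  · have h3 : (2 : ℝ) ≤ (Fintype.card X : ℝ) * (k : ℝ) / δ := by
      rw [le_div_iff₀ hδ]
      nlinarith
    have := Real.log_le_log (by norm_num) h3
    linarith [Real.log_two_gt_d9]

/-- Combine `ρ k ≤ 1`, `η ≤ D` and a logarithm of at least `1 / 2`. This forces `k ≤ n` in the
theorem, so loops of length `k` are also bounded by `n`. -/
theorem sq_card_le_sampleBound {k : ℕ} {C : Finpartition (univ : Finset X)} {δ : ℝ}
    (hk : C.parts.card = k) (h2 : 2 ≤ minSize C) (hδ : 0 < δ) (hδ1 : δ < 1) :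
    (k : ℝ) ^ 2 ≤ 2 * sampleBound k C δ := by
  obtain ⟨hk1, hN, hρ, hρk, hlog⟩ := sampleBound_facts hk h2 hδ hδ1
  have hη := eta_pos h2
  have hD := eta_le_diam h2
  have h3 : (k : ℝ) ^ 2 ≤ Metric.diam (Set.univ : Set X) ^ 2 /
      (rho C ^ 2 * eta (dist : X → X → ℝ) C ^ 2) := by
    rw [le_div_iff₀ (by positivity)]
    have h4 : (rho C * k) ^ 2 ≤ 1 := pow_le_one₀ (by positivity) hρk
    have h5 : eta (dist : X → X → ℝ) C ^ 2 ≤ Metric.diam (Set.univ : Set X) ^ 2 :=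
      pow_le_pow_left₀ hη.le hD 2
    nlinarith [sq_nonneg (eta (dist : X → X → ℝ) C)]
  unfold sampleBound
  nlinarith [sq_nonneg (k : ℝ)]

variable [MeasurableSpace X] [MeasurableSingletonClass X]

/-- For each pair of a point and a cluster, two variables are controlled: the distance to the
sampled point if it falls into the cluster, and the indicator of that event. -/
theorem sampleLaw_real_representative_ge {k : ℕ} {C : Finpartition (univ : Finset X)} {δ : ℝ}
    (hk : C.parts.card = k) (h2 : 2 ≤ minSize C) (hδ : 0 < δ) (hδ1 : δ < 1) {n : ℕ}
    (hn : 600 * sampleBound k C δ ≤ n) :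
    1 - δ ≤ (sampleLaw X n).real {x | IsRepresentative C ((n : ℝ) / Fintype.card X) x} := by
  obtain ⟨hk1, hN, hρ, hρk, hlog⟩ := sampleBound_facts hk h2 hδ hδ1
  have hη := eta_pos h2
  have hD := eta_le_diam h2
  have hsq := sq_card_le_sampleBound hk h2 hδ hδ1
  have hk0 : (1 : ℝ) ≤ k := by exact_mod_cast hk1
  have hN0 : (2 : ℝ) ≤ Fintype.card X := by exact_mod_cast hN
  have hX : Nonempty X := Fintype.card_pos_iff.1 (by omega)
  set D := Metric.diam (Set.univ : Set X)
  set η := eta (dist : X → X → ℝ) C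
  have hn0 : 0 < n := by
    have : (0 : ℝ) < n := by nlinarith
    exact_mod_cast this
  -- The distance variable has mean at least `ρ η` and range `D`. The indicator has mean at least
  -- `ρ`, and `ρ ≥ w` because `η ≤ D`.
  set w := rho C * η / D with hw
  have hD0 : 0 < D := lt_of_lt_of_le hη hD
  have hw0 : 0 < w := by positivity
  have hwρ : w ≤ rho C := by
    rw [hw, div_le_iff₀ hD0]
    exact mul_le_mul_of_nonneg_left hD hρ.le
  set e := Real.exp (-(n * w ^ 2 / 200)) with he
  -- the tail bound
  have htail : 4 * ((Fintype.card X : ℝ) * k * e) ≤ δ := by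
    have hq : 0 < (Fintype.card X : ℝ) * k / δ := by positivity
    set l := Real.log ((Fintype.card X : ℝ) * k / δ)
    -- The constant `600 = 3 · 200` makes each tail at most the cube of `δ / (N k)`. The union bound
    -- `4 N k e ≤ 4 δ ^ 3 / (N k) ^ 2` is then at most `δ`, since `N k ≥ 2`.
    have h3 : 3 * l ≤ n * w ^ 2 / 200 := by
      have h4 : sampleBound k C δ * w ^ 2 = l := by
        unfold sampleBound
        rw [hw, div_pow, mul_pow]
        change D ^ 2 / (rho C ^ 2 * η ^ 2) * l * _ = l
        field_simp
      have := mul_le_mul_of_nonneg_right hn (sq_nonneg w)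
      rw [mul_assoc, h4] at this
      linarith
    have h5 : e ≤ ((Fintype.card X : ℝ) * k / δ)⁻¹ ^ 3 := by
      rw [he, ← Real.exp_log (inv_pos.2 hq), ← Real.exp_nat_mul, Real.log_inv]
      apply Real.exp_le_exp.2
      push_cast
      linarith
    have h6 : (2 : ℝ) ≤ (Fintype.card X : ℝ) * k := by nlinarith
    set Q := (Fintype.card X : ℝ) * k
    have hQ : 0 < Q := by linarith
    calc 4 * (Q * e) ≤ 4 * (Q * ((Q / δ)⁻¹ ^ 3)) := by gcongr
      _ = (4 / Q ^ 2 * δ ^ 2) * δ := by field_simp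
      _ ≤ 1 * δ := by
        refine mul_le_mul_of_nonneg_right ?_ hδ.le
        have h7 : 4 / Q ^ 2 ≤ 1 := by rw [div_le_one (by positivity)]; nlinarith
        have h8 : δ ^ 2 ≤ 1 := pow_le_one₀ hδ.le hδ1.le
        have h9 : 0 ≤ 4 / Q ^ 2 := by positivity
        nlinarith [sq_nonneg δ]
      _ = δ := one_mul δ
  -- the two families of events
  set φ : X × C.parts → X → ℝ := fun z q => if q ∈ z.2.1 then dist z.1 q else 0
  set ψ : X × C.parts → X → ℝ := fun z q => if q ∈ z.2.1 then 1 else 0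
  have hρA : ∀ A : C.parts, rho C ≤ (A.1.card : ℝ) / Fintype.card X := by
    intro A
    unfold rho
    have : (minSize C : ℝ) ≤ A.1.card := by exact_mod_cast minSize_le C A
    gcongr
  have hφsum : ∀ z, ∑ q, φ z q = dsum dist {z.1} z.2.1 := by
    intro z
    rw [dsum_singleton_left]
    simp [φ]
  have hψsum : ∀ z, ∑ q, ψ z q = z.2.1.card := by
    intro z
    simp [ψ]
  have hφb : ∀ z, (sampleLaw X n).real (deviationSet n (φ z)) ≤ 2 * e := by
    intro z
    refine sampleLaw_real_deviationSet_le hn0 hD0 (fun q => ?_) hw0.le ?_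
    · simp only [φ]
      split_ifs
      · exact ⟨dist_nonneg, Metric.dist_le_diam_of_mem Set.finite_univ.isBounded
          (Set.mem_univ _) (Set.mem_univ _)⟩
      · exact ⟨le_rfl, hD0.le⟩
    · rw [hφsum, hw, div_mul_cancel₀ _ hD0.ne']
      calc rho C * η ≤ (z.2.1.card : ℝ) / Fintype.card X * η :=
            mul_le_mul_of_nonneg_right (hρA z.2) hη.le
        _ = η * z.2.1.card / Fintype.card X := by ring
        _ ≤ _ := by
          have := eta_le C z.1 z.2
          gcongr
  have hψb : ∀ z, (sampleLaw X n).real (deviationSet n (ψ z)) ≤ 2 * e := by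
    intro z
    refine sampleLaw_real_deviationSet_le hn0 one_pos (fun q => ?_) hw0.le ?_
    · simp only [ψ]
      split_ifs <;> simp
    · rw [hψsum, mul_one]
      exact hwρ.trans (hρA z.2)
  set bad : Set (Fin n → X) := ⋃ z, (deviationSet n (φ z) ∪ deviationSet n (ψ z)) with hbad
  have hbadle : (sampleLaw X n).real bad ≤ δ := by
    calc (sampleLaw X n).real bad
        ≤ ∑ z, (sampleLaw X n).real (deviationSet n (φ z) ∪ deviationSet n (ψ z)) :=
          measureReal_iUnion_fintype_le _
      _ ≤ ∑ _z : X × C.parts, 4 * e := by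
          refine Finset.sum_le_sum fun z _ => (measureReal_union_le _ _).trans ?_
          linarith [hφb z, hψb z]
      _ = 4 * ((Fintype.card X : ℝ) * k * e) := by
          rw [Finset.sum_const, Finset.card_univ, Fintype.card_prod, Fintype.card_coe, hk,
            nsmul_eq_mul]
          push_cast
          ring
      _ ≤ δ := htail
  have hcompl : badᶜ ⊆ {x | IsRepresentative C ((n : ℝ) / Fintype.card X) x} := by
    intro x hx
    have hx' : ∀ z, x ∉ deviationSet n (φ z) ∧ x ∉ deviationSet n (ψ z) := by
      intro z
      constructor <;> intro hz <;> apply hx <;> rw [hbad, Set.mem_iUnion]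
      · exact ⟨z, Or.inl hz⟩
      · exact ⟨z, Or.inr hz⟩
    have hcl : ∀ (A : C.parts) (f : X → ℝ), ∑ i, (if x i ∈ A.1 then f (x i) else 0) =
        ∑ a ∈ labelClass (partLabel C ∘ x) A, f (x a) := by
      intro A f
      rw [labelClass, Finset.sum_filter]
      simp only [Function.comp, partLabel_eq_iff]
    have hφ' : ∀ p A, _ := fun p A => abs_lt_of_notMem_deviationSet (hx' (p, A)).1
    have hψ' : ∀ A, _ := fun A => abs_lt_of_notMem_deviationSet (hx' (hX.some, A)).2
    simp only [hφsum] at hφ'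
    simp only [hψsum] at hψ'
    simp only [φ, hcl] at hφ'
    simp only [ψ, hcl _ (fun _ => (1 : ℝ)), Finset.sum_const, nsmul_eq_mul, mul_one] at hψ'
    simp only [mul_div_assoc', ← div_mul_eq_mul_div] at hφ' hψ'
    exact ⟨fun A => (hψ' A).1, fun A => (hψ' A).2, fun p A => (hφ' p A).1, fun p A => (hφ' p A).2⟩
  have hmeas : MeasurableSet bad := (Set.toFinite bad).measurableSet
  calc 1 - δ ≤ 1 - (sampleLaw X n).real bad := by linarith
    _ = (sampleLaw X n).real badᶜ := (probReal_compl_eq_one_sub hmeas).symm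
    _ ≤ _ := measureReal_mono hcompl

end SampleBound

/-! ### Reasoning about programs -/

namespace RealRAM

@[simp] theorem State.setNat_nat (s : State) (a i j v a' i' j' : ℕ) :
    (s.setNat a i j v).nat a' i' j' = if a' = a ∧ i' = i ∧ j' = j then v else s.nat a' i' j' := rfl

@[simp] theorem State.setNat_real (s : State) (a i j v : ℕ) : (s.setNat a i j v).real = s.real := rfl

@[simp] theorem State.setReal_real (s : State) (a i j : ℕ) (v : ℝ) (a' i' j' : ℕ) :
    (s.setReal a i j v).real a' i' j' = if a' = a ∧ i' = i ∧ j' = j then v else s.real a' i' j' :=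
  rfl

@[simp] theorem State.setReal_nat (s : State) (a i j : ℕ) (v : ℝ) :
    (s.setReal a i j v).nat = s.nat := rfl

namespace Cmd

/-- The final state. -/
noncomputable def exec (c : Cmd) (s : State) : State := (c.run s).1

@[simp] theorem exec_skip (s : State) : skip.exec s = s := rfl

@[simp] theorem exec_setNat (a : ℕ) (i j e : NExp) (s : State) :
    (setNat a i j e).exec s = s.setNat a (i.eval s) (j.eval s) (e.eval s) := rfl

@[simp] theorem exec_setReal (a : ℕ) (i j : NExp) (e : RExp) (s : State) :
    (setReal a i j e).exec s = s.setReal a (i.eval s) (j.eval s) (e.eval s) := rfl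

theorem exec_seq (c c' : Cmd) (s : State) : (seq c c').exec s = c'.exec (c.exec s) := rfl

theorem exec_ite_of_holds {b : Test} {s : State} (h : b.Holds s) (c c' : Cmd) :
    (ite b c c').exec s = c.exec s := by
  simp only [exec, run, if_pos h]

theorem exec_ite_of_not_holds {b : Test} {s : State} (h : ¬ b.Holds s) (c c' : Cmd) :
    (ite b c c').exec s = c'.exec s := by
  simp only [exec, run, if_neg h]

theorem exec_loop (v : ℕ) (e : NExp) (c : Cmd) (s : State) :
    (loop v e c).exec s =
      Nat.rec s (fun t r => c.exec (r.setNat v 0 0 t)) (e.eval s) := by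
  unfold exec
  simp only [run]
  induction e.eval s with
  | zero => rfl
  | succ t ih => simp only [ih]

/-- Does the command write into the array `a` of natural numbers? -/
def writesNat : Cmd → ℕ → Bool
  | skip, _ => false
  | setNat b _ _ _, a => a == b
  | setReal _ _ _ _, _ => false
  | seq c c', a => c.writesNat a || c'.writesNat a
  | ite _ c c', a => c.writesNat a || c'.writesNat a
  | loop v _ c, a => a == v || c.writesNat a

/-- Does the command write into the array `a` of real numbers? -/
def writesReal : Cmd → ℕ → Bool
  | skip, _ => false
  | setNat _ _ _ _, _ => false
  | setReal b _ _ _, a => a == b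
  | seq c c', a => c.writesReal a || c'.writesReal a
  | ite _ c c', a => c.writesReal a || c'.writesReal a
  | loop _ _ c, a => c.writesReal a

/-- The frame rule. Its hypothesis is a syntactic check, so facts about untouched arrays are carried
through a program by computation. -/
theorem exec_nat_of_writesNat {c : Cmd} {a : ℕ} (h : c.writesNat a = false) (s : State) :
    (c.exec s).nat a = s.nat a := by
  induction c generalizing s with
  | skip => rfl
  | setNat b i j e =>
    have hab : a ≠ b := by simpa [writesNat] using h
    funext i' j'
    simp [hab]
  | setReal b i j e => rfl
  | seq c c' ih ih' =>
    simp only [writesNat, Bool.or_eq_false_iff] at h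
    rw [exec_seq, ih' h.2, ih h.1]
  | ite b c c' ih ih' =>
    simp only [writesNat, Bool.or_eq_false_iff] at h
    by_cases hb : b.Holds s
    · rw [exec_ite_of_holds hb, ih h.1]
    · rw [exec_ite_of_not_holds hb, ih' h.2]
  | loop v e c ih =>
    simp only [writesNat, Bool.or_eq_false_iff] at h
    have hav : a ≠ v := by simpa using h.1
    rw [exec_loop]
    induction e.eval s with
    | zero => rfl
    | succ t iht =>
      dsimp only
      rw [ih h.2]
      funext i' j'
      rw [State.setNat_nat, if_neg (fun hc => hav hc.1), iht]

theorem exec_real_of_writesReal {c : Cmd} {a : ℕ} (h : c.writesReal a = false) (s : State) :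
    (c.exec s).real a = s.real a := by
  induction c generalizing s with
  | skip => rfl
  | setNat b i j e => rfl
  | setReal b i j e =>
    have hab : a ≠ b := by simpa [writesReal] using h
    funext i' j'
    simp [hab]
  | seq c c' ih ih' =>
    simp only [writesReal, Bool.or_eq_false_iff] at h
    rw [exec_seq, ih' h.2, ih h.1]
  | ite b c c' ih ih' =>
    simp only [writesReal, Bool.or_eq_false_iff] at h
    by_cases hb : b.Holds s
    · rw [exec_ite_of_holds hb, ih h.1]
    · rw [exec_ite_of_not_holds hb, ih' h.2]
  | loop v e c ih =>
    rw [exec_loop]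
    induction e.eval s with
    | zero => rfl
    | succ t iht =>
      dsimp only
      rw [ih h, State.setNat_real, iht]

/-- Loop invariants. In each pass, the arrays that the loop does not write are as before the
loop. -/
theorem exec_loop_induct {v : ℕ} {e : NExp} {c : Cmd} {s : State} (I : ℕ → State → Prop) {N : ℕ}
    (hN : e.eval s = N) (h0 : I 0 s)
    (hstep : ∀ t < N, ∀ s', (∀ a, (loop v e c).writesNat a = false → s'.nat a = s.nat a) →
      (∀ a, (loop v e c).writesReal a = false → s'.real a = s.real a) → I t s' →
      I (t + 1) (c.exec (s'.setNat v 0 0 t))) :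
    I N ((loop v e c).exec s) := by
  have key : ∀ M ≤ N, I M (Nat.rec s (fun t r => c.exec (r.setNat v 0 0 t)) M) ∧
      (∀ a, (loop v e c).writesNat a = false →
        (Nat.rec s (fun t r => c.exec (r.setNat v 0 0 t)) M : State).nat a = s.nat a) ∧
      (∀ a, (loop v e c).writesReal a = false →
        (Nat.rec s (fun t r => c.exec (r.setNat v 0 0 t)) M : State).real a = s.real a) := by
    intro M
    induction M with
    | zero => exact fun _ => ⟨h0, fun _ _ => rfl, fun _ _ => rfl⟩
    | succ t ih =>
      intro ht
      obtain ⟨h1, h2, h3⟩ := ih (by omega)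
      refine ⟨hstep t (by omega) _ h2 h3 h1, fun a ha => ?_, fun a ha => ?_⟩
      · have ha' := ha
        simp only [writesNat, Bool.or_eq_false_iff] at ha
        have hav : a ≠ v := by simpa using ha.1
        dsimp only
        rw [exec_nat_of_writesNat ha.2]
        funext i' j'
        rw [State.setNat_nat, if_neg (fun hc => hav hc.1), h2 a ha']
      · dsimp only
        rw [exec_real_of_writesReal (show c.writesReal a = false from ha), State.setNat_real,
          h3 a ha]
  rw [exec_loop, hN]
  exact (key N le_rfl).1

/-! ### Running times -/

/-- The entry that holds `n` or the entry that holds `k`. -/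
def _root_.RealRAM.NExp.isSize : NExp → Bool
  | .get 0 (.const 0) (.const 0) => true
  | .get 0 (.const 0) (.const 1) => true
  | _ => false

/-- All loops run `n` or `k` times. -/
def sizeBounded : Cmd → Bool
  | skip => true
  | setNat _ _ _ _ => true
  | setReal _ _ _ _ => true
  | seq c c' => c.sizeBounded && c'.sizeBounded
  | ite _ c c' => c.sizeBounded && c'.sizeBounded
  | loop _ e c => e.isSize && c.sizeBounded

/-- The nesting depth of the loops. -/
def depth : Cmd → ℕ
  | skip => 0
  | setNat _ _ _ _ => 0
  | setReal _ _ _ _ => 0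
  | seq c c' => max c.depth c'.depth
  | ite _ c c' => max c.depth c'.depth
  | loop _ _ c => c.depth + 1

/-- The constant in the bound for the running time. -/
def coef : Cmd → ℕ
  | skip => 1
  | setNat _ i j e => 1 + i.cost + j.cost + e.cost
  | setReal _ i j e => 1 + i.cost + j.cost + e.cost
  | seq c c' => 1 + c.coef + c'.coef
  | ite b c c' => 1 + b.cost + c.coef + c'.coef
  | loop _ e c => 1 + e.cost + (1 + c.coef)

theorem _root_.RealRAM.NExp.eval_le_of_isSize {e : NExp} (h : e.isSize = true) {s : State} {N : ℕ}
    (h0 : s.nat 0 0 0 ≤ N) (h1 : s.nat 0 0 1 ≤ N) : e.eval s ≤ N := by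
  unfold NExp.isSize at h
  split at h
  · exact h0
  · exact h1
  · exact absurd h (by simp)

/-- No semantics of the program is needed: array `0` is never written, so the loop lengths keep
their initial values, and each nesting level costs a factor `N`. -/
theorem run_snd_le {c : Cmd} (hb : c.sizeBounded = true) (hw : c.writesNat 0 = false) {N : ℕ}
    (hN : 1 ≤ N) {s : State} (h0 : s.nat 0 0 0 ≤ N) (h1 : s.nat 0 0 1 ≤ N) :
    (c.run s).2 ≤ c.coef * N ^ c.depth := by
  induction c generalizing s with
  | skip => simp [run, coef, depth]
  | setNat a i j e => simp [run, coef, depth]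
  | setReal a i j e => simp [run, coef, depth]
  | seq c c' ih ih' =>
    simp only [sizeBounded, Bool.and_eq_true] at hb
    simp only [writesNat, Bool.or_eq_false_iff] at hw
    have e0 := exec_nat_of_writesNat hw.1 s
    have i1 := ih hb.1 hw.1 h0 h1
    have i2 := ih' hb.2 hw.2 (s := c.exec s) (by rw [e0]; exact h0) (by rw [e0]; exact h1)
    have m1 : N ^ c.depth ≤ N ^ max c.depth c'.depth := Nat.pow_le_pow_right hN (le_max_left _ _)
    have m2 : N ^ c'.depth ≤ N ^ max c.depth c'.depth := Nat.pow_le_pow_right hN (le_max_right _ _)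
    have m3 : 1 ≤ N ^ max c.depth c'.depth := Nat.one_le_pow _ _ hN
    have n1 := Nat.mul_le_mul_left c.coef m1
    have n2 := Nat.mul_le_mul_left c'.coef m2
    simp only [run, coef, depth]
    change 1 + (c.run s).2 + (c'.run (c.exec s)).2 ≤ _
    rw [add_mul, add_mul, one_mul]
    omega
  | ite b c c' ih ih' =>
    simp only [sizeBounded, Bool.and_eq_true] at hb
    simp only [writesNat, Bool.or_eq_false_iff] at hw
    have i1 := ih hb.1 hw.1 h0 h1
    have i2 := ih' hb.2 hw.2 h0 h1
    have m1 : N ^ c.depth ≤ N ^ max c.depth c'.depth := Nat.pow_le_pow_right hN (le_max_left _ _)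
    have m2 : N ^ c'.depth ≤ N ^ max c.depth c'.depth := Nat.pow_le_pow_right hN (le_max_right _ _)
    have m3 : 1 ≤ N ^ max c.depth c'.depth := Nat.one_le_pow _ _ hN
    have n1 := Nat.mul_le_mul_left c.coef m1
    have n2 := Nat.mul_le_mul_left c'.coef m2
    have n3 := Nat.mul_le_mul_left b.cost m3
    simp only [run, coef, depth]
    rw [add_mul, add_mul, add_mul, one_mul]
    split_ifs
    · change 1 + b.cost + (c.run s).2 ≤ _
      omega
    · change 1 + b.cost + (c'.run s).2 ≤ _
      omega
  | loop v e c ih =>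
    simp only [sizeBounded, Bool.and_eq_true] at hb
    simp only [writesNat, Bool.or_eq_false_iff] at hw
    have hv : (0 : ℕ) ≠ v := by simpa using hw.1
    have hle := NExp.eval_le_of_isSize hb.1 h0 h1
    have key : ∀ M, (Nat.rec (s, 1 + e.cost)
        (fun t r => ((c.run (r.1.setNat v 0 0 t)).1,
          r.2 + 1 + (c.run (r.1.setNat v 0 0 t)).2)) M : State × ℕ).1.nat 0 = s.nat 0 ∧
        (Nat.rec (s, 1 + e.cost)
        (fun t r => ((c.run (r.1.setNat v 0 0 t)).1,
          r.2 + 1 + (c.run (r.1.setNat v 0 0 t)).2)) M : State × ℕ).2 ≤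
          1 + e.cost + M * (1 + c.coef * N ^ c.depth) := by
      intro M
      induction M with
      | zero => exact ⟨rfl, by simp⟩
      | succ t iht =>
        obtain ⟨j1, j2⟩ := iht
        set r : State × ℕ := Nat.rec (s, 1 + e.cost)
          (fun t r => ((c.run (r.1.setNat v 0 0 t)).1,
            r.2 + 1 + (c.run (r.1.setNat v 0 0 t)).2)) t
        have hr : (r.1.setNat v 0 0 t).nat 0 = s.nat 0 := by
          rw [← j1]
          funext i' j'
          rw [State.setNat_nat, if_neg (fun hc => hv hc.1)]
        have i1 := ih hb.2 hw.2 (s := r.1.setNat v 0 0 t) (by rw [hr]; exact h0)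
          (by rw [hr]; exact h1)
        refine ⟨(exec_nat_of_writesNat hw.2 _).trans hr, ?_⟩
        change r.2 + 1 + (c.run (r.1.setNat v 0 0 t)).2 ≤ _
        rw [add_mul, one_mul]
        omega
    have m1 : 1 ≤ N ^ c.depth := Nat.one_le_pow _ _ hN
    have m2 : 1 ≤ N ^ (c.depth + 1) := Nat.one_le_pow _ _ hN
    simp only [run, coef, depth]
    refine (key _).2.trans ?_
    calc 1 + e.cost + e.eval s * (1 + c.coef * N ^ c.depth)
        ≤ 1 + e.cost + N * (1 + c.coef * N ^ c.depth) :=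
          Nat.add_le_add_left (Nat.mul_le_mul_right _ hle) _
      _ ≤ (1 + e.cost) * N ^ (c.depth + 1) + N * (N ^ c.depth + c.coef * N ^ c.depth) := by
          refine Nat.add_le_add (Nat.le_mul_of_pos_right _ m2) (Nat.mul_le_mul_left _ ?_)
          omega
      _ = (1 + e.cost + (1 + c.coef)) * N ^ (c.depth + 1) := by ring

end Cmd

end RealRAM

/-! ### The program -/

namespace RealRAM

namespace AvgLink

/-- The entry `(0, 0)` of an array of natural numbers. -/
def cell (a : ℕ) : NExp := .get a (.const 0) (.const 0)

/-- The number of clusters asked for. -/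
def numClusters : NExp := .get 0 (.const 0) (.const 1)

/-- The label of the current cluster of a point; labels are points of the cluster. -/
def lab (i : NExp) : NExp := .get 2 i (.const 0)

/-- The singletons as clusters, with their sizes and distance sums. -/
def initCmd : Cmd :=
  .loop 10 (cell 0) <|
    .seq (.setNat 2 (cell 10) (.const 0) (cell 10)) <|
    .seq (.setNat 3 (cell 10) (.const 0) (.const 1)) <|
    .loop 11 (cell 0) (.setReal 1 (cell 10) (cell 11) (.get 0 (cell 10) (cell 11)))

/-- Adds the row of the second cluster to that of the first one. -/
def addRows : Cmd :=
  .loop 12 (cell 0) (.setReal 1 (cell 6) (cell 12)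
    (.add (.get 1 (cell 6) (cell 12)) (.get 1 (cell 7) (cell 12))))

/-- Adds the column of the second cluster to that of the first one. -/
def addCols : Cmd :=
  .loop 12 (cell 0) (.setReal 1 (cell 12) (cell 6)
    (.add (.get 1 (cell 12) (cell 6)) (.get 1 (cell 12) (cell 7))))

/-- Gives the points of the second cluster the label of the first one. -/
def relabel : Cmd :=
  .loop 12 (cell 0) (.ite (.natEq (lab (cell 12)) (cell 7))
    (.setNat 2 (cell 12) (.const 0) (cell 6)) .skip)

/-- Joins the clusters with the labels in the cells `6` and `7`. -/
def unionCmd : Cmd :=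
  .seq addRows <| .seq addCols <|
  .seq (.setNat 3 (cell 6) (.const 0)
    (.add (.get 3 (cell 6) (.const 0)) (.get 3 (cell 7) (.const 0)))) relabel

/-- The point in cell `12` comes before the one in cell `11` in the order of distances from the
one in cell `10`. -/
def closerTest : Test :=
  .and (.not (.natEq (cell 12) (cell 10)))
    (.or (.realLt (.get 0 (cell 10) (cell 12)) (.get 0 (cell 10) (cell 11)))
      (.and (.not (.realLt (.get 0 (cell 10) (cell 11)) (.get 0 (cell 10) (cell 12))))
        (.natLt (cell 12) (cell 11))))

/-- Counts the points that are closer. -/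
def rankCmd : Cmd :=
  .seq (.setNat 5 (.const 0) (.const 0) (.const 0)) <|
  .loop 12 (cell 0) (.ite closerTest
    (.setNat 5 (.const 0) (.const 0) (.add (cell 5) (.const 1))) .skip)

/-- The point in cell `11` is a nearest neighbour of the one in cell `10`, and their clusters are
still different. -/
def edgeTest : Test :=
  .and (.not (.natEq (cell 11) (cell 10)))
    (.and (.natLt (.add (.add (cell 5) (cell 5)) (.const 1)) (.get 0 (.const 0) (.const 2)))
      (.not (.natEq (lab (cell 10)) (lab (cell 11)))))

/-- The connected components of the nearest neighbour graph. -/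
def componentsCmd : Cmd :=
  .loop 10 (cell 0) <| .loop 11 (cell 0) <| .seq rankCmd <|
    .ite edgeTest
      (.seq (.setNat 6 (.const 0) (.const 0) (lab (cell 10))) <|
        .seq (.setNat 7 (.const 0) (.const 0) (lab (cell 11))) unionCmd)
      .skip

/-- The optimal prunings of the leaves. -/
def leavesCmd : Cmd :=
  .loop 10 (cell 0) <| .loop 11 numClusters <|
    .seq (.setReal 2 (cell 10) (.add (cell 11) (.const 1)) (.get 1 (cell 10) (cell 10)))
      (.setNat 4 (cell 10) (.add (cell 11) (.const 1)) (lab (cell 10)))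

/-- The average distance of the clusters with the given labels. -/
def avgDist (u v : NExp) : RExp :=
  .div (.get 1 u v) (.mul (.ofNat (.get 3 u (.const 0))) (.ofNat (.get 3 v (.const 0))))

/-- The cells `11` and `12` hold labels of different clusters that are closer than the best pair
found so far. -/
def betterTest : Test :=
  .and (.natEq (lab (cell 11)) (cell 11)) <| .and (.natEq (lab (cell 12)) (cell 12)) <|
  .and (.not (.natEq (cell 11) (cell 12))) <|
    .or (.natEq (cell 6) (cell 7))
      (.realLt (avgDist (cell 11) (cell 12)) (avgDist (cell 6) (cell 7)))

/-- Finds two clusters at minimum average distance. -/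
def findCmd : Cmd :=
  .seq (.setNat 6 (.const 0) (.const 0) (.const 0)) <|
  .seq (.setNat 7 (.const 0) (.const 0) (.const 0)) <|
  .loop 11 (cell 0) <| .loop 12 (cell 0) <|
    .ite betterTest
      (.seq (.setNat 6 (.const 0) (.const 0) (cell 11)) (.setNat 7 (.const 0) (.const 0) (cell 12)))
      .skip

/-- The cost of a split with `i` clusters on the left. -/
def splitCost (i : NExp) : RExp :=
  .add (.get 2 (cell 6) i) (.get 2 (cell 7) (.sub (cell 8) i))

/-- Finds the best number of clusters on the left (`0` for no split) and its cost. -/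
def bestSplit : Cmd :=
  .seq (.setReal 3 (.const 0) (.const 0)
    (.add (.add (.get 1 (cell 6) (cell 6)) (.get 1 (cell 6) (cell 7)))
      (.add (.get 1 (cell 7) (cell 6)) (.get 1 (cell 7) (cell 7))))) <|
  .seq (.setNat 9 (.const 0) (.const 0) (.const 0)) <|
  .loop 12 numClusters <|
    .ite (.and (.natLt (.const 0) (cell 12)) (.and (.natLt (cell 12) (cell 8))
        (.realLt (splitCost (cell 12)) (.get 3 (.const 0) (.const 0)))))
      (.seq (.setReal 3 (.const 0) (.const 0) (splitCost (cell 12)))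
        (.setNat 9 (.const 0) (.const 0) (cell 12)))
      .skip

/-- Updates the labels of the best pruning with at most as many clusters as cell `8` says. -/
def updateLabels : Cmd :=
  .loop 12 (cell 0) <|
    .ite (.natEq (lab (cell 12)) (cell 6))
      (.ite (.natEq (cell 9) (.const 0)) (.setNat 4 (cell 12) (cell 8) (cell 6))
        (.setNat 4 (cell 12) (cell 8) (.get 4 (cell 12) (cell 9)))) <|
    .ite (.natEq (lab (cell 12)) (cell 7))
      (.ite (.natEq (cell 9) (.const 0)) (.setNat 4 (cell 12) (cell 8) (cell 6))
        (.setNat 4 (cell 12) (cell 8) (.get 4 (cell 12) (.sub (cell 8) (cell 9)))))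
      .skip

/-- The optimal prunings of the union of two clusters. -/
def pruneCmd : Cmd :=
  .loop 11 numClusters <|
    .seq (.setNat 8 (.const 0) (.const 0) (.sub numClusters (cell 11))) <|
    .seq bestSplit <|
    .seq (.setReal 2 (cell 6) (cell 8) (.get 3 (.const 0) (.const 0))) updateLabels

/-- Merges clusters until one is left. -/
def mergeCmd : Cmd :=
  .loop 10 (cell 0) <| .seq findCmd <|
    .ite (.not (.natEq (cell 6) (cell 7))) (.seq pruneCmd unionCmd) .skip

/-- Writes the output. -/
def outputCmd : Cmd :=
  .loop 10 (cell 0) (.setNat 1 (cell 10) (.const 0) (.get 4 (cell 10) numClusters))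

end AvgLink

open AvgLink in
/-- The average linkage algorithm. -/
def averageLinkage : Cmd :=
  .seq initCmd <| .seq componentsCmd <| .seq leavesCmd <| .seq mergeCmd outputCmd

/-- The exponent comes from evaluating the loop depth of the concrete program. -/
theorem averageLinkage_run_snd_le {s : State} {n : ℕ} (hn : 1 ≤ n) (h0 : s.nat 0 0 0 ≤ n)
    (h1 : s.nat 0 0 1 ≤ n) :
    (averageLinkage.run s).2 ≤ averageLinkage.coef * n ^ 3 :=
  Cmd.run_snd_le (by decide) (by decide) hn h0 h1

namespace AvgLink

attribute [simp] NExp.eval RExp.eval Test.Holds cell lab numClusters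

/-! ### Unions -/

theorem addRows_real {n : ℕ} {s : State} (hn : s.nat 0 0 0 = n) (hne : s.nat 6 0 0 ≠ s.nat 7 0 0)
    (i j : ℕ) :
    (addRows.exec s).real 1 i j = if i = s.nat 6 0 0 ∧ j < n then
      s.real 1 (s.nat 6 0 0) j + s.real 1 (s.nat 7 0 0) j else s.real 1 i j := by
  refine Cmd.exec_loop_induct (I := fun t s' => ∀ i j, s'.real 1 i j =
    if i = s.nat 6 0 0 ∧ j < t then s.real 1 (s.nat 6 0 0) j + s.real 1 (s.nat 7 0 0) j
    else s.real 1 i j) (N := n) (by simpa using hn) (by simp) ?_ i j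
  intro t _ s' hnat _ hI i j
  have h6 := hnat 6 (by decide)
  have h7 := hnat 7 (by decide)
  simp only [Cmd.exec_setReal, NExp.eval, cell, RExp.eval, State.setReal_real, State.setNat_nat,
    State.setNat_real, h6, h7, hI]
  norm_num
  grind

theorem addCols_real {n : ℕ} {s : State} (hn : s.nat 0 0 0 = n) (hne : s.nat 6 0 0 ≠ s.nat 7 0 0)
    (i j : ℕ) :
    (addCols.exec s).real 1 i j = if j = s.nat 6 0 0 ∧ i < n then
      s.real 1 i (s.nat 6 0 0) + s.real 1 i (s.nat 7 0 0) else s.real 1 i j := by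
  refine Cmd.exec_loop_induct (I := fun t s' => ∀ i j, s'.real 1 i j =
    if j = s.nat 6 0 0 ∧ i < t then s.real 1 i (s.nat 6 0 0) + s.real 1 i (s.nat 7 0 0)
    else s.real 1 i j) (N := n) (by simpa using hn) (by simp) ?_ i j
  intro t _ s' hnat _ hI i j
  have h6 := hnat 6 (by decide)
  have h7 := hnat 7 (by decide)
  simp only [Cmd.exec_setReal, NExp.eval, cell, RExp.eval, State.setReal_real, State.setNat_nat,
    State.setNat_real, h6, h7, hI]
  norm_num
  grind

theorem relabel_nat {n : ℕ} {s : State} (hn : s.nat 0 0 0 = n) (hne : s.nat 6 0 0 ≠ s.nat 7 0 0)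
    (i : ℕ) :
    (relabel.exec s).nat 2 i 0 = if i < n ∧ s.nat 2 i 0 = s.nat 7 0 0 then s.nat 6 0 0
      else s.nat 2 i 0 := by
  refine Cmd.exec_loop_induct (I := fun t s' => ∀ i, s'.nat 2 i 0 =
    if i < t ∧ s.nat 2 i 0 = s.nat 7 0 0 then s.nat 6 0 0 else s.nat 2 i 0) (N := n)
    (by simpa using hn) (by simp) ?_ i
  intro t _ s' hnat _ hI i
  have h6 := hnat 6 (by decide)
  have h7 := hnat 7 (by decide)
  have ht : s'.nat 2 t 0 = s.nat 2 t 0 := by rw [hI]; simp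
  by_cases hb : s.nat 2 t 0 = s.nat 7 0 0
  · rw [Cmd.exec_ite_of_holds (by simp [h7, ht, hb])]
    simp only [Cmd.exec_setNat, NExp.eval, cell, State.setNat_nat, h6, hI]
    norm_num
    grind
  · rw [Cmd.exec_ite_of_not_holds (by simp [h7, ht, hb])]
    simp only [Cmd.exec_skip, State.setNat_nat, hI]
    norm_num
    grind

theorem unionCmd_lab {n : ℕ} {s : State} (hn : s.nat 0 0 0 = n) (hne : s.nat 6 0 0 ≠ s.nat 7 0 0)
    (i : ℕ) :
    (unionCmd.exec s).nat 2 i 0 = if i < n ∧ s.nat 2 i 0 = s.nat 7 0 0 then s.nat 6 0 0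
      else s.nat 2 i 0 := by
  simp only [unionCmd, Cmd.exec_seq]
  rw [relabel_nat (n := n)]
  · simp [Cmd.exec_nat_of_writesNat (c := addRows) (a := 2) rfl, Cmd.exec_nat_of_writesNat (c := addCols) (a := 2) rfl,
      Cmd.exec_nat_of_writesNat (c := addRows) (a := 6) rfl, Cmd.exec_nat_of_writesNat (c := addCols) (a := 6) rfl,
      Cmd.exec_nat_of_writesNat (c := addRows) (a := 7) rfl, Cmd.exec_nat_of_writesNat (c := addCols) (a := 7) rfl]
  · simp [Cmd.exec_nat_of_writesNat (c := addRows) (a := 0) rfl, Cmd.exec_nat_of_writesNat (c := addCols) (a := 0) rfl, hn]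
  · simp [Cmd.exec_nat_of_writesNat (c := addRows) (a := 6) rfl, Cmd.exec_nat_of_writesNat (c := addCols) (a := 6) rfl,
      Cmd.exec_nat_of_writesNat (c := addRows) (a := 7) rfl, Cmd.exec_nat_of_writesNat (c := addCols) (a := 7) rfl, hne]

theorem unionCmd_size {s : State} (i : ℕ) :
    (unionCmd.exec s).nat 3 i 0 = if i = s.nat 6 0 0 then
      s.nat 3 (s.nat 6 0 0) 0 + s.nat 3 (s.nat 7 0 0) 0 else s.nat 3 i 0 := by
  simp only [unionCmd, Cmd.exec_seq]
  rw [Cmd.exec_nat_of_writesNat (c := relabel) (a := 3) rfl]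
  simp [Cmd.exec_nat_of_writesNat (c := addRows) (a := 3) rfl, Cmd.exec_nat_of_writesNat (c := addCols) (a := 3) rfl,
    Cmd.exec_nat_of_writesNat (c := addRows) (a := 6) rfl, Cmd.exec_nat_of_writesNat (c := addCols) (a := 6) rfl,
    Cmd.exec_nat_of_writesNat (c := addRows) (a := 7) rfl, Cmd.exec_nat_of_writesNat (c := addCols) (a := 7) rfl]

/-- Rows are added before columns, so the corner entry collects all four sums. The row and column of
the absorbed label become meaningless, which is harmless since that label is no longer in use. -/
theorem unionCmd_sum {n : ℕ} {s : State} (hn : s.nat 0 0 0 = n) (hne : s.nat 6 0 0 ≠ s.nat 7 0 0)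
    {i j : ℕ} (hi : i < n) (hj : j < n) (h7 : s.nat 7 0 0 < n) :
    (unionCmd.exec s).real 1 i j =
      if i = s.nat 6 0 0 then
        if j = s.nat 6 0 0 then
          s.real 1 (s.nat 6 0 0) (s.nat 6 0 0) + s.real 1 (s.nat 7 0 0) (s.nat 6 0 0) +
            (s.real 1 (s.nat 6 0 0) (s.nat 7 0 0) + s.real 1 (s.nat 7 0 0) (s.nat 7 0 0))
        else s.real 1 (s.nat 6 0 0) j + s.real 1 (s.nat 7 0 0) j
      else if j = s.nat 6 0 0 then s.real 1 i (s.nat 6 0 0) + s.real 1 i (s.nat 7 0 0)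
        else s.real 1 i j := by
  simp only [unionCmd, Cmd.exec_seq]
  rw [Cmd.exec_real_of_writesReal (c := relabel) (a := 1) rfl]
  simp only [Cmd.exec_setNat, State.setNat_real]
  have e0 := Cmd.exec_nat_of_writesNat (c := addRows) (a := 0) rfl s
  have e6 := Cmd.exec_nat_of_writesNat (c := addRows) (a := 6) rfl s
  have e7 := Cmd.exec_nat_of_writesNat (c := addRows) (a := 7) rfl s
  rw [addCols_real (n := n) (by rw [e0, hn]) (by rw [e6, e7]; exact hne)]
  simp only [e6, e7, addRows_real hn hne]
  grind

/-! ### Representations of partitions -/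

/-- The cluster with the label `p`. -/
def cluster (n : ℕ) (s : State) (p : ℕ) : Finset (Fin n) :=
  univ.filter fun a : Fin n => s.nat 2 a 0 = p

@[simp] theorem mem_cluster {n : ℕ} {s : State} {p : ℕ} {a : Fin n} :
    a ∈ cluster n s p ↔ s.nat 2 a 0 = p := by simp [cluster]

/-- The state represents a partition with its sizes and distance sums. -/
structure Represents {n : ℕ} (d : Fin n → Fin n → ℝ) (s : State) : Prop where
  lab_lt : ∀ a : Fin n, s.nat 2 a 0 < n
  lab_lab : ∀ a : Fin n, s.nat 2 (s.nat 2 a 0) 0 = s.nat 2 a 0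
  size : ∀ a : Fin n, s.nat 3 (s.nat 2 a 0) 0 = (cluster n s (s.nat 2 a 0)).card
  sum : ∀ a b : Fin n, s.real 1 (s.nat 2 a 0) (s.nat 2 b 0) =
    dsum d (cluster n s (s.nat 2 a 0)) (cluster n s (s.nat 2 b 0))

theorem Represents.congr {n : ℕ} {d : Fin n → Fin n → ℝ} {s s' : State} (h : Represents d s)
    (h2 : s'.nat 2 = s.nat 2) (h3 : s'.nat 3 = s.nat 3) (h1 : s'.real 1 = s.real 1) :
    Represents d s' := by
  have hc : cluster n s' = cluster n s := by unfold cluster; rw [h2]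
  refine ⟨?_, ?_, ?_, ?_⟩ <;> simp only [h2, h3, h1, hc]
  exacts [h.lab_lt, h.lab_lab, h.size, h.sum]

theorem cluster_disjoint {n : ℕ} (s : State) {p q : ℕ} (h : p ≠ q) :
    Disjoint (cluster n s p) (cluster n s q) := by
  rw [Finset.disjoint_left]
  intro a ha hb
  rw [mem_cluster] at ha hb
  exact h (ha.symm.trans hb)

theorem cluster_unionCmd {n : ℕ} {s : State} (hn : s.nat 0 0 0 = n)
    (hne : s.nat 6 0 0 ≠ s.nat 7 0 0) (p : ℕ) :
    cluster n (unionCmd.exec s) p = if p = s.nat 6 0 0 then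
      cluster n s (s.nat 6 0 0) ∪ cluster n s (s.nat 7 0 0) else
      if p = s.nat 7 0 0 then ∅ else cluster n s p := by
  ext a
  rw [mem_cluster, unionCmd_lab hn hne]
  have := a.2
  split_ifs <;> simp <;> grind

theorem Represents.union {n : ℕ} {d : Fin n → Fin n → ℝ} {s : State} (h : Represents d s)
    (hn : s.nat 0 0 0 = n) {u v : Fin n} (hu : s.nat 6 0 0 = s.nat 2 u 0)
    (hv : s.nat 7 0 0 = s.nat 2 v 0) (hne : s.nat 2 u 0 ≠ s.nat 2 v 0) :
    Represents d (unionCmd.exec s) := by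
  have hne' : s.nat 6 0 0 ≠ s.nat 7 0 0 := by rw [hu, hv]; exact hne
  have hlab : ∀ a : Fin n, (unionCmd.exec s).nat 2 a 0 =
      if s.nat 2 a 0 = s.nat 2 v 0 then s.nat 2 u 0 else s.nat 2 a 0 := by
    intro a
    rw [unionCmd_lab hn hne', hu, hv]
    simp
  have hl : ∀ a : Fin n, ∃ b : Fin n, (unionCmd.exec s).nat 2 a 0 = s.nat 2 b 0 ∧
      s.nat 2 b 0 ≠ s.nat 2 v 0 := by
    intro a
    rw [hlab]
    split_ifs with hc
    · exact ⟨u, rfl, hne⟩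
    · exact ⟨a, rfl, hc⟩
  have hdis := cluster_disjoint (n := n) s hne
  refine ⟨?_, ?_, ?_, ?_⟩
  · intro a
    obtain ⟨b, hb, -⟩ := hl a
    rw [hb]
    exact h.lab_lt b
  · intro a
    obtain ⟨b, hb, hbv⟩ := hl a
    rw [hb, unionCmd_lab hn hne', h.lab_lab, hv]
    simp [hbv]
  · intro a
    obtain ⟨b, hb, hbv⟩ := hl a
    rw [hb, unionCmd_size, cluster_unionCmd hn hne', hu, hv, if_neg hbv]
    split_ifs with hc
    · rw [h.size, h.size, Finset.card_union_of_disjoint hdis]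
    · exact h.size b
  · intro a a'
    obtain ⟨b, hb, hbv⟩ := hl a
    obtain ⟨b', hb', hbv'⟩ := hl a'
    rw [hb, hb', unionCmd_sum hn hne' (h.lab_lt b) (h.lab_lt b') (by rw [hv]; exact h.lab_lt v),
      cluster_unionCmd hn hne', cluster_unionCmd hn hne', hu, hv, if_neg hbv, if_neg hbv']
    split_ifs
    · rw [dsum_union_left d hdis, dsum_union_right d _ hdis, dsum_union_right d _ hdis,
        h.sum, h.sum, h.sum, h.sum]
      ring
    · rw [dsum_union_left d hdis, h.sum, h.sum]
    · rw [dsum_union_right d _ hdis, h.sum, h.sum]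
    · exact h.sum b b'

end AvgLink

end RealRAM

namespace RealRAM

theorem State.setNat_nat_of_ne {a b : ℕ} (h : a ≠ b) (s : State) (i j v : ℕ) :
    (s.setNat b i j v).nat a = s.nat a := by
  funext i' j'
  simp [h]

theorem State.setReal_real_of_ne {a b : ℕ} (h : a ≠ b) (s : State) (i j : ℕ) (v : ℝ) :
    (s.setReal b i j v).real a = s.real a := by
  funext i' j'
  simp [h]

namespace AvgLink

/-! ### Nearest neighbours -/

section Nearest

variable {n : ℕ} (d : Fin n → Fin n → ℝ)

/-- `r` comes before `q` in the order of distances from `p`. -/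
def Closer (p q r : Fin n) : Prop :=
  r ≠ p ∧ (d p r < d p q ∨ ¬ d p q < d p r ∧ r < q)

open scoped Classical in
/-- The number of points before `q` in the order of distances from `p`. -/
noncomputable def rank (p q : Fin n) : ℕ := (univ.filter (Closer d p q)).card

open scoped Classical in
/-- The first `⌊m / 2⌋` points in the order of distances from `p`. -/
noncomputable def nearest (m : ℕ) (p : Fin n) : Finset (Fin n) :=
  univ.filter fun q => q ≠ p ∧ 2 * rank d p q + 1 < m

variable {d}

theorem mem_nearest {m : ℕ} {p q : Fin n} :
    q ∈ nearest d m p ↔ q ≠ p ∧ 2 * rank d p q + 1 < m := by simp [nearest]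

/-- The relation is transitive and irreflexive: what precedes `r` precedes `q`, and `r` is counted
only for `q`. -/
theorem rank_lt_rank {p q r : Fin n} (h : Closer d p q r) : rank d p r < rank d p q := by
  classical
  apply Finset.card_lt_card
  rw [Finset.ssubset_iff_of_subset]
  · refine ⟨r, by simpa using h, ?_⟩
    simp [Closer]
  · intro x hx
    simp only [mem_filter, mem_univ, true_and, Closer, not_lt] at hx h ⊢
    refine ⟨hx.1, ?_⟩
    rcases hx.2 with h1 | h1 <;> rcases h.2 with h2 | h2
    · exact Or.inl (h1.trans h2)
    · exact Or.inl (h1.trans_le h2.1)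
    · exact Or.inl (h1.1.trans_lt h2)
    · exact Or.inr ⟨h1.1.trans h2.1, h1.2.trans h2.2⟩

/-- Ties are broken by the index, so the order on the points other than `p` is total. -/
theorem rank_injOn (p : Fin n) : Set.InjOn (rank d p) (univ.erase p : Finset (Fin n)) := by
  intro q hq r hr heq
  have hq' : q ≠ p := Finset.ne_of_mem_erase hq
  have hr' : r ≠ p := Finset.ne_of_mem_erase hr
  by_contra hne
  have h : Closer d p q r ∨ Closer d p r q := by
    unfold Closer
    rcases lt_trichotomy (d p q) (d p r) with h | h | h
    · exact Or.inr ⟨hq', Or.inl h⟩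
    · rcases lt_or_gt_of_ne hne with h' | h'
      · exact Or.inr ⟨hq', Or.inr ⟨by rw [h]; exact lt_irrefl _, h'⟩⟩
      · exact Or.inl ⟨hr', Or.inr ⟨by rw [h]; exact lt_irrefl _, h'⟩⟩
    · exact Or.inl ⟨hr', Or.inl h⟩
  rcases h with h | h
  · exact absurd heq (rank_lt_rank h).ne'
  · exact absurd heq (rank_lt_rank h).ne

theorem rank_lt {p q : Fin n} (h : q ≠ p) : rank d p q < n - 1 := by
  classical
  have hsub : univ.filter (Closer d p q) ⊆ (univ.erase p).erase q := by
    intro r hr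
    simp only [mem_filter, mem_univ, true_and, Closer] at hr
    refine Finset.mem_erase.2 ⟨?_, Finset.mem_erase.2 ⟨hr.1, mem_univ _⟩⟩
    rintro rfl
    simp at hr
  have hcard := Finset.card_le_card hsub
  have hpos : 0 < (univ.erase p).card := Finset.card_pos.2 ⟨q, Finset.mem_erase.2 ⟨h, mem_univ _⟩⟩
  have h1 : (univ.erase p : Finset (Fin n)).card = n - 1 := by simp
  rw [Finset.card_erase_of_mem (Finset.mem_erase.2 ⟨h, mem_univ _⟩)] at hcard
  unfold rank
  omega

/-- The ranks of the `n - 1` other points are exactly `0, …, n - 2`. The test `2 rank + 1 < m` says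
`rank < ⌊m / 2⌋` without a division, so it selects exactly `⌊m / 2⌋` points. -/
theorem isNearestNeighbors_nearest {m : ℕ} (hm : m / 2 ≤ n - 1) (p : Fin n) :
    IsNearestNeighbors d (m / 2) p (nearest d m p) := by
  refine ⟨fun h => (mem_nearest.1 h).1 rfl, ?_, ?_⟩
  · have himg : (univ.erase p).image (rank d p) = range (n - 1) := by
      apply Finset.eq_of_subset_of_card_le
      · intro i hi
        obtain ⟨q, hq, rfl⟩ := Finset.mem_image.1 hi
        exact Finset.mem_range.2 (rank_lt (Finset.ne_of_mem_erase hq))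
      · rw [Finset.card_image_of_injOn (rank_injOn p)]
        simp
    have himg' : (nearest d m p).image (rank d p) = range (m / 2) := by
      ext i
      simp only [mem_image, mem_nearest, mem_range]
      constructor
      · rintro ⟨q, ⟨_, h⟩, rfl⟩
        omega
      · intro hi
        obtain ⟨q, hq, rfl⟩ := Finset.mem_image.1
          (himg ▸ Finset.mem_range.2 (by omega) : i ∈ (univ.erase p).image (rank d p))
        exact ⟨q, ⟨Finset.ne_of_mem_erase hq, by omega⟩, rfl⟩
    rw [← Finset.card_range (m / 2), ← himg', Finset.card_image_of_injOn]
    intro q hq r hr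
    exact rank_injOn p (Finset.mem_erase.2 ⟨(mem_nearest.1 hq).1, mem_univ _⟩)
      (Finset.mem_erase.2 ⟨(mem_nearest.1 hr).1, mem_univ _⟩)
  · intro q hq r hr hrp
    by_contra hlt
    have h1 := rank_lt_rank (d := d) (p := p) (q := q) (r := r) ⟨hrp, Or.inl (not_le.1 hlt)⟩
    have h2 := (mem_nearest.1 hq).2
    exact hr (mem_nearest.2 ⟨hrp, by omega⟩)

end Nearest

/-! ### Connected components -/

/-- The union step of connected components: identifying the labels of `p` and `q` corresponds to
adding the edge between them. Labels may stay as they are if they already agree. -/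
theorem relabel_reachable_iff {V : Type*} {R : V → V → Prop} {f : V → ℕ}
    (hf : ∀ u v, f u = f v ↔ (SimpleGraph.fromRel R).Reachable u v) {p q : V} (hpq : q ≠ p)
    (u v : V) :
    ((if f u = f q then f p else f u) = if f v = f q then f p else f v) ↔
      (SimpleGraph.fromRel fun a b => R a b ∨ a = p ∧ b = q).Reachable u v := by
  set G' := SimpleGraph.fromRel fun a b => R a b ∨ a = p ∧ b = q
  have hle : SimpleGraph.fromRel R ≤ G' := by
    intro a b hab
    rw [SimpleGraph.fromRel_adj] at hab ⊢
    exact ⟨hab.1, hab.2.imp Or.inl Or.inl⟩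
  have hmono : ∀ {a b}, f a = f b → G'.Reachable a b := fun h => ((hf _ _).1 h).mono hle
  have hadj : G'.Reachable p q := SimpleGraph.Adj.reachable (by
    rw [SimpleGraph.fromRel_adj]
    exact ⟨hpq.symm, Or.inl (Or.inr ⟨rfl, rfl⟩)⟩)
  have hstep : ∀ w, ∃ w', (if f w = f q then f p else f w) = f w' ∧ G'.Reachable w w' := by
    intro w
    split_ifs with h
    · exact ⟨p, rfl, (hmono h).trans hadj.symm⟩
    · exact ⟨w, rfl, SimpleGraph.Reachable.refl w⟩
  constructor
  · intro h
    obtain ⟨u', hu, hu'⟩ := hstep u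
    obtain ⟨v', hv, hv'⟩ := hstep v
    rw [hu, hv] at h
    exact (hu'.trans (hmono h)).trans hv'.symm
  · rintro ⟨w⟩
    induction w with
    | nil => rfl
    | @cons a b c hab _ ih =>
      rw [← ih]
      rw [SimpleGraph.fromRel_adj] at hab
      have key : ∀ a b, a ≠ b → (R a b ∨ a = p ∧ b = q) →
          (if f a = f q then f p else f a) = if f b = f q then f p else f b := by
        rintro a b hne (h | ⟨rfl, rfl⟩)
        · rw [(hf a b).2 (SimpleGraph.Adj.reachable (by
            rw [SimpleGraph.fromRel_adj]; exact ⟨hne, Or.inl h⟩))]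
        · by_cases h : f a = f b <;> simp [h]
      rcases hab.2 with h | h
      · exact key a b hab.1 h
      · exact (key b a hab.1.symm h).symm

/-- The input is as it was at the beginning. -/
structure HasInput (n k m : ℕ) (d : Fin n → Fin n → ℝ) (s : State) : Prop where
  size : s.nat 0 0 0 = n
  clusters : s.nat 0 0 1 = k
  param : s.nat 0 0 2 = m
  dist : ∀ a b : Fin n, s.real 0 a b = d a b

theorem HasInput.congr {n k m : ℕ} {d : Fin n → Fin n → ℝ} {s s' : State}
    (h : HasInput n k m d s) (h0 : s'.nat 0 = s.nat 0) (h1 : s'.real 0 = s.real 0) :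
    HasInput n k m d s' := by
  refine ⟨?_, ?_, ?_, ?_⟩ <;> simp only [h0, h1]
  exacts [h.size, h.clusters, h.param, h.dist]

variable {n k m : ℕ} {d : Fin n → Fin n → ℝ}

theorem rankCmd_nat {s : State} (h : HasInput n k m d s) {p q : Fin n} (hp : s.nat 10 0 0 = p)
    (hq : s.nat 11 0 0 = q) : (rankCmd.exec s).nat 5 0 0 = rank d p q := by
  classical
  have key : (rankCmd.exec s).nat 5 0 0 =
      (univ.filter fun r : Fin n => Closer d p q r ∧ r.1 < n).card := by
    rw [rankCmd, Cmd.exec_seq]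
    refine Cmd.exec_loop_induct (I := fun t s' => s'.nat 5 0 0 =
      (univ.filter fun r : Fin n => Closer d p q r ∧ r.1 < t).card) (N := n) ?_ ?_ ?_
    · simpa using h.size
    · simp
    · intro t ht s' hnat hreal hI
      have h10 : s'.nat 10 = s.nat 10 := hnat 10 (by decide)
      have h11 : s'.nat 11 = s.nat 11 := hnat 11 (by decide)
      have h0 : s'.real 0 = s.real 0 := hreal 0 (by decide)
      set r : Fin n := ⟨t, ht⟩ with hr
      have hset : (univ.filter fun r : Fin n => Closer d p q r ∧ r.1 < t + 1) =
          if Closer d p q r then insert r (univ.filter fun r : Fin n => Closer d p q r ∧ r.1 < t)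
          else univ.filter fun r : Fin n => Closer d p q r ∧ r.1 < t := by
        ext x
        have hx : x.1 < t + 1 ↔ x = r ∨ x.1 < t := by
          rw [Fin.ext_iff]
          change x.1 < t + 1 ↔ x.1 = t ∨ x.1 < t
          omega
        split_ifs with hc
        · simp only [mem_filter, mem_univ, true_and, mem_insert, hx]
          constructor
          · rintro ⟨h1, h2 | h2⟩
            · exact Or.inl h2
            · exact Or.inr ⟨h1, h2⟩
          · rintro (rfl | h1)
            · exact ⟨hc, Or.inl rfl⟩
            · exact ⟨h1.1, Or.inr h1.2⟩
        · simp only [mem_filter, mem_univ, true_and, hx]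
          constructor
          · rintro ⟨h1, rfl | h2⟩
            · exact absurd h1 hc
            · exact ⟨h1, h2⟩
          · exact fun h1 => ⟨h1.1, Or.inr h1.2⟩
      have hiff : closerTest.Holds (s'.setNat 12 0 0 t) ↔ Closer d p q r := by
        have e1 : s.real 0 p t = d p r := h.dist p r
        have e2 : s.real 0 p q = d p q := h.dist p q
        simp only [closerTest, Test.Holds, NExp.eval, RExp.eval, cell, State.setNat_nat,
          State.setNat_real, h10, h11, h0]
        norm_num
        rw [hp, hq, e1, e2, Closer, ← Fin.val_ne_iff, Fin.lt_def]
        simp [hr]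
      by_cases hc : Closer d p q r
      · rw [Cmd.exec_ite_of_holds (hiff.2 hc), hset, if_pos hc, Finset.card_insert_of_notMem]
        · simp [hI]
        · simp [hr]
      · rw [Cmd.exec_ite_of_not_holds (fun h' => hc (hiff.1 h')), hset, if_neg hc]
        simp [hI]
  rw [key, rank]
  congr 1
  ext r
  simp

theorem componentsCmd_spec {s : State} (h : HasInput n k m d s) (hr : Represents d s)
    (hlab : ∀ a : Fin n, s.nat 2 a 0 = a) :
    Represents d (componentsCmd.exec s) ∧ ∀ u v : Fin n,
      (componentsCmd.exec s).nat 2 u 0 = (componentsCmd.exec s).nat 2 v 0 ↔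
        (SimpleGraph.fromRel fun a b => b ∈ nearest d m a).Reachable u v := by
  have key : Represents d (componentsCmd.exec s) ∧ ∀ u v : Fin n,
      (componentsCmd.exec s).nat 2 u 0 = (componentsCmd.exec s).nat 2 v 0 ↔
        (SimpleGraph.fromRel fun a b : Fin n => b ∈ nearest d m a ∧ a.1 < n).Reachable u v := by
    refine Cmd.exec_loop_induct (I := fun p s' => Represents d s' ∧ ∀ u v : Fin n,
      s'.nat 2 u 0 = s'.nat 2 v 0 ↔
        (SimpleGraph.fromRel fun a b : Fin n => b ∈ nearest d m a ∧ a.1 < p).Reachable u v)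
      (N := n) (by simpa using h.size) ⟨hr, ?_⟩ ?_
    · intro u v
      rw [hlab, hlab]
      constructor
      · intro huv
        rw [Fin.ext huv]
      · rintro ⟨w⟩
        cases w with
        | nil => rfl
        | cons hadj _ =>
          rw [SimpleGraph.fromRel_adj] at hadj
          simp at hadj
    intro p hp s₁ hnat₁ hreal₁ hI₁
    have hin₁ : HasInput n k m d s₁ := h.congr (hnat₁ 0 (by decide)) (hreal₁ 0 (by decide))
    set P : Fin n := ⟨p, hp⟩ with hP
    -- The graph treated so far has all edges out of earlier points, and those out of `P` to points
    -- before `q`.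
    have key₂ := Cmd.exec_loop_induct (v := 11) (e := cell 0) (s := s₁.setNat 10 0 0 p)
      (c := .seq rankCmd (.ite edgeTest
        (.seq (.setNat 6 (.const 0) (.const 0) (lab (cell 10)))
          (.seq (.setNat 7 (.const 0) (.const 0) (lab (cell 11))) unionCmd)) .skip))
      (I := fun q s' => Represents d s' ∧ ∀ u v : Fin n, s'.nat 2 u 0 = s'.nat 2 v 0 ↔
        (SimpleGraph.fromRel fun a b : Fin n =>
          b ∈ nearest d m a ∧ (a.1 < p ∨ a = P ∧ b.1 < q)).Reachable u v)
      (N := n) (by simpa using hin₁.size) ?_ ?_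
    · refine ⟨key₂.1, fun u v => (key₂.2 u v).trans ?_⟩
      have : (fun a b : Fin n => b ∈ nearest d m a ∧ (a.1 < p ∨ a = P ∧ b.1 < n)) =
          fun a b : Fin n => b ∈ nearest d m a ∧ a.1 < p + 1 := by
        funext a b
        rw [Fin.ext_iff, hP]
        have := b.2
        simp only [this, and_true, eq_iff_iff]
        refine and_congr_right fun _ => ?_
        omega
      rw [this]
    · refine ⟨hI₁.1.congr ?_ ?_ ?_, fun u v => ?_⟩
      · exact State.setNat_nat_of_ne (by decide) _ _ _ _
      · exact State.setNat_nat_of_ne (by decide) _ _ _ _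
      · rfl
      · simpa using hI₁.2 u v
    intro q hq s₂ hnat₂ hreal₂ hI₂
    have hin₂ : HasInput n k m d s₂ := by
      refine hin₁.congr ((hnat₂ 0 (by decide)).trans ?_) (hreal₂ 0 (by decide))
      exact State.setNat_nat_of_ne (by decide) _ _ _ _
    set Q : Fin n := ⟨q, hq⟩ with hQ
    have h10 : s₂.nat 10 0 0 = P := by rw [hnat₂ 10 (by decide)]; simp [hP]
    -- the state after computing the rank
    rw [Cmd.exec_seq]
    set s₃ := rankCmd.exec (s₂.setNat 11 0 0 q) with hs₃
    have f : ∀ a, a ≠ 11 → rankCmd.writesNat a = false → s₃.nat a = s₂.nat a := by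
      intro a ha hw
      rw [hs₃, Cmd.exec_nat_of_writesNat hw]
      exact State.setNat_nat_of_ne ha _ _ _ _
    have f2 := f 2 (by decide) (by decide)
    have f3 := f 3 (by decide) (by decide)
    have f10 : s₃.nat 10 0 0 = p := by rw [f 10 (by decide) (by decide), h10]
    have f11 : s₃.nat 11 0 0 = q := by
      rw [hs₃, Cmd.exec_nat_of_writesNat (by decide)]; simp
    have fr : s₃.real = s₂.real := by
      funext a
      rw [hs₃, Cmd.exec_real_of_writesReal (by rfl), State.setNat_real]
    have hin₃ : HasInput n k m d s₃ :=
      hin₂.congr (f 0 (by decide) (by decide)) (by rw [fr])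
    have hrep₃ : Represents d s₃ := hI₂.1.congr f2 f3 (by rw [fr])
    have f5 : s₃.nat 5 0 0 = rank d P Q := by
      refine rankCmd_nat (k := k) (m := m) (s := s₂.setNat 11 0 0 q) (hin₂.congr ?_ rfl) ?_ ?_
      · exact State.setNat_nat_of_ne (by decide) _ _ _ _
      · simpa using h10
      · simp [hQ]
    have hI₃ : ∀ u v : Fin n, s₃.nat 2 u 0 = s₃.nat 2 v 0 ↔
        (SimpleGraph.fromRel fun a b : Fin n =>
          b ∈ nearest d m a ∧ (a.1 < p ∨ a = P ∧ b.1 < q)).Reachable u v := by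
      rw [f2]; exact hI₂.2
    have hiff : edgeTest.Holds s₃ ↔
        Q ∈ nearest d m P ∧ s₃.nat 2 P 0 ≠ s₃.nat 2 Q 0 := by
      simp only [edgeTest, Test.Holds, NExp.eval, cell, lab, f10, f11, f5, hin₃.param]
      rw [mem_nearest, ← Fin.val_ne_iff, two_mul, and_assoc]
    have hrel : ∀ a b : Fin n, (b ∈ nearest d m a ∧ (a.1 < p ∨ a = P ∧ b.1 < q + 1)) ↔
        ((b ∈ nearest d m a ∧ (a.1 < p ∨ a = P ∧ b.1 < q)) ∨
          (Q ∈ nearest d m P ∧ a = P ∧ b = Q)) := by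
      intro a b
      have hb : b.1 < q + 1 ↔ b = Q ∨ b.1 < q := by
        rw [Fin.ext_iff, hQ]
        change b.1 < q + 1 ↔ b.1 = q ∨ b.1 < q
        omega
      rw [hb]
      constructor
      · rintro ⟨h1, h2 | ⟨h2, h3 | h3⟩⟩
        · exact Or.inl ⟨h1, Or.inl h2⟩
        · exact Or.inr ⟨h3 ▸ h2 ▸ h1, h2, h3⟩
        · exact Or.inl ⟨h1, Or.inr ⟨h2, h3⟩⟩
      · rintro (⟨h1, h2 | ⟨h2, h3⟩⟩ | ⟨h1, rfl, rfl⟩)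
        · exact ⟨h1, Or.inl h2⟩
        · exact ⟨h1, Or.inr ⟨h2, Or.inr h3⟩⟩
        · exact ⟨h1, Or.inr ⟨rfl, Or.inl rfl⟩⟩
    have hrel' : (fun a b : Fin n => b ∈ nearest d m a ∧ (a.1 < p ∨ a = P ∧ b.1 < q + 1)) =
        fun a b : Fin n => (b ∈ nearest d m a ∧ (a.1 < p ∨ a = P ∧ b.1 < q)) ∨
          (Q ∈ nearest d m P ∧ a = P ∧ b = Q) := by
      funext a b; exact propext (hrel a b)
    rw [hrel']
    by_cases hQP : Q ∈ nearest d m P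
    · simp only [hQP, true_and]
      have hre := relabel_reachable_iff hI₃ (mem_nearest.1 hQP).1
      -- If the labels agree, the program skips the edge and the relabelling is the identity.
      by_cases hne : s₃.nat 2 P 0 = s₃.nat 2 Q 0
      · rw [Cmd.exec_ite_of_not_holds (fun hc => (hiff.1 hc).2 hne), Cmd.exec_skip]
        refine ⟨hrep₃, fun u v => (Iff.trans ?_ (hre u v))⟩
        rw [hne]
        split_ifs with h1 h2 h2 <;> simp [h1, h2]
      · rw [Cmd.exec_ite_of_holds (hiff.2 ⟨hQP, hne⟩), Cmd.exec_seq, Cmd.exec_seq,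
          Cmd.exec_setNat, Cmd.exec_setNat]
        set s₄ := (s₃.setNat 6 _ _ _).setNat 7 _ _ _ with hs₄
        have g2 : s₄.nat 2 = s₃.nat 2 := by
          rw [hs₄, State.setNat_nat_of_ne (by decide), State.setNat_nat_of_ne (by decide)]
        have g3 : s₄.nat 3 = s₃.nat 3 := by
          rw [hs₄, State.setNat_nat_of_ne (by decide), State.setNat_nat_of_ne (by decide)]
        have g0 : s₄.nat 0 0 0 = n := by
          rw [hs₄, State.setNat_nat_of_ne (by decide), State.setNat_nat_of_ne (by decide)]
          exact hin₃.size
        have g6 : s₄.nat 6 0 0 = s₄.nat 2 P 0 := by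
          rw [g2]; simp [hs₄, f10, hP]
        have g7 : s₄.nat 7 0 0 = s₄.nat 2 Q 0 := by
          rw [g2]; simp [hs₄, f11, hQ]
        have hne' : s₄.nat 2 P 0 ≠ s₄.nat 2 Q 0 := by rw [g2]; exact hne
        refine ⟨(hrep₃.congr g2 g3 rfl).union g0 g6 g7 hne', fun u v => Iff.trans ?_ (hre u v)⟩
        rw [unionCmd_lab g0 (by rw [g6, g7]; exact hne'),
          unionCmd_lab g0 (by rw [g6, g7]; exact hne'), g6, g7, g2]
        simp
    · rw [Cmd.exec_ite_of_not_holds (fun hc => hQP (hiff.1 hc).1), Cmd.exec_skip]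
      simp only [hQP, false_and, or_false]
      exact ⟨hrep₃, hI₃⟩
  refine ⟨key.1, fun u v => (key.2 u v).trans ?_⟩
  simp

end AvgLink

end RealRAM

namespace RealRAM

namespace AvgLink

variable {n k m : ℕ} {d : Fin n → Fin n → ℝ}

/-! ### Initialization -/

theorem initCmd_spec {s : State} (h : HasInput n k m d s) :
    Represents d (initCmd.exec s) ∧ ∀ a : Fin n, (initCmd.exec s).nat 2 a 0 = a := by
  have key : ∀ a < n, (initCmd.exec s).nat 2 a 0 = a ∧ (initCmd.exec s).nat 3 a 0 = 1 ∧
      ∀ b < n, (initCmd.exec s).real 1 a b = s.real 0 a b := by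
    refine Cmd.exec_loop_induct (I := fun p s' => ∀ a < p, s'.nat 2 a 0 = a ∧ s'.nat 3 a 0 = 1 ∧
      ∀ b < n, s'.real 1 a b = s.real 0 a b) (N := n) (by simpa using h.size) (by simp) ?_
    intro p hp s₁ hnat₁ hreal₁ hI₁
    rw [Cmd.exec_seq, Cmd.exec_seq, Cmd.exec_setNat, Cmd.exec_setNat]
    set s₂ := ((s₁.setNat 10 0 0 p).setNat 2 _ _ _).setNat 3 _ _ _ with hs₂
    set c : Cmd := .loop 11 (cell 0) (.setReal 1 (cell 10) (cell 11) (.get 0 (cell 10) (cell 11)))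
    have h0 : s₂.nat 0 0 0 = n := by
      have := hnat₁ 0 (by decide)
      simp [hs₂, this, h.size]
    have h10 : s₂.nat 10 0 0 = p := by simp [hs₂]
    have hr0 : s₂.real 0 = s.real 0 := by
      rw [← hreal₁ 0 (by decide)]
      simp [hs₂]
    have hc : ∀ i j, (c.exec s₂).real 1 i j = if i = p ∧ j < n then s.real 0 p j
        else s₁.real 1 i j := by
      refine Cmd.exec_loop_induct (I := fun q s' => ∀ i j, s'.real 1 i j =
        if i = p ∧ j < q then s.real 0 p j else s₁.real 1 i j) (N := n) (by simpa using h0) ?_ ?_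
      · simp [hs₂]
      intro q hq s₃ hnat₃ hreal₃ hI₃ i j
      have e10 := hnat₃ 10 (by decide)
      have e0 := hreal₃ 0 (by decide)
      simp only [Cmd.exec_setReal, NExp.eval, cell, RExp.eval, State.setReal_real,
        State.setNat_nat, State.setNat_real, e10, e0, hr0, hI₃]
      norm_num [h10]
      grind
    intro a ha
    rw [Cmd.exec_nat_of_writesNat (c := c) (a := 2) (by decide),
      Cmd.exec_nat_of_writesNat (c := c) (a := 3) (by decide)]
    rcases Nat.lt_succ_iff_lt_or_eq.1 ha with ha | rfl
    · obtain ⟨h1, h2, h3⟩ := hI₁ a ha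
      refine ⟨?_, ?_, fun b hb => ?_⟩
      · simp [hs₂, h1, ha.ne]
      · simp [hs₂, h2]
      · rw [hc, if_neg (fun hc => ha.ne hc.1), h3 b hb]
    · refine ⟨?_, ?_, fun b hb => ?_⟩
      · simp [hs₂]
      · simp [hs₂]
      · rw [hc, if_pos ⟨rfl, hb⟩]
  have hlab : ∀ a : Fin n, (initCmd.exec s).nat 2 a 0 = a := fun a => (key a a.2).1
  have hcl : ∀ a : Fin n, cluster n (initCmd.exec s) a = {a} := by
    intro a
    ext b
    rw [mem_cluster, hlab, Finset.mem_singleton, Fin.ext_iff]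
  refine ⟨⟨?_, ?_, ?_, ?_⟩, hlab⟩
  · intro a; rw [hlab]; exact a.2
  · intro a; rw [hlab, hlab]
  · intro a; rw [hlab, hcl, (key a a.2).2.1]; simp
  · intro a b
    rw [hlab, hlab, hcl, hcl, (key a a.2).2.2 b b.2, h.dist]
    simp [dsum]

theorem leavesCmd_spec {s : State} (h : HasInput n k m d s) :
    ∀ p < n, ∀ j < k, (leavesCmd.exec s).real 2 p (j + 1) = s.real 1 p p ∧
      (leavesCmd.exec s).nat 4 p (j + 1) = s.nat 2 p 0 := by
  refine Cmd.exec_loop_induct (I := fun t s' => ∀ p < t, ∀ j < k,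
    s'.real 2 p (j + 1) = s.real 1 p p ∧ s'.nat 4 p (j + 1) = s.nat 2 p 0) (N := n)
    (by simpa using h.size) (by simp) ?_
  intro p hp s₁ hnat₁ hreal₁ hI₁
  have key := Cmd.exec_loop_induct (v := 11) (e := numClusters) (s := s₁.setNat 10 0 0 p)
    (c := .seq (.setReal 2 (cell 10) (.add (cell 11) (.const 1)) (.get 1 (cell 10) (cell 10)))
      (.setNat 4 (cell 10) (.add (cell 11) (.const 1)) (lab (cell 10))))
    (I := fun t s' => ∀ i, (∀ j < k, (i < p ∨ i = p ∧ j < t) →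
      s'.real 2 i (j + 1) = s.real 1 i i ∧ s'.nat 4 i (j + 1) = s.nat 2 i 0)) (N := k) ?_ ?_ ?_
  · intro i hi j hj
    refine key i j hj ?_
    omega
  · have := hnat₁ 0 (by decide)
    simp [this, h.clusters]
  · intro i j hj hi
    have : i < p := by omega
    simpa using hI₁ i this j hj
  · intro t ht s₂ hnat₂ hreal₂ hI₂ i j hj hi
    have e10 := hnat₂ 10 (by decide)
    have e2 : s₂.nat 2 = s.nat 2 := by
      rw [hnat₂ 2 (by decide), ← hnat₁ 2 (by decide)]
      exact State.setNat_nat_of_ne (by decide) _ _ _ _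
    have e1 : s₂.real 1 = s.real 1 := by
      rw [hreal₂ 1 (by decide), ← hreal₁ 1 (by decide)]
      rfl
    have hold := hI₂ i j hj
    simp only [Cmd.exec_seq, Cmd.exec_setReal, Cmd.exec_setNat, NExp.eval, cell, lab, RExp.eval,
      State.setReal_real, State.setReal_nat, State.setNat_nat, State.setNat_real, e10, e2, e1]
    norm_num
    grind

/-! ### Finding the closest clusters -/

/-- The labels of two different clusters. -/
def IsPair (n : ℕ) (s : State) (x y : ℕ) : Prop :=
  x < n ∧ y < n ∧ s.nat 2 x 0 = x ∧ s.nat 2 y 0 = y ∧ x ≠ y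

/-- The average distance computed by the program. -/
noncomputable def pairDist (s : State) (x y : ℕ) : ℝ :=
  s.real 1 x y / ((s.nat 3 x 0 : ℝ) * (s.nat 3 y 0 : ℝ))

/-- The cells `6` and `7` hold the best one of the pairs in the relation `R`, if there are any. -/
def BestPair (n : ℕ) (s : State) (R : ℕ → ℕ → Prop) (l r : ℕ) : Prop :=
  (l = r ∧ ∀ x y, R x y → ¬ IsPair n s x y) ∨
    (IsPair n s l r ∧ ∀ x y, R x y → IsPair n s x y → pairDist s l r ≤ pairDist s x y)

/-- Equal cells encode that no pair has been found, which is unambiguous because the labels of a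
pair differ. -/
theorem findCmd_bestPair {s : State} (h : HasInput n k m d s) :
    BestPair n s (fun x y => x < n ∧ y < n) ((findCmd.exec s).nat 6 0 0)
      ((findCmd.exec s).nat 7 0 0) := by
  rw [findCmd, Cmd.exec_seq, Cmd.exec_seq, Cmd.exec_setNat, Cmd.exec_setNat]
  set s₀ := (s.setNat 6 _ _ _).setNat 7 _ _ _ with hs₀
  have g : ∀ a, a ≠ 6 → a ≠ 7 → s₀.nat a = s.nat a := by
    intro a h6 h7
    rw [hs₀, State.setNat_nat_of_ne h7, State.setNat_nat_of_ne h6]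
  refine Cmd.exec_loop_induct (I := fun p s' => BestPair n s (fun x y => x < p ∧ y < n)
    (s'.nat 6 0 0) (s'.nat 7 0 0)) (N := n) ?_ ?_ ?_
  · rw [← h.size, ← g 0 (by decide) (by decide)]; rfl
  · left
    simp [hs₀]
  intro p hp s₁ hnat₁ hreal₁ hI₁
  have key := Cmd.exec_loop_induct (v := 12) (e := cell 0) (s := s₁.setNat 11 0 0 p)
    (c := .ite betterTest (.seq (.setNat 6 (.const 0) (.const 0) (cell 11))
      (.setNat 7 (.const 0) (.const 0) (cell 12))) .skip)
    (I := fun q s' => BestPair n s (fun x y => (x < p ∨ x = p ∧ y < q) ∧ y < n)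
      (s'.nat 6 0 0) (s'.nat 7 0 0)) (N := n) ?_ ?_ ?_
  · have hR : (fun x y => (x < p ∨ x = p ∧ y < n) ∧ y < n) = fun x y => x < p + 1 ∧ y < n := by
      funext x y
      apply propext
      omega
    rwa [hR] at key
  · simp [hnat₁ 0 (by decide), g, h.size]
  · have hR : (fun x y => (x < p ∨ x = p ∧ y < 0) ∧ y < n) = fun x y => x < p ∧ y < n := by
      funext x y
      apply propext
      omega
    rw [hR]
    simpa using hI₁
  intro q hq s₂ hnat₂ hreal₂ hI₂
  have e2 : s₂.nat 2 = s.nat 2 := by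
    rw [hnat₂ 2 (by decide), State.setNat_nat_of_ne (by decide), hnat₁ 2 (by decide),
      g 2 (by decide) (by decide)]
  have e3 : s₂.nat 3 = s.nat 3 := by
    rw [hnat₂ 3 (by decide), State.setNat_nat_of_ne (by decide), hnat₁ 3 (by decide),
      g 3 (by decide) (by decide)]
  have e11 : s₂.nat 11 0 0 = p := by rw [hnat₂ 11 (by decide)]; simp
  have e1 : s₂.real 1 = s.real 1 := by
    rw [hreal₂ 1 (by decide), State.setNat_real, hreal₁ 1 (by decide)]
    rfl
  have hR : ∀ x y, ((x < p ∨ x = p ∧ y < q + 1) ∧ y < n) ↔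
      ((x < p ∨ x = p ∧ y < q) ∧ y < n) ∨ (x = p ∧ y = q) := by
    intro x y; omega
  have hiff : betterTest.Holds (s₂.setNat 12 0 0 q) ↔ IsPair n s p q ∧
      (s₂.nat 6 0 0 = s₂.nat 7 0 0 ∨
        pairDist s p q < pairDist s (s₂.nat 6 0 0) (s₂.nat 7 0 0)) := by
    simp only [betterTest, avgDist, Test.Holds, NExp.eval, RExp.eval, cell, lab, State.setNat_nat,
      State.setNat_real, IsPair, pairDist]
    norm_num [e2, e3, e1, e11]
    tauto
  by_cases ht : betterTest.Holds (s₂.setNat 12 0 0 q)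
  · rw [Cmd.exec_ite_of_holds ht]
    obtain ⟨hp1, hp2⟩ := hiff.1 ht
    have v6 : ((Cmd.seq (.setNat 6 (.const 0) (.const 0) (cell 11))
      (.setNat 7 (.const 0) (.const 0) (cell 12))).exec (s₂.setNat 12 0 0 q)).nat 6 0 0 = p := by
      simp [Cmd.exec_seq, e11]
    have v7 : ((Cmd.seq (.setNat 6 (.const 0) (.const 0) (cell 11))
      (.setNat 7 (.const 0) (.const 0) (cell 12))).exec (s₂.setNat 12 0 0 q)).nat 7 0 0 = q := by
      simp [Cmd.exec_seq]
    rw [v6, v7]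
    right
    refine ⟨hp1, fun x y hxy hpair => ?_⟩
    rcases (hR x y).1 hxy with hxy | ⟨rfl, rfl⟩
    · rcases hI₂ with ⟨_, hno⟩ | ⟨hpr, hmin⟩
      · exact absurd hpair (hno x y hxy)
      · rcases hp2 with hp2 | hp2
        · exact absurd hp2 hpr.2.2.2.2
        · exact hp2.le.trans (hmin x y hxy hpair)
    · exact le_rfl
  · rw [Cmd.exec_ite_of_not_holds ht, Cmd.exec_skip]
    have ht' := fun hc => ht (hiff.2 hc)
    have w6 : (s₂.setNat 12 0 0 q).nat 6 0 0 = s₂.nat 6 0 0 := by simp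
    have w7 : (s₂.setNat 12 0 0 q).nat 7 0 0 = s₂.nat 7 0 0 := by simp
    rw [w6, w7]
    rcases hI₂ with ⟨heq, hno⟩ | ⟨hpr, hmin⟩
    · refine Or.inl ⟨heq, fun x y hxy hpair => ?_⟩
      rcases (hR x y).1 hxy with hxy | ⟨rfl, rfl⟩
      · exact hno x y hxy hpair
      · exact ht' ⟨hpair, Or.inl heq⟩
    · refine Or.inr ⟨hpr, fun x y hxy hpair => ?_⟩
      rcases (hR x y).1 hxy with hxy | ⟨rfl, rfl⟩
      · exact hmin x y hxy hpair
      · by_contra hlt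
        exact ht' ⟨hpair, Or.inr (not_le.1 hlt)⟩

theorem Represents.pairDist_eq {s : State} (hr : Represents d s) (a b : Fin n) :
    pairDist s (s.nat 2 a 0) (s.nat 2 b 0) =
      davg d (cluster n s (s.nat 2 a 0)) (cluster n s (s.nat 2 b 0)) := by
  rw [pairDist, hr.sum, hr.size, hr.size, davg]

theorem findCmd_spec {s : State} (h : HasInput n k m d s) (hr : Represents d s) :
    ((findCmd.exec s).nat 6 0 0 = (findCmd.exec s).nat 7 0 0 ∧
      ∀ a b : Fin n, s.nat 2 a 0 = s.nat 2 b 0) ∨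
    ∃ u v : Fin n, (findCmd.exec s).nat 6 0 0 = s.nat 2 u 0 ∧
      (findCmd.exec s).nat 7 0 0 = s.nat 2 v 0 ∧ s.nat 2 u 0 ≠ s.nat 2 v 0 ∧
      ∀ a b : Fin n, s.nat 2 a 0 ≠ s.nat 2 b 0 →
        davg d (cluster n s (s.nat 2 u 0)) (cluster n s (s.nat 2 v 0)) ≤
          davg d (cluster n s (s.nat 2 a 0)) (cluster n s (s.nat 2 b 0)) := by
  have hpair : ∀ a b : Fin n, s.nat 2 a 0 ≠ s.nat 2 b 0 →
      IsPair n s (s.nat 2 a 0) (s.nat 2 b 0) := fun a b hab =>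
    ⟨hr.lab_lt a, hr.lab_lt b, hr.lab_lab a, hr.lab_lab b, hab⟩
  rcases findCmd_bestPair h with ⟨heq, hno⟩ | ⟨⟨h1, h2, h3, h4, h5⟩, hmin⟩
  · refine Or.inl ⟨heq, fun a b => ?_⟩
    by_contra hab
    exact hno _ _ ⟨hr.lab_lt a, hr.lab_lt b⟩ (hpair a b hab)
  · right
    set u : Fin n := ⟨_, h1⟩ with hu
    set v : Fin n := ⟨_, h2⟩ with hv
    have hu' : (findCmd.exec s).nat 6 0 0 = s.nat 2 u 0 := h3.symm
    have hv' : (findCmd.exec s).nat 7 0 0 = s.nat 2 v 0 := h4.symm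
    refine ⟨u, v, hu', hv', by rw [← hu', ← hv']; exact h5, fun a b hab => ?_⟩
    rw [← hr.pairDist_eq, ← hr.pairDist_eq, ← hu', ← hv']
    exact hmin _ _ ⟨hr.lab_lt a, hr.lab_lt b⟩ (hpair a b hab)

end AvgLink

end RealRAM

/-! ### Optimal prunings -/

section Optimal

variable {ι : Type*} [DecidableEq ι]

/-- `v` is the minimum cost of the prunings of `T` with at most `j` clusters, and the labelling `b`,
whose labels are points named by `e`, gives a pruning where it is attained. -/
def IsOptimalPruning (e : ι → ℕ) (d : ι → ι → ℝ) (T : ClusterTree ι) (j : ℕ) (v : ℝ) (b : ι → ℕ) :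
    Prop :=
  (∃ P, IsPruning T P ∧ P.card ≤ j ∧ minSumCost d P = v ∧
    (∀ x ∈ T.points, ∃ y ∈ T.points, b x = e y) ∧
    ∀ x ∈ T.points, ∀ y ∈ T.points, b x = b y ↔ ∃ A ∈ P, x ∈ A ∧ y ∈ A) ∧
  ∀ Q, IsPruning T Q → Q.card ≤ j → v ≤ minSumCost d Q

variable {e : ι → ℕ} {d : ι → ι → ℝ}

theorem minSumCost_singleton (A : Finset ι) : minSumCost d {A} = dsum d A A := by
  simp [minSumCost]

/-- A leaf has only the trivial pruning, which is admissible for every `j ≥ 1`. -/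
theorem IsOptimalPruning.leaf {A : Finset ι} {j : ℕ} (hj : 1 ≤ j) {b : ι → ℕ} {y : ι} (hy : y ∈ A)
    (hb : ∀ x ∈ A, b x = e y) : IsOptimalPruning e d (.leaf A) j (dsum d A A) b := by
  refine ⟨⟨{A}, IsPruning.root (.leaf A), by simpa using hj, minSumCost_singleton A,
    fun x hx => ⟨y, hy, hb x hx⟩, fun x hx z hz => ?_⟩, fun Q hQ _ => ?_⟩
  · rw [hb x hx, hb z hz]
    simpa using ⟨hx, hz⟩
  · cases hQ
    exact (minSumCost_singleton A).ge

theorem IsOptimalPruning.congr {T : ClusterTree ι} {j : ℕ} {v : ℝ} {b b' : ι → ℕ}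
    (h : IsOptimalPruning e d T j v b) (hb : ∀ x ∈ T.points, b' x = b x) :
    IsOptimalPruning e d T j v b' := by
  obtain ⟨⟨P, h1, h2, h3, h4, h5⟩, h6⟩ := h
  refine ⟨⟨P, h1, h2, h3, fun x hx => ?_, fun x hx y hy => ?_⟩, h6⟩
  · rw [hb x hx]; exact h4 x hx
  · rw [hb x hx, hb y hy]; exact h5 x hx y hy

/-- The recursion of the dynamic program. -/
theorem IsOptimalPruning.node (he : Function.Injective e) {l r : ClusterTree ι}
    (hW : (ClusterTree.node l r).WF) {j : ℕ} {fl fr : ℕ → ℝ} {bl br : ℕ → ι → ℕ}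
    (hl : ∀ i, 1 ≤ i → i < j → IsOptimalPruning e d l i (fl i) (bl i))
    (hr : ∀ i, 1 ≤ i → i < j → IsOptimalPruning e d r i (fr i) (br i)) (hj : 1 ≤ j)
    {v : ℝ} {b : ι → ℕ} (hv : v ≤ dsum d (l.points ∪ r.points) (l.points ∪ r.points))
    (hv' : ∀ i, 1 ≤ i → i < j → v ≤ fl i + fr (j - i))
    (hb : (v = dsum d (l.points ∪ r.points) (l.points ∪ r.points) ∧
        ∃ y ∈ l.points, ∀ x ∈ l.points ∪ r.points, b x = e y) ∨
      ∃ i, 1 ≤ i ∧ i < j ∧ v = fl i + fr (j - i) ∧ (∀ x ∈ l.points, b x = bl i x) ∧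
        ∀ x ∈ r.points, b x = br (j - i) x) :
    IsOptimalPruning e d (.node l r) j v b := by
  refine ⟨?_, ?_⟩
  · rcases hb with ⟨hv0, y, hy, hb⟩ | ⟨i, hi1, hij, hvi, hbl, hbr⟩
    · refine ⟨{l.points ∪ r.points}, IsPruning.root (.node l r), by simpa using hj, ?_,
        fun x hx => ⟨y, Finset.mem_union_left _ hy, hb x hx⟩, fun x hx z hz => ?_⟩
      · rw [minSumCost_singleton, hv0]
      · rw [hb x hx, hb z hz]
        simp only [true_iff]
        exact ⟨_, Finset.mem_singleton_self _, hx, hz⟩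
    · obtain ⟨⟨P, p1, p2, p3, p4, p5⟩, -⟩ := hl i hi1 hij
      obtain ⟨⟨Q, q1, q2, q3, q4, q5⟩, -⟩ := hr (j - i) (by omega) (by omega)
      have hdis := p1.disjoint q1 hW
      -- Labels are points of the respective subtree, so labels from the two sides never coincide
      -- and the labellings can be put together without renaming.
      have hcross : ∀ x ∈ l.points, ∀ z ∈ r.points, b x ≠ b z ∧ ¬ ∃ A ∈ P ∪ Q, x ∈ A ∧ z ∈ A := by
        intro x hx z hz
        constructor
        · rw [hbl x hx, hbr z hz]
          obtain ⟨y, hy, hy'⟩ := p4 x hx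
          obtain ⟨w, hw, hw'⟩ := q4 z hz
          rw [hy', hw']
          intro heq
          exact Finset.disjoint_left.1 hW.2.2 hy (he heq ▸ hw)
        · rintro ⟨A, hA, hxA, hzA⟩
          rcases Finset.mem_union.1 hA with hA | hA
          · exact Finset.disjoint_left.1 hW.2.2 (p1.subset A hA hzA) hz
          · exact Finset.disjoint_left.1 hW.2.2 hx (q1.subset A hA hxA)
      refine ⟨P ∪ Q, IsPruning.split l r P Q p1 q1, ?_, ?_, ?_, ?_⟩
      · rw [Finset.card_union_of_disjoint hdis]; omega
      · rw [minSumCost_union d hdis, p3, q3, hvi]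
      · intro x hx
        rcases Finset.mem_union.1 hx with hx | hx
        · obtain ⟨y, hy, hy'⟩ := p4 x hx
          exact ⟨y, Finset.mem_union_left _ hy, (hbl x hx).trans hy'⟩
        · obtain ⟨y, hy, hy'⟩ := q4 x hx
          exact ⟨y, Finset.mem_union_right _ hy, (hbr x hx).trans hy'⟩
      · intro x hx z hz
        rcases Finset.mem_union.1 hx with hx | hx <;> rcases Finset.mem_union.1 hz with hz | hz
        · rw [hbl x hx, hbl z hz, p5 x hx z hz]
          constructor
          · rintro ⟨A, hA, h⟩
            exact ⟨A, Finset.mem_union_left _ hA, h⟩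
          · rintro ⟨A, hA, h⟩
            rcases Finset.mem_union.1 hA with hA | hA
            · exact ⟨A, hA, h⟩
            · exact absurd (q1.subset A hA h.1) (Finset.disjoint_left.1 hW.2.2 hx)
        · obtain ⟨h1, h2⟩ := hcross x hx z hz
          exact ⟨fun h => absurd h h1, fun h => absurd h h2⟩
        · obtain ⟨h1, h2⟩ := hcross z hz x hx
          exact ⟨fun h => absurd h.symm h1, fun ⟨A, hA, h, h'⟩ => absurd ⟨A, hA, h', h⟩ h2⟩
        · rw [hbr x hx, hbr z hz, q5 x hx z hz]
          constructor
          · rintro ⟨A, hA, h⟩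
            exact ⟨A, Finset.mem_union_right _ hA, h⟩
          · rintro ⟨A, hA, h⟩
            rcases Finset.mem_union.1 hA with hA | hA
            · exact absurd hx (Finset.disjoint_left.1 hW.2.2 (p1.subset A hA h.1))
            · exact ⟨A, hA, h⟩
  · intro R hR hcard
    cases hR with
    | root => exact hv.trans (minSumCost_singleton _).ge
    -- Both parts are nonempty, so each has fewer than `j` clusters. If the left one uses `|P|`, at
    -- most `j - |P|` are left for the right one, and this split was compared.
    | split _ _ P Q hP hQ =>
      have hdis := hP.disjoint hQ hW
      rw [Finset.card_union_of_disjoint hdis] at hcard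
      have hp := hP.nonempty.card_pos
      have hq := hQ.nonempty.card_pos
      rw [minSumCost_union d hdis]
      have h1 := (hl P.card hp (by omega)).2 P hP le_rfl
      have h2 := (hr (j - P.card) (by omega) (by omega)).2 Q hQ (by omega)
      linarith [hv' P.card hp (by omega)]

end Optimal

/-! ### The dynamic program inside the machine -/

namespace RealRAM

namespace AvgLink

variable {n k m : ℕ} {d : Fin n → Fin n → ℝ}

theorem bestSplit_spec {s : State} (h1 : s.nat 0 0 1 = k) {l r j : ℕ} (h6 : s.nat 6 0 0 = l)
    (h7 : s.nat 7 0 0 = r) (h8 : s.nat 8 0 0 = j) :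
    let c := s.real 1 l l + s.real 1 l r + (s.real 1 r l + s.real 1 r r)
    let v := (bestSplit.exec s).real 3 0 0
    let i := (bestSplit.exec s).nat 9 0 0
    (i = 0 ∧ v = c ∨ 1 ≤ i ∧ i < j ∧ v = s.real 2 l i + s.real 2 r (j - i)) ∧ v ≤ c ∧
      ∀ i < k, 1 ≤ i → i < j → v ≤ s.real 2 l i + s.real 2 r (j - i) := by
  intro c v i
  simp only [v, i]
  rw [bestSplit, Cmd.exec_seq, Cmd.exec_seq, Cmd.exec_setReal, Cmd.exec_setNat]
  set s₀ := (s.setReal 3 _ _ _).setNat 9 _ _ _ with hs₀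
  have g : ∀ a, a ≠ 9 → s₀.nat a = s.nat a := by
    intro a ha
    rw [hs₀, State.setNat_nat_of_ne ha, State.setReal_nat]
  have g2 : s₀.real 2 = s.real 2 := by
    rw [hs₀, State.setNat_real, State.setReal_real_of_ne (by decide)]
  refine Cmd.exec_loop_induct (I := fun t s' =>
    (s'.nat 9 0 0 = 0 ∧ s'.real 3 0 0 = c ∨ 1 ≤ s'.nat 9 0 0 ∧ s'.nat 9 0 0 < j ∧
      s'.real 3 0 0 = s.real 2 l (s'.nat 9 0 0) + s.real 2 r (j - s'.nat 9 0 0)) ∧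
    s'.real 3 0 0 ≤ c ∧
      ∀ i < t, 1 ≤ i → i < j → s'.real 3 0 0 ≤ s.real 2 l i + s.real 2 r (j - i)) (N := k) ?_ ?_ ?_
  · simp [g, h1]
  · have hc : s₀.real 3 0 0 = c := by
      simp only [hs₀, c]
      simp [h6, h7]
    have h9 : s₀.nat 9 0 0 = 0 := by simp [hs₀]
    exact ⟨Or.inl ⟨h9, hc⟩, hc.le, fun i hi => absurd hi (by omega)⟩
  intro t ht s' hnat hreal ⟨hI1, hI2, hI3⟩
  have e6 : s'.nat 6 0 0 = l := by rw [hnat 6 (by decide), g 6 (by decide), h6]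
  have e7 : s'.nat 7 0 0 = r := by rw [hnat 7 (by decide), g 7 (by decide), h7]
  have e8 : s'.nat 8 0 0 = j := by rw [hnat 8 (by decide), g 8 (by decide), h8]
  have e2 : s'.real 2 = s.real 2 := by rw [hreal 2 (by decide), g2]
  by_cases hc : (Test.and (.natLt (.const 0) (cell 12)) (.and (.natLt (cell 12) (cell 8))
        (.realLt (splitCost (cell 12)) (.get 3 (.const 0) (.const 0))))).Holds (s'.setNat 12 0 0 t)
  · rw [Cmd.exec_ite_of_holds hc]
    simp only [Test.Holds, NExp.eval, cell, splitCost, RExp.eval, State.setNat_nat,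
      State.setNat_real] at hc
    norm_num [e6, e7, e8, e2] at hc
    obtain ⟨c1, c2, c3⟩ := hc
    have v3 : ((Cmd.seq (.setReal 3 (.const 0) (.const 0) (splitCost (cell 12)))
        (.setNat 9 (.const 0) (.const 0) (cell 12))).exec (s'.setNat 12 0 0 t)).real 3 0 0 =
        s.real 2 l t + s.real 2 r (j - t) := by
      simp [Cmd.exec_seq, splitCost, e6, e7, e8, e2]
    have v9 : ((Cmd.seq (.setReal 3 (.const 0) (.const 0) (splitCost (cell 12)))
        (.setNat 9 (.const 0) (.const 0) (cell 12))).exec (s'.setNat 12 0 0 t)).nat 9 0 0 = t := by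
      simp [Cmd.exec_seq, splitCost]
    rw [v3, v9]
    refine ⟨Or.inr ⟨c1, c2, rfl⟩, c3.le.trans hI2, fun i hi h1 h2 => ?_⟩
    rcases Nat.lt_succ_iff_lt_or_eq.1 hi with hi | rfl
    · exact c3.le.trans (hI3 i hi h1 h2)
    · exact le_rfl
  · rw [Cmd.exec_ite_of_not_holds hc, Cmd.exec_skip]
    simp only [Test.Holds, NExp.eval, cell, splitCost, RExp.eval, State.setNat_nat,
      State.setNat_real] at hc
    norm_num [e6, e7, e8, e2] at hc
    have w9 : (s'.setNat 12 0 0 t).nat 9 0 0 = s'.nat 9 0 0 := by simp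
    rw [w9, State.setNat_real]
    refine ⟨hI1, hI2, fun i hi h1 h2 => ?_⟩
    rcases Nat.lt_succ_iff_lt_or_eq.1 hi with hi | rfl
    · exact hI3 i hi h1 h2
    · exact hc h1 h2

theorem updateLabels_nat {s : State} (hn : s.nat 0 0 0 = n) {l r j c : ℕ} (h6 : s.nat 6 0 0 = l)
    (h7 : s.nat 7 0 0 = r) (h8 : s.nat 8 0 0 = j) (h9 : s.nat 9 0 0 = c) (hcj : c ≤ j) (x y : ℕ) :
    (updateLabels.exec s).nat 4 x y = if x < n ∧ y = j then
        if s.nat 2 x 0 = l then if c = 0 then l else s.nat 4 x c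
        else if s.nat 2 x 0 = r then if c = 0 then l else s.nat 4 x (j - c)
        else s.nat 4 x y
      else s.nat 4 x y := by
  refine Cmd.exec_loop_induct (I := fun t s' => ∀ x y, s'.nat 4 x y = if x < t ∧ y = j then
        if s.nat 2 x 0 = l then if c = 0 then l else s.nat 4 x c
        else if s.nat 2 x 0 = r then if c = 0 then l else s.nat 4 x (j - c)
        else s.nat 4 x y
      else s.nat 4 x y) (N := n) (by simpa using hn) (by simp) ?_ x y
  intro t ht s' hnat _ hI x y
  have e6 : s'.nat 6 0 0 = l := by rw [hnat 6 (by decide), h6]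
  have e7 : s'.nat 7 0 0 = r := by rw [hnat 7 (by decide), h7]
  have e8 : s'.nat 8 0 0 = j := by rw [hnat 8 (by decide), h8]
  have e9 : s'.nat 9 0 0 = c := by rw [hnat 9 (by decide), h9]
  have e2 : s'.nat 2 = s.nat 2 := hnat 2 (by decide)
  -- The passes before `t` wrote only rows with smaller index, so row `t` can still be read as it
  -- was.
  have et : ∀ y, s'.nat 4 t y = s.nat 4 t y := fun y => by rw [hI]; simp
  have key : ((Cmd.ite (.natEq (lab (cell 12)) (cell 6))
      (.ite (.natEq (cell 9) (.const 0)) (.setNat 4 (cell 12) (cell 8) (cell 6))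
        (.setNat 4 (cell 12) (cell 8) (.get 4 (cell 12) (cell 9)))) <|
    .ite (.natEq (lab (cell 12)) (cell 7))
      (.ite (.natEq (cell 9) (.const 0)) (.setNat 4 (cell 12) (cell 8) (cell 6))
        (.setNat 4 (cell 12) (cell 8) (.get 4 (cell 12) (.sub (cell 8) (cell 9)))))
      .skip).exec (s'.setNat 12 0 0 t)).nat 4 x y = if x = t ∧ y = j then
        if s.nat 2 t 0 = l then if c = 0 then l else s.nat 4 t c
        else if s.nat 2 t 0 = r then if c = 0 then l else s.nat 4 t (j - c)
        else s.nat 4 t y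
      else s'.nat 4 x y := by
    by_cases hl : s.nat 2 t 0 = l
    · rw [Cmd.exec_ite_of_holds (by simp [e6, e2, hl])]
      by_cases hc : c = 0
      · rw [Cmd.exec_ite_of_holds (by simp [e9, hc])]
        simp [e6, e8, hl, hc]
      · rw [Cmd.exec_ite_of_not_holds (by simp [e9, hc])]
        simp [e8, e9, hl, hc, et]
    · rw [Cmd.exec_ite_of_not_holds (by simp [e6, e2, hl])]
      by_cases hr : s.nat 2 t 0 = r
      · rw [Cmd.exec_ite_of_holds (by simp [e7, e2, hr])]
        by_cases hc : c = 0
        · rw [Cmd.exec_ite_of_holds (by simp [e9, hc])]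
          have hl' : r ≠ l := by rw [← hr]; exact hl
          simp [e6, e8, hl', hr, hc]
        · rw [Cmd.exec_ite_of_not_holds (by simp [e9, hc])]
          have hl' : r ≠ l := by rw [← hr]; exact hl
          simp [e8, e9, hl', hr, hc, et]
      · rw [Cmd.exec_ite_of_not_holds (by simp [e7, e2, hr]), Cmd.exec_skip]
        simp [hl, hr]
        rintro rfl rfl
        exact et _
  rw [key, hI]
  grind

/-- The state represents a forest, with the optimal prunings of its trees. -/
structure RepresentsForest (k : ℕ) (d : Fin n → Fin n → ℝ) (s : State)
    (tr : ℕ → ClusterTree (Fin n)) : Prop where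
  rep : Represents d s
  points : ∀ a : Fin n, (tr (s.nat 2 a 0)).points = cluster n s (s.nat 2 a 0)
  wf : ∀ a : Fin n, (tr (s.nat 2 a 0)).WF
  opt : ∀ (a : Fin n) (j : ℕ), 1 ≤ j → j ≤ k → IsOptimalPruning Fin.val d (tr (s.nat 2 a 0)) j
    (s.real 2 (s.nat 2 a 0) j) fun x => s.nat 4 x j

/-- The tables of the two subtrees are overwritten in place. This is safe because `j` runs downwards
from `k` to `1`, while the recursion at `j` reads only smaller indices. -/
theorem pruneCmd_spec {s : State} {tr : ℕ → ClusterTree (Fin n)} (h : HasInput n k m d s)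
    (hF : RepresentsForest k d s tr) {u v : Fin n} (hu : s.nat 6 0 0 = s.nat 2 u 0)
    (hv : s.nat 7 0 0 = s.nat 2 v 0) (hne : s.nat 2 u 0 ≠ s.nat 2 v 0) :
    (∀ j, 1 ≤ j → j ≤ k → IsOptimalPruning Fin.val d
      (.node (tr (s.nat 2 u 0)) (tr (s.nat 2 v 0))) j ((pruneCmd.exec s).real 2 (s.nat 2 u 0) j)
      fun x => (pruneCmd.exec s).nat 4 x j) ∧
    (∀ i j, i ≠ s.nat 2 u 0 → (pruneCmd.exec s).real 2 i j = s.real 2 i j) ∧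
    (∀ x j, s.nat 2 x 0 ≠ s.nat 2 u 0 → s.nat 2 x 0 ≠ s.nat 2 v 0 →
      (pruneCmd.exec s).nat 4 x j = s.nat 4 x j) := by
  set l := s.nat 2 u 0 with hl
  set r := s.nat 2 v 0 with hr
  have key : (∀ j, 1 ≤ j → j ≤ k → k - k < j → IsOptimalPruning Fin.val d
      (.node (tr l) (tr r)) j ((pruneCmd.exec s).real 2 l j)
      fun x => (pruneCmd.exec s).nat 4 x j) ∧
    (∀ i j, (i ≠ l ∨ j ≤ k - k) → (pruneCmd.exec s).real 2 i j = s.real 2 i j) ∧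
    (∀ x j, (s.nat 2 x 0 ≠ l ∧ s.nat 2 x 0 ≠ r ∨ j ≤ k - k) →
      (pruneCmd.exec s).nat 4 x j = s.nat 4 x j) := by
    refine Cmd.exec_loop_induct (I := fun t s' =>
      (∀ j, 1 ≤ j → j ≤ k → k - t < j → IsOptimalPruning Fin.val d
        (.node (tr l) (tr r)) j (s'.real 2 l j) fun x => s'.nat 4 x j) ∧
      (∀ i j, (i ≠ l ∨ j ≤ k - t) → s'.real 2 i j = s.real 2 i j) ∧
      (∀ x j, (s.nat 2 x 0 ≠ l ∧ s.nat 2 x 0 ≠ r ∨ j ≤ k - t) →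
        s'.nat 4 x j = s.nat 4 x j)) (N := k) (by simpa using h.clusters) ?_ ?_
    · exact ⟨fun j _ h1 h2 => absurd h1 (by omega), fun _ _ _ => rfl, fun _ _ _ => rfl⟩
    intro t ht s₁ hnat₁ hreal₁ ⟨hI1, hI2, hI3⟩
    set j₀ := k - t with hj₀
    rw [Cmd.exec_seq, Cmd.exec_seq, Cmd.exec_seq, Cmd.exec_setNat, Cmd.exec_setReal]
    set s₂ := (s₁.setNat 11 0 0 t).setNat 8 _ _ _ with hs₂
    have e0 : s₁.nat 0 = s.nat 0 := hnat₁ 0 (by decide)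
    have g : ∀ a, a ≠ 11 → a ≠ 8 → s₂.nat a = s₁.nat a := by
      intro a h11 h8
      rw [hs₂, State.setNat_nat_of_ne h8, State.setNat_nat_of_ne h11]
    have g8 : s₂.nat 8 0 0 = j₀ := by simp [hs₂, e0, h.clusters, hj₀]
    have g6 : s₂.nat 6 0 0 = l := by
      rw [g 6 (by decide) (by decide), hnat₁ 6 (by decide), hu]
    have g7 : s₂.nat 7 0 0 = r := by
      rw [g 7 (by decide) (by decide), hnat₁ 7 (by decide), hv]
    have g01 : s₂.nat 0 0 1 = k := by rw [g 0 (by decide) (by decide), e0, h.clusters]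
    have greal : s₂.real = s₁.real := rfl
    have hbs := bestSplit_spec g01 g6 g7 g8
    set s₃ := bestSplit.exec s₂ with hs₃
    simp only [greal, hreal₁ 1 (by decide)] at hbs
    obtain ⟨hb1, hb2, hb3⟩ := hbs
    have f : ∀ a, bestSplit.writesNat a = false → s₃.nat a = s₂.nat a :=
      fun a ha => Cmd.exec_nat_of_writesNat ha s₂
    have fr : ∀ a, bestSplit.writesReal a = false → s₃.real a = s₂.real a :=
      fun a ha => Cmd.exec_real_of_writesReal ha s₂
    set c := s₃.nat 9 0 0 with hc
    set w := s₃.real 3 0 0 with hw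
    have i6 : s₃.nat 6 0 0 = l := by rw [f 6 (by decide), g6]
    have i7 : s₃.nat 7 0 0 = r := by rw [f 7 (by decide), g7]
    have i8 : s₃.nat 8 0 0 = j₀ := by rw [f 8 (by decide), g8]
    have i2 : s₃.nat 2 = s.nat 2 := by
      rw [f 2 (by decide), g 2 (by decide) (by decide), hnat₁ 2 (by decide)]
    have i4 : s₃.nat 4 = s₁.nat 4 := by rw [f 4 (by decide), g 4 (by decide) (by decide)]
    have i0 : s₃.nat 0 0 0 = n := by
      rw [f 0 (by decide), g 0 (by decide) (by decide), e0, h.size]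
    have r2 : s₃.real 2 = s₁.real 2 := by rw [fr 2 (by decide), greal]
    have hcj : c ≤ j₀ := by
      rcases hb1 with ⟨h1, _⟩ | ⟨_, h1, _⟩ <;> omega
    have hj1 : 1 ≤ j₀ := by omega
    set s₄ := s₃.setReal 2 ((cell 6).eval s₃) ((cell 8).eval s₃)
      ((RExp.get 3 (.const 0) (.const 0)).eval s₃) with hs₄
    have hlab := updateLabels_nat (s := s₄) i0 i6 i7 i8 rfl hcj
    have hfin2 : ∀ i j, (updateLabels.exec s₄).real 2 i j =
        if i = l ∧ j = j₀ then w else s₁.real 2 i j := by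
      intro i j
      rw [Cmd.exec_real_of_writesReal (by decide), hs₄]
      simp [i6, i8, r2, hw]
    have hfin4 : ∀ x y, (updateLabels.exec s₄).nat 4 x y = if x < n ∧ y = j₀ then
        if s.nat 2 x 0 = l then if c = 0 then l else s₁.nat 4 x c
        else if s.nat 2 x 0 = r then if c = 0 then l else s₁.nat 4 x (j₀ - c)
        else s₁.nat 4 x y
      else s₁.nat 4 x y := by
      intro x y
      rw [hlab x y]
      simp only [hs₄, State.setReal_nat, i2, i4]
      rfl
    refine ⟨fun j h1 h2 h3 => ?_, fun i j hij => ?_, fun x j hx => ?_⟩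
    · by_cases hjj : j = j₀
      · subst hjj
        have hval : (updateLabels.exec s₄).real 2 l j₀ = w := by rw [hfin2]; simp
        rw [hval]
        have hdis : Disjoint (tr l).points (tr r).points := by
          rw [hl, hr, hF.points u, hF.points v]
          exact cluster_disjoint s hne
        have hcost : s.real 1 l l + s.real 1 l r + (s.real 1 r l + s.real 1 r r) =
            dsum d ((tr l).points ∪ (tr r).points) ((tr l).points ∪ (tr r).points) := by
          rw [dsum_union_left d hdis, dsum_union_right d _ hdis, dsum_union_right d _ hdis,
            hl, hr, hF.points u, hF.points v, hF.rep.sum, hF.rep.sum, hF.rep.sum, hF.rep.sum]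
        rw [hcost] at hb1 hb2
        -- Entries at or below the current index have not been overwritten yet, so the recursion
        -- sees the tables of the children.
        have hold : ∀ i j, j ≤ j₀ → s₁.real 2 i j = s.real 2 i j :=
          fun i j hj => hI2 i j (Or.inr hj)
        have hold4 : ∀ x j, j ≤ j₀ → s₁.nat 4 x j = s.nat 4 x j :=
          fun x j hj => hI3 x j (Or.inr hj)
        have hmeml : ∀ x : Fin n, x ∈ (tr l).points → s.nat 2 x 0 = l := by
          intro x hx
          rwa [hl, hF.points u, mem_cluster, ← hl] at hx
        have hmemr : ∀ x : Fin n, x ∈ (tr r).points → s.nat 2 x 0 = r := by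
          intro x hx
          rwa [hr, hF.points v, mem_cluster, ← hr] at hx
        refine IsOptimalPruning.node Fin.val_injective
          (show (ClusterTree.node (tr l) (tr r)).WF from ⟨hF.wf u, hF.wf v, hdis⟩)
          (fl := s.real 2 l) (fr := s.real 2 r) (bl := fun i x => s.nat 4 x i)
          (br := fun i x => s.nat 4 x i)
          (fun i hi hij => hF.opt u i hi (by omega)) (fun i hi hij => hF.opt v i hi (by omega))
          hj1 hb2 (fun i hi hij => ?_) ?_
        · rw [← hold l i hij.le, ← hold r (j₀ - i) (Nat.sub_le _ _)]
          exact hb3 i (by omega) hi hij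
        · rcases hb1 with ⟨hc0, hw0⟩ | ⟨hc1, hc2, hw1⟩
          · left
            refine ⟨hw0, ⟨l, hF.rep.lab_lt u⟩, ?_, ?_⟩
            · exact ((Finset.ext_iff.1 (hF.points u)) _).2 (mem_cluster.2 (hF.rep.lab_lab u))
            · intro x hx
              rw [hfin4]
              rcases Finset.mem_union.1 hx with hx | hx
              · simp [hmeml x hx, hc0]
              · have hrl : r ≠ l := hne.symm
                simp [hmemr x hx, hc0, hrl]
          · right
            have hc0 : c ≠ 0 := by omega
            refine ⟨c, hc1, hc2, ?_, fun x hx => ?_, fun x hx => ?_⟩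
            · rw [hw1, hold l c hcj, hold r _ (Nat.sub_le _ _)]
            · rw [hfin4]
              simp [hmeml x hx, hc0, hold4 _ c hcj]
            · have hrl : r ≠ l := hne.symm
              rw [hfin4]
              simp [hmemr x hx, hc0, hrl, hold4 _ (j₀ - c) (Nat.sub_le _ _)]
      · have hval : (updateLabels.exec s₄).real 2 l j = s₁.real 2 l j := by
          rw [hfin2, if_neg (fun hc => hjj hc.2)]
        have hval4 : ∀ x : Fin n, (updateLabels.exec s₄).nat 4 x j = s₁.nat 4 x j := by
          intro x
          rw [hfin4, if_neg (fun hc => hjj hc.2)]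
        rw [hval]
        exact (hI1 j h1 h2 (by omega)).congr fun x _ => hval4 x
    · rw [hfin2, if_neg (by rintro ⟨h1, h2⟩; omega)]
      exact hI2 i j (by omega)
    · rw [hfin4, ← hI3 x j (by omega)]
      split_ifs <;> first | rfl | omega
  refine ⟨fun j h1 h2 => key.1 j h1 h2 (by omega), fun i j hi => key.2.1 i j (Or.inl hi),
    fun x j h1 h2 => key.2.2 x j (Or.inl ⟨h1, h2⟩)⟩

end AvgLink

end RealRAM

/-! ### The main loop and the output -/

namespace RealRAM

namespace AvgLink

variable {n k m : ℕ} {d : Fin n → Fin n → ℝ}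

/-- The forest represented by a state. -/
def forest (n : ℕ) (s : State) (tr : ℕ → ClusterTree (Fin n)) : Set (ClusterTree (Fin n)) :=
  Set.range fun a : Fin n => tr (s.nat 2 a 0)

/-- The labels in use. -/
def labels (n : ℕ) (s : State) : Finset ℕ := univ.image fun a : Fin n => s.nat 2 a 0

theorem RepresentsForest.congr {s s' : State} {tr : ℕ → ClusterTree (Fin n)}
    (h : RepresentsForest k d s tr) (h2 : s'.nat 2 = s.nat 2) (h3 : s'.nat 3 = s.nat 3)
    (h4 : s'.nat 4 = s.nat 4) (hr1 : s'.real 1 = s.real 1) (hr2 : s'.real 2 = s.real 2) :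
    RepresentsForest k d s' tr := by
  have hc : cluster n s' = cluster n s := by unfold cluster; rw [h2]
  refine ⟨h.rep.congr h2 h3 hr1, ?_, ?_, ?_⟩ <;> simp only [h2, hc, h4, hr2]
  exacts [h.points, h.wf, h.opt]

theorem RepresentsForest.tree_inj {s : State} {tr : ℕ → ClusterTree (Fin n)}
    (h : RepresentsForest k d s tr) {a b : Fin n} (hab : tr (s.nat 2 a 0) = tr (s.nat 2 b 0)) :
    s.nat 2 a 0 = s.nat 2 b 0 := by
  have h1 : a ∈ (tr (s.nat 2 a 0)).points := by rw [h.points]; exact mem_cluster.2 rfl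
  rw [hab, h.points, mem_cluster] at h1
  exact h1

/-- One pass of the main loop that merges the clusters with the labels of `u` and `v`. -/
theorem merge_spec {s : State} {tr : ℕ → ClusterTree (Fin n)} (h : HasInput n k m d s)
    (hF : RepresentsForest k d s tr) {u v : Fin n} (hu : s.nat 6 0 0 = s.nat 2 u 0)
    (hv : s.nat 7 0 0 = s.nat 2 v 0) (hne : s.nat 2 u 0 ≠ s.nat 2 v 0)
    (hmin : ∀ a b : Fin n, s.nat 2 a 0 ≠ s.nat 2 b 0 →
        davg d (cluster n s (s.nat 2 u 0)) (cluster n s (s.nat 2 v 0)) ≤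
          davg d (cluster n s (s.nat 2 a 0)) (cluster n s (s.nat 2 b 0))) :
    ∃ tr', RepresentsForest k d ((Cmd.seq pruneCmd unionCmd).exec s) tr' ∧
      MergeStep d (forest n s tr) (forest n ((Cmd.seq pruneCmd unionCmd).exec s) tr') ∧
      (labels n ((Cmd.seq pruneCmd unionCmd).exec s)).card + 1 ≤ (labels n s).card := by
  rw [Cmd.exec_seq]
  obtain ⟨hp1, hp2, hp3⟩ := pruneCmd_spec h hF hu hv hne
  set s₁ := pruneCmd.exec s with hs₁
  have f : ∀ a, pruneCmd.writesNat a = false → s₁.nat a = s.nat a :=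
    fun a ha => Cmd.exec_nat_of_writesNat ha s
  have f2 := f 2 (by decide)
  have f3 := f 3 (by decide)
  have r1 : s₁.real 1 = s.real 1 := Cmd.exec_real_of_writesReal (by decide) s
  have h0 : s₁.nat 0 0 0 = n := by rw [f 0 (by decide), h.size]
  have h6 : s₁.nat 6 0 0 = s₁.nat 2 u 0 := by rw [f 6 (by decide), f2, hu]
  have h7 : s₁.nat 7 0 0 = s₁.nat 2 v 0 := by rw [f 7 (by decide), f2, hv]
  have hne₁ : s₁.nat 2 u 0 ≠ s₁.nat 2 v 0 := by rw [f2]; exact hne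
  have hcl₁ : cluster n s₁ = cluster n s := by unfold cluster; rw [f2]
  have hrep := (hF.rep.congr f2 f3 r1).union h0 h6 h7 hne₁
  have hlab := fun i => unionCmd_lab h0 (by rw [h6, h7]; exact hne₁) (i := i)
  have hclu := fun p => cluster_unionCmd h0 (by rw [h6, h7]; exact hne₁) (p := p)
  have k4 : (unionCmd.exec s₁).nat 4 = s₁.nat 4 := Cmd.exec_nat_of_writesNat (by decide) s₁
  have k2 : (unionCmd.exec s₁).real 2 = s₁.real 2 := Cmd.exec_real_of_writesReal (by decide) s₁
  set s₂ := unionCmd.exec s₁ with hs₂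
  simp only [h6, h7, f2, hcl₁] at hlab hclu
  set l := s.nat 2 u 0 with hl
  set r := s.nat 2 v 0 with hr
  have hlab' : ∀ a : Fin n, s₂.nat 2 a 0 = if s.nat 2 a 0 = r then l else s.nat 2 a 0 := by
    intro a; rw [hlab]; simp
  have hcase : ∀ a : Fin n, s₂.nat 2 a 0 = l ∨
      (s₂.nat 2 a 0 = s.nat 2 a 0 ∧ s.nat 2 a 0 ≠ l ∧ s.nat 2 a 0 ≠ r) := by
    intro a
    rw [hlab']
    by_cases h1 : s.nat 2 a 0 = r
    · simp [h1]
    · by_cases h2 : s.nat 2 a 0 = l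
      · simp [h2]
      · exact Or.inr ⟨by rw [if_neg h1], h2, h1⟩
  have hu₂ : s₂.nat 2 u 0 = l := by rw [hlab', ← hl, if_neg hne]
  have hdis : Disjoint (tr l).points (tr r).points := by
    rw [hl, hr, hF.points u, hF.points v]
    exact cluster_disjoint s hne
  -- The new tree takes the surviving label `l`; the tree stored at `r` remains but no point refers
  -- to it.
  set tr' := Function.update tr l (.node (tr l) (tr r)) with htr'
  have htl : tr' l = .node (tr l) (tr r) := by rw [htr', Function.update_self]
  have hto : ∀ {p}, p ≠ l → tr' p = tr p := fun hp => by
    rw [htr', Function.update_of_ne hp]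
  refine ⟨tr', ⟨hrep, fun a => ?_, fun a => ?_, fun a j hj hjk => ?_⟩, ?_, ?_⟩
  · rcases hcase a with ha | ⟨ha, hal, har⟩
    · rw [ha, htl, hclu, if_pos rfl]
      exact congrArg₂ _ (hF.points u) (hF.points v)
    · rw [ha, hto hal, hclu, if_neg hal, if_neg har, hF.points]
  · rcases hcase a with ha | ⟨ha, hal, har⟩
    · rw [ha, htl]
      exact ⟨hF.wf u, hF.wf v, hdis⟩
    · rw [ha, hto hal]
      exact hF.wf a
  · rw [k4, k2]
    rcases hcase a with ha | ⟨ha, hal, har⟩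
    · rw [ha, htl]
      exact hp1 j hj hjk
    · rw [ha, hto hal, hp2 _ _ hal]
      refine (hF.opt a j hj hjk).congr fun x hx => ?_
      rw [hF.points, mem_cluster] at hx
      exact hp3 x j (by rw [hx]; exact hal) (by rw [hx]; exact har)
  · refine ⟨tr l, ⟨u, rfl⟩, tr r, ⟨v, rfl⟩, fun he => hne (hF.tree_inj he), ?_, ?_⟩
    · rintro _ ⟨a, rfl⟩ _ ⟨b, rfl⟩ hab
      have hab' : s.nat 2 a 0 ≠ s.nat 2 b 0 := fun hc => hab (by simp only [hc])
      have := hmin a b hab'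
      dsimp only
      rw [hF.points a, hF.points b, show (tr l).points = _ from hF.points u,
        show (tr r).points = _ from hF.points v]
      exact this
    · ext T
      simp only [forest, Set.mem_range, Set.mem_insert_iff, Set.mem_sdiff, Set.mem_singleton_iff,
        not_or]
      constructor
      · rintro ⟨a, rfl⟩
        rcases hcase a with ha | ⟨ha, hal, har⟩
        · left; rw [ha, htl]
        · right
          rw [ha, hto hal]
          exact ⟨⟨a, rfl⟩, fun he => hal (hF.tree_inj (b := u) he),
            fun he => har (hF.tree_inj (b := v) he)⟩
      · rintro (rfl | ⟨⟨a, rfl⟩, h1, h2⟩)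
        · exact ⟨u, by rw [hu₂, htl]⟩
        · have hal : s.nat 2 a 0 ≠ l := fun hc => h1 (by rw [hc])
          have har : s.nat 2 a 0 ≠ r := fun hc => h2 (by rw [hc])
          refine ⟨a, ?_⟩
          rw [hlab', if_neg har, hto hal]
  · have hsub : labels n s₂ ⊆ (labels n s).erase r := by
      intro p hp
      obtain ⟨a, _, rfl⟩ := Finset.mem_image.1 hp
      rcases hcase a with ha | ⟨ha, _, har⟩
      · simp only [ha]
        exact Finset.mem_erase.2 ⟨hne, Finset.mem_image.2 ⟨u, mem_univ _, rfl⟩⟩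
      · simp only [ha]
        exact Finset.mem_erase.2 ⟨har, Finset.mem_image.2 ⟨a, mem_univ _, rfl⟩⟩
    have hmem : r ∈ labels n s := Finset.mem_image.2 ⟨v, mem_univ _, rfl⟩
    have := Finset.card_le_card hsub
    rw [Finset.card_erase_of_mem hmem] at this
    have hpos := Finset.card_pos.2 ⟨r, hmem⟩
    omega

/-- Each pass either lowers the number of labels or finds that all labels agree. Only `n - 1` merges
can happen, so `n` passes are enough and the surplus passes do nothing. -/
theorem mergeCmd_spec (hn : 1 ≤ n) {s : State} {tr : ℕ → ClusterTree (Fin n)}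
    (h : HasInput n k m d s) (hF : RepresentsForest k d s tr) :
    ∃ tr', RepresentsForest k d (mergeCmd.exec s) tr' ∧
      Relation.ReflTransGen (MergeStep d) (forest n s tr) (forest n (mergeCmd.exec s) tr') ∧
      ∀ a b : Fin n, (mergeCmd.exec s).nat 2 a 0 = (mergeCmd.exec s).nat 2 b 0 := by
  have key : ∃ tr', RepresentsForest k d (mergeCmd.exec s) tr' ∧
      Relation.ReflTransGen (MergeStep d) (forest n s tr) (forest n (mergeCmd.exec s) tr') ∧
      ((labels n (mergeCmd.exec s)).card + n ≤ n ∨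
        ∀ a b : Fin n, (mergeCmd.exec s).nat 2 a 0 = (mergeCmd.exec s).nat 2 b 0) := by
    refine Cmd.exec_loop_induct (I := fun t s' => ∃ tr', RepresentsForest k d s' tr' ∧
      Relation.ReflTransGen (MergeStep d) (forest n s tr) (forest n s' tr') ∧
      ((labels n s').card + t ≤ n ∨ ∀ a b : Fin n, s'.nat 2 a 0 = s'.nat 2 b 0)) (N := n)
      (by simpa using h.size) ?_ ?_
    · refine ⟨tr, hF, Relation.ReflTransGen.refl, Or.inl ?_⟩
      have := Finset.card_image_le (s := univ) (f := fun a : Fin n => s.nat 2 a 0)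
      rw [Finset.card_univ, Fintype.card_fin] at this
      exact this
    rintro t _ s₁ hnat₁ hreal₁ ⟨tr₁, hF₁, hstep₁, hcard₁⟩
    have hin₁ : HasInput n k m d (s₁.setNat 10 0 0 t) := by
      refine h.congr ?_ (hreal₁ 0 (by decide))
      rw [State.setNat_nat_of_ne (by decide), hnat₁ 0 (by decide)]
    set s₂ := s₁.setNat 10 0 0 t with hs₂
    have hlab₂ : s₂.nat 2 = s₁.nat 2 := State.setNat_nat_of_ne (by decide) _ _ _ _
    have hF₂ : RepresentsForest k d s₂ tr₁ := hF₁.congr hlab₂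
      (State.setNat_nat_of_ne (by decide) _ _ _ _) (State.setNat_nat_of_ne (by decide) _ _ _ _)
      rfl rfl
    have hspec := findCmd_spec hin₁ hF₂.rep
    rw [Cmd.exec_seq]
    set s₃ := findCmd.exec s₂ with hs₃
    have f : ∀ a, findCmd.writesNat a = false → s₃.nat a = s₂.nat a :=
      fun a ha => Cmd.exec_nat_of_writesNat ha s₂
    have fr : ∀ a, findCmd.writesReal a = false → s₃.real a = s₂.real a :=
      fun a ha => Cmd.exec_real_of_writesReal ha s₂
    have hlab₃ : s₃.nat 2 = s₂.nat 2 := f 2 (by decide)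
    have hF₃ : RepresentsForest k d s₃ tr₁ := hF₂.congr hlab₃ (f 3 (by decide)) (f 4 (by decide))
      (fr 1 (by decide)) (fr 2 (by decide))
    have hin₃ : HasInput n k m d s₃ := hin₁.congr (f 0 (by decide)) (fr 0 (by decide))
    have hfor : forest n s₃ tr₁ = forest n s₁ tr₁ := by
      unfold forest; rw [hlab₃, hlab₂]
    have hlabels : labels n s₃ = labels n s₁ := by
      unfold labels; rw [hlab₃, hlab₂]
    have hcl₃ : cluster n s₂ = cluster n s₃ := by unfold cluster; rw [hlab₃]
    rcases hspec with ⟨heq, hall⟩ | ⟨u, v, hu, hv, hne, hmin⟩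
    · rw [Cmd.exec_ite_of_not_holds (by simpa using heq), Cmd.exec_skip]
      refine ⟨tr₁, hF₃, by rw [hfor]; exact hstep₁, Or.inr ?_⟩
      rw [hlab₃]
      exact hall
    · have hne' : s₃.nat 6 0 0 ≠ s₃.nat 7 0 0 := by rw [hu, hv]; exact hne
      rw [Cmd.exec_ite_of_holds (by simpa using hne')]
      rw [← hlab₃] at hu hv hne hmin
      rw [hcl₃] at hmin
      obtain ⟨tr', hF', hms, hcard'⟩ := merge_spec hin₃ hF₃ hu hv hne hmin
      rw [hfor] at hms
      rw [hlabels] at hcard'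
      refine ⟨tr', hF', hstep₁.tail hms, Or.inl ?_⟩
      rcases hcard₁ with hc | hc
      · omega
      · exact absurd (by rw [hlab₃, hlab₂]; exact hc u v) hne
  obtain ⟨tr', h1, h2, h3 | h3⟩ := key
  -- If every pass had merged, no label would be left after `n` passes.
  · exfalso
    have : 0 < (labels n (mergeCmd.exec s)).card :=
      Finset.card_pos.2 ⟨_, Finset.mem_image_of_mem _ (mem_univ (⟨0, hn⟩ : Fin n))⟩
    omega
  · exact ⟨tr', h1, h2, h3⟩

theorem outputCmd_spec {s : State} (h : HasInput n k m d s) :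
    ∀ a < n, (outputCmd.exec s).nat 1 a 0 = s.nat 4 a k := by
  refine Cmd.exec_loop_induct (I := fun t s' => ∀ a < t, s'.nat 1 a 0 = s.nat 4 a k) (N := n)
    (by simpa using h.size) (by simp) ?_
  intro t _ s' hnat _ hI a ha
  have e4 := hnat 4 (by decide)
  have e0 := hnat 0 (by decide)
  simp only [Cmd.exec_setNat, NExp.eval, cell, numClusters, State.setNat_nat, e4, e0]
  norm_num [h.clusters]
  rcases Nat.lt_succ_iff_lt_or_eq.1 ha with ha | rfl
  · rw [if_neg ha.ne]; exact hI a ha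
  · simp

theorem hasInput_input (n k m : ℕ) (d : Fin n → Fin n → ℝ) : HasInput n k m d (input n k m d) := by
  refine ⟨by simp [input], by simp [input], by simp [input], fun a b => ?_⟩
  simp [input]

theorem leaf_image_components {s : State} {nn : Fin n → Finset (Fin n)}
    (h : ∀ u v : Fin n, s.nat 2 u 0 = s.nat 2 v 0 ↔
      (SimpleGraph.fromRel fun a b => b ∈ nn a).Reachable u v) :
    ClusterTree.leaf '' components nn = forest n s fun p => .leaf (cluster n s p) := by
  ext T
  simp only [forest, Set.mem_image, Set.mem_range, components, Set.mem_ofPred_eq]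
  constructor
  · rintro ⟨A, ⟨p, hp⟩, rfl⟩
    refine ⟨p, ?_⟩
    congr 1
    ext q
    rw [hp, mem_cluster, ← h, eq_comm]
  · rintro ⟨p, rfl⟩
    refine ⟨_, ⟨p, fun q => ?_⟩, rfl⟩
    rw [mem_cluster, ← h, eq_comm]

end AvgLink

open AvgLink in
/-- The program computes an output of the average linkage algorithm. -/
theorem isAverageLinkageOutput_output {n k m : ℕ} {d : Fin n → Fin n → ℝ} (hn : 1 ≤ n)
    (hk : 1 ≤ k) (hm : m ≤ n) :
    IsAverageLinkageOutput d m k (output averageLinkage n k m d) := by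
  have h0 := hasInput_input n k m d
  obtain ⟨hrep₁, hlab₁⟩ := initCmd_spec h0
  set s₁ := initCmd.exec (input n k m d) with hs₁
  have h1 : HasInput n k m d s₁ := h0.congr (Cmd.exec_nat_of_writesNat (by decide) _)
    (Cmd.exec_real_of_writesReal (by decide) _)
  obtain ⟨hrep₂, hreach₂⟩ := componentsCmd_spec h1 hrep₁ hlab₁
  set s₂ := componentsCmd.exec s₁ with hs₂
  have h2 : HasInput n k m d s₂ := h1.congr (Cmd.exec_nat_of_writesNat (by decide) _)
    (Cmd.exec_real_of_writesReal (by decide) _)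
  have hleaves := leavesCmd_spec h2
  set s₃ := leavesCmd.exec s₂ with hs₃
  have h3 : HasInput n k m d s₃ := h2.congr (Cmd.exec_nat_of_writesNat (by decide) _)
    (Cmd.exec_real_of_writesReal (by decide) _)
  have hlab₃ : s₃.nat 2 = s₂.nat 2 := Cmd.exec_nat_of_writesNat (by decide) _
  have hcl₃ : cluster n s₃ = cluster n s₂ := by unfold cluster; rw [hlab₃]
  have hrep₃ : Represents d s₃ := hrep₂.congr hlab₃ (Cmd.exec_nat_of_writesNat (by decide) _)
    (Cmd.exec_real_of_writesReal (by decide) _)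
  have hF₃ : RepresentsForest k d s₃ fun p => .leaf (cluster n s₃ p) := by
    refine ⟨hrep₃, fun a => rfl, fun a => ⟨a, mem_cluster.2 rfl⟩, fun a j hj hjk => ?_⟩
    obtain ⟨i, rfl⟩ : ∃ i, j = i + 1 := ⟨j - 1, by omega⟩
    rw [hlab₃, hcl₃, (hleaves _ (hrep₂.lab_lt a) i (by omega)).1, hrep₂.sum]
    refine IsOptimalPruning.leaf hj (y := ⟨s₂.nat 2 a 0, hrep₂.lab_lt a⟩)
      (mem_cluster.2 (hrep₂.lab_lab a)) fun x hx => ?_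
    rw [(hleaves x x.2 i (by omega)).2]
    exact mem_cluster.1 hx
  obtain ⟨tr, hF₄, hstep, hall⟩ := mergeCmd_spec hn h3 hF₃
  set s₄ := mergeCmd.exec s₃ with hs₄
  have h4 : HasInput n k m d s₄ := h3.congr (Cmd.exec_nat_of_writesNat (by decide) _)
    (Cmd.exec_real_of_writesReal (by decide) _)
  have hout : ∀ a : Fin n, (averageLinkage.run (input n k m d)).1.nat 1 a 0 = s₄.nat 4 a k :=
    fun a => outputCmd_spec h4 a a.2
  set a₀ : Fin n := ⟨0, hn⟩
  set T := tr (s₄.nat 2 a₀ 0) with hT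
  have hforest : forest n s₄ tr = {T} := by
    ext U
    simp only [forest, Set.mem_range, Set.mem_singleton_iff]
    constructor
    · rintro ⟨a, rfl⟩
      rw [hall a a₀]
    · rintro rfl
      exact ⟨a₀, rfl⟩
  have hTu : ∀ a : Fin n, a ∈ T.points := by
    intro a
    rw [hT, hF₄.points, mem_cluster]
    exact hall a a₀
  -- The table entry of the whole tree at `j = k` describes the required pruning, and column `k` of
  -- the labels is what is written out.
  obtain ⟨⟨P, hP, hcard, hcost, -, hPb⟩, hmin⟩ := hF₄.opt a₀ k hk le_rfl
  refine ⟨nearest d m, isNearestNeighbors_nearest (by omega), T, ?_, ?_⟩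
  · have hreach₃ : ∀ u v : Fin n, s₃.nat 2 u 0 = s₃.nat 2 v 0 ↔
        (SimpleGraph.fromRel fun a b => b ∈ nearest d m a).Reachable u v := by
      rw [hlab₃]; exact hreach₂
    rw [leaf_image_components hreach₃, ← hforest]
    exact hstep
  · have hfib : output averageLinkage n k m d = P := by
      have hcls : ∀ p : Fin n, ∀ A ∈ P, p ∈ A →
          (univ.filter fun q : Fin n => s₄.nat 4 q k = s₄.nat 4 p k) = A := by
        intro p A hA hpA
        ext q
        simp only [mem_filter, mem_univ, true_and]
        rw [hPb q (hTu q) p (hTu p)]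
        constructor
        · rintro ⟨B, hB, hqB, hpB⟩
          rwa [hP.eq_of_mem (hF₄.wf a₀) A hA B hB p hpA hpB]
        · exact fun hq => ⟨A, hA, hq, hpA⟩
      ext A
      unfold output fibers
      simp only [mem_image, mem_univ, true_and, hout]
      constructor
      · rintro ⟨p, rfl⟩
        obtain ⟨B, hB, hpB⟩ := hP.exists_mem p (hTu p)
        rw [hcls p B hB hpB]
        exact hB
      · intro hA
        obtain ⟨p, hp⟩ := hP.nonempty_of_mem (hF₄.wf a₀) A hA
        exact ⟨p, hcls p A hA hp⟩
    rw [hfib]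
    exact ⟨hP, hcard, fun Q hQ hQc => hcost.le.trans (hmin Q hQ hQc)⟩

end RealRAM

/-! ### Assembly of the theorem -/

theorem mainTheorem6 :
    ∃ (prog : RealRAM.Cmd) (c K : ℝ), 0 < c ∧ 0 < K ∧
      ∀ (X : Type*) [Fintype X] [DecidableEq X] [MetricSpace X] [MeasurableSpace X]
        [MeasurableSingletonClass X] (k : ℕ) (C : Finpartition (univ : Finset X)) (α δ : ℝ),
        IsOptimalClustering (dist : X → X → ℝ) k C →
        IsPerturbationResilient (dist : X → X → ℝ) k α →
        2 ≤ minSize C →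
        6 * ((maxSize C : ℝ) / ((minSize C : ℝ) - 1)) ≤ α →
        0 < δ → δ < 1 →
        ∀ n : ℕ, c * sampleBound k C δ ≤ (n : ℝ) →
          1 - δ ≤ (sampleLaw X n).real
            {x | ∀ P, IsAverageLinkageOutput (sampleDist x) (sampleMinSize C x) k P →
              ImplicitClusteringIs x P C} ∧
          ∀ x : Fin n → X,
            IsAverageLinkageOutput (sampleDist x) (sampleMinSize C x) k
              (RealRAM.output prog n k (sampleMinSize C x) (sampleDist x)) ∧
            (RealRAM.steps prog n k (sampleMinSize C x) (sampleDist x) : ℝ) ≤ K * (n : ℝ) ^ 3 ∧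
            ∀ b : ℝ, (n : ℝ) ≤ b * sampleBound k C δ →
              (RealRAM.steps prog n k (sampleMinSize C x) (sampleDist x) : ℝ) ≤
                K * b ^ 3 * sampleBound k C δ ^ 3 := by
  refine ⟨RealRAM.averageLinkage, 600, RealRAM.averageLinkage.coef + 1, by norm_num, by positivity,
    ?_⟩
  intro X _ _ _ _ _ k C α δ hC hPR h2 hα hδ hδ1 n hn
  obtain ⟨hk1, hN, -, -, -⟩ := sampleBound_facts hC.1 h2 hδ hδ1
  have hsq := sq_card_le_sampleBound hC.1 h2 hδ hδ1
  have hk0 : (1 : ℝ) ≤ k := by exact_mod_cast hk1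
  -- From `n ≥ 600 L` and `k ^ 2 ≤ 2 L`.
  have hkn : k ≤ n := by
    have : (k : ℝ) ≤ n := by nlinarith
    exact_mod_cast this
  have hn1 : 1 ≤ n := hk1.trans hkn
  have hX : 0 < Fintype.card X := by omega
  have ht : 0 < (n : ℝ) / Fintype.card X := by
    have : (0 : ℝ) < n := by exact_mod_cast hn1
    have : (0 : ℝ) < Fintype.card X := by exact_mod_cast hX
    positivity
  have : Nonempty X := Fintype.card_pos_iff.1 hX
  refine ⟨(sampleLaw_real_representative_ge hC.1 h2 hδ hδ1 hn).trans (measureReal_mono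
    fun x hx P hP => IsRepresentative.implicitClusteringIs hx ht hC hPR h2 hα hP), fun x => ?_⟩
  have hm : sampleMinSize C x ≤ n := by
    obtain ⟨A⟩ := nonempty_parts_of_minSize h2
    exact (sampleMinSize_le x A).trans ((Finset.card_le_univ _).trans (by simp))
  have hsteps : (RealRAM.steps RealRAM.averageLinkage n k (sampleMinSize C x) (sampleDist x) : ℝ) ≤
      (RealRAM.averageLinkage.coef + 1) * (n : ℝ) ^ 3 := by
    have h1 := RealRAM.averageLinkage_run_snd_le
      (s := RealRAM.input n k (sampleMinSize C x) (sampleDist x)) hn1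
      (by simp [RealRAM.input]) (by simpa [RealRAM.input] using hkn)
    have h3 : (RealRAM.steps RealRAM.averageLinkage n k (sampleMinSize C x) (sampleDist x) : ℝ) ≤
        RealRAM.averageLinkage.coef * (n : ℝ) ^ 3 := by
      unfold RealRAM.steps
      exact_mod_cast h1
    have h4 : (0 : ℝ) ≤ (n : ℝ) ^ 3 := by positivity
    linarith
  refine ⟨RealRAM.isAverageLinkageOutput_output hn1 hk1 hm, hsteps, fun b hb => hsteps.trans ?_⟩
  rw [mul_assoc, ← mul_pow]
  have h5 : (n : ℝ) ^ 3 ≤ (b * sampleBound k C δ) ^ 3 := pow_le_pow_left₀ (Nat.cast_nonneg n) hb 3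
  exact mul_le_mul_of_nonneg_left h5 (by positivity)
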